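/- Let $q\in[0,1)$. Let $\mathsf v,\mathsf k:[0,\infty)\to(0,\infty)$ be Borel functions, $\mathsf v$ bounded and $\mathsf k$ integrable on every bounded interval (for instance piecewise continuous with one-sided limits). Let $\mathbf B\subset[0,\infty)$ be a set without accumulation points, and let $\mathsf p:\mathbf B\to[0,1]$. A configuration places finitely many particles in every interval $(0,R]$, $R>0$; particles may share a location and then form a stack. The inhomogeneous Exponential Jump Model with these parameters is the continuous-time Markov process of configurations with the following dynamics. One particle of a stack of $m$ particles at $y$ becomes active at rate $\mathsf v(y)(1-q^m)$, independently for different stacks, and active particles are injected at $0$ according to an independent Poisson process of rate $\mathsf v(0)$. A particle that becomes active at $y\ge 0$ jumps at once to the right, and it flies beyond a point $l>y$ with probability $$\exp\Big(-\int_y^l \mathsf k(s)\,ds\Big)\; q^{\#\{\text{particles in }(y,l]\}}\prod_{b\in\mathbf B,\; y<b\le l}\mathsf p(b).$$ (It may jump to $+\infty$, and then leaves the system.) Equivalently, for each $L\ge 0$, the particles in $(0,L]$ together with the number of particles that have crossed $L$ (counting injected particles that fly beyond $L$) evolve as right-continuous step functions that solve the martingale problem for the corresponding generator. Let $\psi_0(z)=\sum_{m\ge1}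 z^m/(1-q^m)$ and $(z;q)_m=\prod_{j=0}^{m-1}(1-zq^j)$ for $0\le m\le\infty$. Let $\mathcal P(u,\mathsf v,\mathsf k,\mathsf p)$ be the law of the random configuration for which the stacks on $(0,\infty)\setminus\mathbf B$ form a marked Poisson process, with locations of intensity $\mathfrak L(y)\,dy$, $\mathfrak L(y)=\mathsf k(y)\,\psi_0(u/\mathsf v(y))$, and with independent stack sizes of law $\varphi_y(m)=\dfrac{(u/\mathsf v(y))^m}{(1-q^m)\,\psi_0(u/\mathsf v(y))}$, $m\ge1$; for which the number of particles at each $b\in\mathbf B$, $b>0$, equals $m\ge 0$ with probability $$\Big(\frac{u}{\mathsf v(b)}\Big)^m\,\frac{(\mathsf p(b);q)_m}{(q;q)_m}\,\frac{(u/\mathsf v(b);q)_\infty}{(\mathsf p(b)\,u/\mathsf v(b);q)_\infty};$$ and for which the marked Poisson process and the numbers of particles at the different roadblocks are all independent. Assume that $\mathsf v(0)<\mathsf v(y)$ for all $y>0$ and that, for $u=\mathsf v(0)$, the function $\mathfrak L$ is integrable on $(0,R]$ for every $R>0$ (so that $(0,R]$ hosts finitely many particles). Then $\mathcal P(\mathsf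 v(0),\mathsf v,\mathsf k,\mathsf p)$ is stationary for the Exponential Jump Model: if the initial configuration has this law and is independent of the future injections and jumps, then so distributed is the configuration at every time $t\ge0$. Moreover, for every $L\ge0$, the process counting the particles that cross $L$ during $(0,t]$, $t\ge0$, is a Poisson process of rate $\mathsf v(0)$. -/

import Mathlib

open MeasureTheory ProbabilityTheory Filter Topology
open scoped NNReal ENNReal

namespace ExpJump

/-! ### `q`-deformed quantities -/

/-- The `q`-Pochhammer symbol `(z;q)_n = (1-z)(1-zq)...(1-zq^{n-1})`. -/
noncomputable def qPoch (q z : ℝ) (n : ℕ) : ℝ := ∏ j ∈ Finset.range n, (1 - z * q ^ j)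

/-- The infinite `q`-Pochhammer symbol `(z;q)_∞`. -/
noncomputable def qPochInf (q z : ℝ) : ℝ := ∏' j : ℕ, (1 - z * q ^ j)

/-- `ψ₀(z) = ∑_{k ≥ 1} z^k / (1 - q^k)`. -/
noncomputable def psiZero (q z : ℝ) : ℝ := ∑' k : ℕ, z ^ (k + 1) / (1 - q ^ (k + 1))

/-! ### Parameters and configurations -/

/-- Parameters of the inhomogeneous Exponential Jump Model on the half line. Only the values of
`v`, `k` on `[0, ∞)` and of `p` on `B` matter. -/
structure Params where
  /-- the deformation parameter -/
  q : ℝ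
  /-- the speed function -/
  v : ℝ → ℝ
  /-- the jumping distance function -/
  k : ℝ → ℝ
  /-- the set of roadblocks -/
  B : Set ℝ
  /-- the weights of the roadblocks -/
  p : ℝ → ℝ
  q_nonneg : 0 ≤ q
  q_lt_one : q < 1
  v_measurable : Measurable v
  v_pos : ∀ y, 0 ≤ y → 0 < v y
  v_locBdd : ∀ R : ℝ, ∃ C : ℝ, ∀ y, 0 ≤ y → y ≤ R → v y ≤ C
  k_measurable : Measurable k
  k_pos : ∀ y, 0 ≤ y → 0 < k y
  k_locInt : ∀ R : ℝ, IntegrableOn k (Set.Ioc 0 R)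
  B_nonneg : ∀ b ∈ B, 0 ≤ b
  B_locFinite : ∀ R : ℝ, (B ∩ Set.Iic R).Finite
  p_nonneg : ∀ b ∈ B, 0 ≤ p b
  p_le_one : ∀ b ∈ B, p b ≤ 1

/-- A configuration of stacks of particles on `(0, ∞)`: `count x` is the number of particles at
`x`, and every interval `(0, R]` hosts finitely many particles. -/
@[ext] structure Config where
  /-- the number of particles at a location -/
  count : ℝ → ℕ
  count_nonpos : ∀ x, x ≤ 0 → count x = 0
  locFinite : ∀ R : ℝ, {x | x ≤ R ∧ count x ≠ 0}.Finite

namespace Config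

/-- The locations in `(0, R]` that host a nonempty stack. -/
noncomputable def sites (η : Config) (R : ℝ) : Finset ℝ := (η.locFinite R).toFinset

/-- The number of particles in `(a, b]`. -/
noncomputable def num (η : Config) (a b : ℝ) : ℕ :=
  ∑ x ∈ (η.sites b).filter (fun x => a < x), η.count x

/-- The point measure `∑_x η(x) δ_x`. -/
noncomputable def toMeasure (η : Config) : Measure ℝ :=
  Measure.sum fun x : ℝ => (η.count x : ℝ≥0∞) • Measure.dirac x

/-- The usual `σ`-algebra of point processes, generated by the particle numbers of Borel sets. -/
noncomputable instance : MeasurableSpace Config := MeasurableSpace.comap toMeasure inferInstance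

open Classical in
/-- One particle of the stack at `y` (if there is any) is moved to `z`. For `y = 0` no particle is
removed, for `z = ⊤` the particle leaves the system. -/
noncomputable def move (η : Config) (y : ℝ) (z : EReal) : Config where
  count x := (if x = y then η.count x - 1 else η.count x) +
    (if 0 < x ∧ (x : EReal) = z then 1 else 0)
  count_nonpos x hx := by simp [η.count_nonpos x hx, not_lt.mpr hx]
  locFinite R := by
    refine ((η.locFinite R).union (Set.finite_singleton z.toReal)).subset ?_
    rintro x ⟨hx, hne⟩
    by_cases hz : (x : EReal) = z
    · right
      simp [← hz]
    · left
      refine ⟨hx, fun h => hne ?_⟩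
      simp [h, hz]

end Config

/-! ### Dynamics -/

namespace Params

variable (M : Params)

/-- The probability that an active particle at `y` flies beyond `l`, when the current
configuration is `η`: `e^{-K(y,l)} q^{#particles in (y,l]} ∏_{b ∈ B ∩ (y,l]} p(b)`. -/
noncomputable def surv (η : Config) (y l : ℝ) : ℝ :=
  Real.exp (-∫ t in y..l, M.k t) * M.q ^ η.num y l * ∏ᶠ b ∈ M.B ∩ Set.Ioc y l, M.p b

/-- The first location to the right of `y` at which the probability of flying beyond it is at most
`u`; it is `⊤` if there is none. -/
noncomputable def landing (η : Config) (y u : ℝ) : EReal :=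
  sInf ((fun r : ℝ => (r : EReal)) '' {r : ℝ | y < r ∧ M.surv η y r ≤ u})

/-- The law of the landing location of an active particle at `y`, obtained from the tail function
`surv` by inverse transform sampling. See `jumpLaw_Ioi`. -/
noncomputable def jumpLaw (η : Config) (y : ℝ) : Measure EReal :=
  (volume.restrict (Set.Ico (0 : ℝ) 1)).map (M.landing η y)

/-- The generator of the Exponential Jump Model, acting on functions `F η n` of the particles in
`(0, L]` and of the number `n` of particles that have crossed `L`. An active particle is injected
at `0` at rate `v(0)`; a particle of the stack at `y` becomes active at rate
`v(y) (1 - q^{η(y)})`; active particles jump according to `jumpLaw`. -/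
noncomputable def gen (L : ℝ) (F : Config → ℤ → ℝ) (η : Config) (n : ℤ) : ℝ :=
  M.v 0 * (∫ z, (F (η.move 0 z) (n + if (L : EReal) < z then 1 else 0) - F η n) ∂M.jumpLaw η 0) +
  ∑ y ∈ η.sites L, M.v y * (1 - M.q ^ η.count y) *
    ∫ z, (F (η.move y z) (n + if (L : EReal) < z then 1 else 0) - F η n) ∂M.jumpLaw η y

end Params

/-- Test functions for the window `(0, L]`: bounded measurable functions `F η n` that depend on `η`
only through the particles in `(0, L]` and that vanish when `n` plus the number of these particles
is large. -/
structure IsTestFunction (L : ℝ) (F : Config → ℤ → ℝ) : Prop where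
  measurable : ∀ n, Measurable fun η => F η n
  bounded : ∃ C : ℝ, ∀ η n, |F η n| ≤ C
  isLocal : ∀ η ξ : Config, (∀ x, x ≤ L → η.count x = ξ.count x) → ∀ n, F η n = F ξ n
  vanishes : ∃ m : ℤ, ∀ η n, m < (η.num 0 L : ℤ) + n → F η n = 0

/-- The number of particles that cross `L` during `(0, t]`, for a process `X` of configurations
in which `I t` particles are injected at `0` during `(0, t]`: those injected, minus the increase of
the number of particles in `(0, L]`. -/
noncomputable def flux {Ω : Type*} (X : ℝ≥0 → Ω → Config) (I : ℝ≥0 → Ω → ℕ) (L : ℝ) (t : ℝ≥0)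
    (ω : Ω) : ℤ :=
  (I t ω : ℤ) + (X 0 ω).num 0 L - (X t ω).num 0 L

/-- `X` is an Exponential Jump Model with parameters `M` and with number of injected particles `I`:
in every window `(0, L]` the paths are right-continuous step functions, particles only cross `L`
to the right, and the process solves the martingale problem for the generator. -/
structure IsExpJumpProcess {Ω : Type*} [mΩ : MeasurableSpace Ω] (M : Params) (μ : Measure Ω)
    (ℱ : Filtration ℝ≥0 mΩ) (X : ℝ≥0 → Ω → Config) (I : ℝ≥0 → Ω → ℕ) : Prop where
  measurable_config : ∀ t, Measurable[ℱ t] (X t)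
  measurable_inj : ∀ t, Measurable[ℱ t] (I t)
  inj_zero : ∀ ω, I 0 ω = 0
  right_cont : ∀ (ω : Ω) (L : ℝ) (t : ℝ≥0), ∀ᶠ s in 𝓝[≥] t,
    I s ω = I t ω ∧ ∀ x, x ≤ L → (X s ω).count x = (X t ω).count x
  left_lim : ∀ (ω : Ω) (L : ℝ) (t : ℝ≥0), ∃ (i : ℕ) (ξ : Config), ∀ᶠ s in 𝓝[<] t,
    I s ω = i ∧ ∀ x, x ≤ L → (X s ω).count x = ξ.count x
  flux_mono : ∀ (ω : Ω) (L : ℝ), 0 ≤ L → Monotone fun t => flux X I L t ω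
  martingale : ∀ (L : ℝ), 0 ≤ L → ∀ F : Config → ℤ → ℝ, IsTestFunction L F →
    Martingale (fun (t : ℝ≥0) (ω : Ω) => F (X t ω) (flux X I L t ω) -
      ∫ s in (0 : ℝ)..t, M.gen L F (X s.toNNReal ω) (flux X I L s.toNNReal ω)) ℱ μ

/-! ### The initial law -/

/-- The intensity `𝔏(y) φ_y(m) dy` on `S × ℤ_{≥1}` of the Poisson process of pairs
(location, mark), for a marked Poisson process on `S` with rate `𝔏` and mark laws `φ_y`. -/
noncomputable def markedIntensity (S : Set ℝ) (𝔏 : ℝ → ℝ) (φ : ℝ → ℕ → ℝ) : Measure (ℝ × ℕ) :=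
  ((volume.restrict S).prod (Measure.count.restrict {m : ℕ | 1 ≤ m})).withDensity
    fun x => ENNReal.ofReal (𝔏 x.1 * φ x.1 x.2)

/-- The number of stacks on `S` whose (location, size) lies in `C`. -/
noncomputable def numStacks (S : Set ℝ) (C : Set (ℝ × ℕ)) (η : Config) : ℕ∞ :=
  {y : ℝ | y ∈ S ∧ η.count y ≠ 0 ∧ (y, η.count y) ∈ C}.encard

/-- Under `P`, the stacks on `S` form a marked Poisson process with rate `𝔏` and mark laws `φ_y`:
the numbers of pairs (location, size) in disjoint sets are independent Poisson variables. -/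
structure IsMarkedPoisson (S : Set ℝ) (𝔏 : ℝ → ℝ) (φ : ℝ → ℕ → ℝ) (P : Measure Config) :
    Prop where
  law : ∀ C : Set (ℝ × ℕ), MeasurableSet C → markedIntensity S 𝔏 φ C ≠ ∞ →
    P.map (numStacks S C) =
      (poissonMeasure (markedIntensity S 𝔏 φ C).toNNReal).map (Nat.cast : ℕ → ℕ∞)
  indep : ∀ (n : ℕ) (C : Fin n → Set (ℝ × ℕ)), (∀ i, MeasurableSet (C i)) →
    (∀ i j, i ≠ j → Disjoint (C i) (C j)) → iIndepFun (fun i => numStacks S (C i)) P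

namespace Params

variable (M : Params)

/-- `(0, ∞)` without the roadblocks. -/
def freeSet : Set ℝ := Set.Ioi 0 \ M.B

/-- The mark law `φ_y(m) = (u/v(y))^m / (1 - q^m) / ψ₀(u/v(y))`. -/
noncomputable def markLaw (u y : ℝ) (m : ℕ) : ℝ :=
  (u / M.v y) ^ m / (1 - M.q ^ m) / psiZero M.q (u / M.v y)

/-- The rate `𝔏(y) = k(y) ψ₀(u/v(y))`. -/
noncomputable def stackRate (u y : ℝ) : ℝ := M.k y * psiZero M.q (u / M.v y)

/-- The `q`-negative binomial weights of the stack at a roadblock `b`. -/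
noncomputable def roadblockLaw (u b : ℝ) (m : ℕ) : ℝ :=
  (u / M.v b) ^ m * (qPoch M.q (M.p b) m / qPoch M.q M.q m) *
    (qPochInf M.q (u / M.v b) / qPochInf M.q (M.p b * (u / M.v b)))

/-- `P` is the law `𝒫(u, v, k, p)`: off the roadblocks the stacks form a marked Poisson process, at
the roadblocks in `(0, ∞)` the stacks are `q`-negative binomial, and all of these are
independent. -/
structure IsInitialLaw (u : ℝ) (P : Measure Config) : Prop where
  isProbabilityMeasure : IsProbabilityMeasure P
  free : IsMarkedPoisson M.freeSet (M.stackRate u) (M.markLaw u) P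
  roadblock : ∀ b ∈ M.B, 0 < b → ∀ m : ℕ,
    P {η | η.count b = m} = ENNReal.ofReal (M.roadblockLaw u b m)
  indep_roadblock : iIndepFun (fun (b : {b : ℝ // b ∈ M.B ∧ 0 < b}) (η : Config) => η.count b) P
  indep_free_roadblock : ∀ (n : ℕ) (C : Fin n → Set (ℝ × ℕ)), (∀ i, MeasurableSet (C i)) →
    IndepFun (fun (η : Config) (i : Fin n) => numStacks M.freeSet (C i) η)
      (fun (η : Config) (b : {b : ℝ // b ∈ M.B ∧ 0 < b}) => η.count b) P

end Params

/-- `N` is a Poisson process of rate `r`. -/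
structure IsPoissonProcess {Ω : Type*} [MeasurableSpace Ω] (N : ℝ≥0 → Ω → ℤ) (r : ℝ≥0)
    (μ : Measure Ω) : Prop where
  zero : ∀ᵐ ω ∂μ, N 0 ω = 0
  mono : ∀ᵐ ω ∂μ, Monotone fun t => N t ω
  right_cont : ∀ᵐ ω ∂μ, ∀ t, ∀ᶠ s in 𝓝[≥] t, N s ω = N t ω
  indep : HasIndepIncrements N μ
  law : ∀ s t, s ≤ t → μ.map (fun ω => N t ω - N s ω) =
    (poissonMeasure (r * (t - s))).map (Nat.cast : ℕ → ℤ)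

/-! ### The tail of the jump law -/

namespace Params

variable (M : Params)

lemma intervalIntegrable {a b : ℝ} (ha : 0 ≤ a) (hb : a ≤ b) :
    IntervalIntegrable M.k volume a b := by
  rw [intervalIntegrable_iff_integrableOn_Ioc_of_le hb]
  exact (M.k_locInt b).mono_set (Set.Ioc_subset_Ioc_left ha)

lemma prod_p_nonneg (y l : ℝ) : 0 ≤ ∏ᶠ b ∈ M.B ∩ Set.Ioc y l, M.p b := by
  have hf : (M.B ∩ Set.Ioc y l).Finite :=
    (M.B_locFinite l).subset fun b hb => ⟨hb.1, hb.2.2⟩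
  rw [finprod_mem_eq_finite_toFinset_prod _ hf]
  exact Finset.prod_nonneg fun b hb => M.p_nonneg b (hf.mem_toFinset.1 hb).1

lemma surv_le_one (η : Config) {y l : ℝ} (hy : 0 ≤ y) (hl : y ≤ l) : M.surv η y l ≤ 1 := by
  have h1 : Real.exp (-∫ t in y..l, M.k t) ≤ 1 := by
    rw [Real.exp_le_one_iff, neg_nonpos]
    exact intervalIntegral.integral_nonneg hl fun u hu => (M.k_pos u (hy.trans hu.1)).le
  have h2 : M.q ^ η.num y l ≤ 1 := pow_le_one₀ M.q_nonneg M.q_lt_one.le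
  have h3 : ∏ᶠ b ∈ M.B ∩ Set.Ioc y l, M.p b ≤ 1 := by
    have hf : (M.B ∩ Set.Ioc y l).Finite :=
      (M.B_locFinite l).subset fun b hb => ⟨hb.1, hb.2.2⟩
    rw [finprod_mem_eq_finite_toFinset_prod _ hf]
    exact Finset.prod_le_one (fun b hb => M.p_nonneg b (hf.mem_toFinset.1 hb).1)
      fun b hb => M.p_le_one b (hf.mem_toFinset.1 hb).1
  have h4 : 0 ≤ ∏ᶠ b ∈ M.B ∩ Set.Ioc y l, M.p b :=
    M.prod_p_nonneg _ _
  unfold surv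
  have := pow_nonneg M.q_nonneg (η.num y l)
  exact mul_le_one₀ (mul_le_one₀ h1 this h2) h4 h3

lemma surv_nonneg (η : Config) (y l : ℝ) : 0 ≤ M.surv η y l := by
  unfold surv
  have h4 : 0 ≤ ∏ᶠ b ∈ M.B ∩ Set.Ioc y l, M.p b :=
    M.prod_p_nonneg _ _
  have := pow_nonneg M.q_nonneg (η.num y l)
  positivity

/-- Just to the right of `l` the tail function is right-continuous. -/
lemma tendsto_surv (η : Config) {y l : ℝ} (hy : 0 ≤ y) (hl : y ≤ l) :
    Tendsto (fun r => M.surv η y r) (𝓝[>] l) (𝓝 (M.surv η y l)) := by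
  have hev : ∀ S : Set ℝ, (S ∩ Set.Iic (l + 1)).Finite →
      ∀ᶠ r in 𝓝[>] l, ∀ x ∈ S, x ≤ r → x ≤ l := by
    intro S hS
    have h1 : ((S ∩ Set.Iic (l + 1)) \ Set.Iic l)ᶜ ∈ 𝓝 l :=
      (hS.subset Set.sdiff_subset).isClosed.isOpen_compl.mem_nhds (by simp)
    obtain ⟨ε, hε, hball⟩ := Metric.mem_nhds_iff.1 h1
    have h2 : Set.Ioo l (l + min ε 1) ∈ 𝓝[>] l :=
      Ioo_mem_nhdsGT (by have := lt_min hε one_pos; linarith)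
    filter_upwards [h2] with r hr x hx hxr
    by_contra hlx
    push Not at hlx
    have hr2 := hr.2
    have hm1 := min_le_left ε 1
    have hm2 := min_le_right ε 1
    have : x ∈ Metric.ball l ε := by
      rw [Metric.mem_ball, Real.dist_eq, abs_lt]
      constructor <;> linarith
    exact hball this ⟨⟨hx, by simp only [Set.mem_Iic]; linarith⟩, by simpa using hlx⟩
  have e1 := hev M.B (M.B_locFinite _)
  have e2 := hev {x | η.count x ≠ 0}
    ((η.locFinite (l + 1)).subset fun x hx => ⟨hx.2, hx.1⟩)
  have hk : Tendsto (fun r => ∫ t in y..r, M.k t) (𝓝[>] l) (𝓝 (∫ t in y..l, M.k t)) := by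
    have hint : IntegrableOn M.k (Set.uIcc y (l + 1)) := by
      rw [Set.uIcc_of_le (by linarith), integrableOn_Icc_iff_integrableOn_Ioc]
      exact (M.k_locInt (l + 1)).mono_set (Set.Ioc_subset_Ioc_left hy)
    have hc := intervalIntegral.continuousOn_primitive_interval hint
    rw [Set.uIcc_of_le (by linarith)] at hc
    refine (hc l ⟨hl, by linarith⟩).mono_left (nhdsWithin_le_iff.2 ?_)
    filter_upwards [Ioo_mem_nhdsGT (show l < l + 1 by linarith)] with r hr
    exact ⟨hl.trans hr.1.le, hr.2.le⟩
  have hlim : Tendsto (fun r => Real.exp (-∫ t in y..r, M.k t) * M.q ^ η.num y l *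
      ∏ᶠ b ∈ M.B ∩ Set.Ioc y l, M.p b) (𝓝[>] l) (𝓝 (M.surv η y l)) :=
    (((Real.continuous_exp.tendsto _).comp hk.neg).mul_const _).mul_const _
  refine hlim.congr' ?_
  filter_upwards [e1, e2, self_mem_nhdsWithin] with r h1 h2 (hr : l < r)
  have hB : M.B ∩ Set.Ioc y r = M.B ∩ Set.Ioc y l := by
    ext b
    constructor
    · rintro ⟨hb, hb1, hb2⟩
      exact ⟨hb, hb1, h1 b hb hb2⟩
    · rintro ⟨hb, hb1, hb2⟩
      exact ⟨hb, hb1, hb2.trans hr.le⟩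
  have hS : η.sites r = η.sites l := by
    ext x
    simp only [Config.sites, Set.Finite.mem_toFinset, Set.mem_ofPred_eq]
    constructor
    · rintro ⟨hx, hne⟩
      exact ⟨h2 x hne hx, hne⟩
    · rintro ⟨hx, hne⟩
      exact ⟨hx.trans hr.le, hne⟩
  simp only [surv, Config.num, hB, hS]

lemma antitone_landing (η : Config) (y : ℝ) : Antitone (M.landing η y) := fun _ _ h =>
  sInf_le_sInf (Set.image_mono fun _ hr => ⟨hr.1, hr.2.trans h⟩)

instance (η : Config) (y : ℝ) : IsProbabilityMeasure (M.jumpLaw η y) := by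
  have : IsProbabilityMeasure ((volume : Measure ℝ).restrict (Set.Ico (0 : ℝ) 1)) :=
    ⟨by simp⟩
  exact Measure.isProbabilityMeasure_map (M.antitone_landing η y).measurable.aemeasurable

lemma surv_antitone (η : Config) {y l r : ℝ} (hy : 0 ≤ y) (hl : y ≤ l) (hr : l ≤ r) :
    M.surv η y r ≤ M.surv η y l := by
  have hf : (M.B ∩ Set.Ioc y r).Finite :=
    (M.B_locFinite r).subset fun b hb => ⟨hb.1, hb.2.2⟩
  have hf' : (M.B ∩ Set.Ioc y l).Finite :=
    (M.B_locFinite l).subset fun b hb => ⟨hb.1, hb.2.2⟩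
  have h1 : ∫ t in y..l, M.k t ≤ ∫ t in y..r, M.k t := by
    rw [← intervalIntegral.integral_add_adjacent_intervals (M.intervalIntegrable hy hl)
      (M.intervalIntegrable (hy.trans hl) hr), le_add_iff_nonneg_right]
    exact intervalIntegral.integral_nonneg hr fun u hu => (M.k_pos u ((hy.trans hl).trans hu.1)).le
  have h2 : η.num y l ≤ η.num y r := by
    unfold Config.num
    refine Finset.sum_le_sum_of_subset fun x hx => ?_
    simp only [Config.sites, Finset.mem_filter, Set.Finite.mem_toFinset, Set.mem_ofPred_eq] at hx ⊢
    exact ⟨⟨hx.1.1.trans hr, hx.1.2⟩, hx.2⟩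
  have h3 : ∏ᶠ b ∈ M.B ∩ Set.Ioc y r, M.p b ≤ ∏ᶠ b ∈ M.B ∩ Set.Ioc y l, M.p b := by
    rw [finprod_mem_eq_finite_toFinset_prod _ hf, finprod_mem_eq_finite_toFinset_prod _ hf']
    have hsub : hf'.toFinset ⊆ hf.toFinset := fun b hb => by
      simp only [Set.Finite.mem_toFinset] at hb ⊢
      exact ⟨hb.1, hb.2.1, hb.2.2.trans hr⟩
    rw [← Finset.prod_sdiff hsub]
    refine mul_le_of_le_one_left
      (Finset.prod_nonneg fun b hb => M.p_nonneg b (hf'.mem_toFinset.1 hb).1)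
      (Finset.prod_le_one (fun b hb => M.p_nonneg b ?_) fun b hb => M.p_le_one b ?_)
    · exact (hf.mem_toFinset.1 (Finset.mem_sdiff.1 hb).1).1
    · exact (hf.mem_toFinset.1 (Finset.mem_sdiff.1 hb).1).1
  unfold surv
  have h4 : 0 ≤ ∏ᶠ b ∈ M.B ∩ Set.Ioc y r, M.p b :=
    M.prod_p_nonneg _ _
  have h5 := pow_nonneg M.q_nonneg (η.num y r)
  have h6 := pow_nonneg M.q_nonneg (η.num y l)
  have h7 : M.q ^ η.num y r ≤ M.q ^ η.num y l := pow_le_pow_of_le_one M.q_nonneg M.q_lt_one.le h2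
  gcongr

/-- An active particle at `y` flies beyond `l` with probability `surv η y l`. -/
theorem jumpLaw_Ioi (η : Config) {y l : ℝ} (hy : 0 ≤ y) (hl : y ≤ l) :
    M.jumpLaw η y (Set.Ioi (l : EReal)) = ENNReal.ofReal (M.surv η y l) := by
  have key : ∀ u : ℝ, u < 1 → ((l : EReal) < M.landing η y u ↔ u < M.surv η y l) := by
    intro u hu1
    constructor
    · intro h
      by_contra hu
      push Not at hu
      rcases hl.eq_or_lt with rfl | hl'
      · have hnum : η.num y y = 0 := by
          refine Finset.sum_eq_zero fun x hx => ?_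
          simp only [Config.sites, Finset.mem_filter, Set.Finite.mem_toFinset,
            Set.mem_ofPred_eq] at hx
          linarith [hx.1.1, hx.2]
        have : M.surv η y y = 1 := by simp [surv, hnum]
        linarith
      · exact absurd h (not_lt.2 (sInf_le ⟨l, ⟨hl', hu⟩, rfl⟩))
    · intro h
      have hev := (M.tendsto_surv η hy hl).eventually (lt_mem_nhds h)
      obtain ⟨r, hr, hlr⟩ := (hev.and self_mem_nhdsWithin).exists
      have hlr : l < r := hlr
      refine lt_of_lt_of_le (EReal.coe_lt_coe_iff.2 hlr) (le_sInf ?_)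
      rintro _ ⟨s, ⟨hs1, hs2⟩, rfl⟩
      refine EReal.coe_le_coe_iff.2 ?_
      by_contra hsr
      push Not at hsr
      have := M.surv_antitone η hy hs1.le hsr.le
      linarith
  unfold jumpLaw
  rw [Measure.map_apply (M.antitone_landing η y).measurable measurableSet_Ioi,
    Measure.restrict_apply ((M.antitone_landing η y).measurable measurableSet_Ioi)]
  have : M.landing η y ⁻¹' Set.Ioi (l : EReal) ∩ Set.Ico 0 1 = Set.Ico 0 (M.surv η y l) := by
    ext u
    simp only [Set.mem_inter_iff, Set.mem_preimage, Set.mem_Ioi, Set.mem_Ico]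
    constructor
    · rintro ⟨h, h0, h1⟩
      exact ⟨h0, (key u h1).1 h⟩
    · rintro ⟨h0, h⟩
      have h1 := h.trans_le (M.surv_le_one η hy hl)
      exact ⟨(key u h1).2 h, h0, h1⟩
  rw [this, Real.volume_Ico, sub_zero]

end Params

end ExpJump

namespace ExpJump

/-! ### Measurability of functionals of configurations -/

namespace Config

/-! Everything follows from one identity for the generator in a window `(0, L]`,
`Params.IsInitialLaw.integral_gen`: the `P`-mean of `gen F` at flux `n` equals `v(0)` times the
difference of the `P`-means of `F` at `n + 1` and at `n`. Averaged over `P`, the configuration does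
not evolve and the flux increases by one at rate `v(0)`.

The identity rests on two facts. The first is a removal formula,
`Params.IsInitialLaw.lintegral_sum_removeAt`: under `P`, summing over the stacks the activation rate
times a function `h` of the location `y` and of the configuration without the activated particle
gives, in mean, `u` times the integral of `h(y, η)` against a measure `haz η` in `y`. This measure
has density `k`, mass `1 - q^η(y)` at a free stack and mass `1 - p(b) q^η(b)` at a roadblock. The
formula comes from the Mecke formula for the marked Poisson process and from the ratio of
consecutive `q`-negative binomial weights.

The second fact is that `haz η` is also the hazard measure of a flight through `η`: a particle from
`y` lands in `dz` with probability (passing `(y, z)`) times `haz η (dz)`. Reading such a survival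
function from right to left, (passing `(0, z)`) plus the integral over starts `y` in `(0, z)` of
(passing `(y, z)`) against `haz η` equals `1`. Hence flights started from a unit mass at `0` and
from `haz η` land in the window with intensity `haz η` and cross `L` with total weight `1`
(`Params.afterJump_add_lintegral_afterJump`). For `u = v(0)`, injections and activations together
start flights with `v(0)` times exactly this source; the removal formula, read backwards, turns the
landings into the loss term (`Params.IsInitialLaw.lintegral_gain`).

To pass from the generator to the process, note that the flux plus the number of particles in the
window never decreases in a jump. The generator, restricted to nonnegative flux, therefore acts
boundedly on test functions that vanish beyond a fixed total. The mean of `F` along the process and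
its mean under `P` with an independent Poisson flux solve the same linear equation, and Picard
iteration identifies them (`eq_zero_of_eq_integral`). This is done on events of the past on which
the flux is known and the window still has law `P` (`IsStationaryOn`). Such events reproduce
themselves at later times, so induction along the times gives the joint law of the flux increments;
since local events generate the `σ`-algebra of configurations, it also gives stationarity. -/

lemma mem_sites {η : Config} {R x : ℝ} : x ∈ η.sites R ↔ x ≤ R ∧ η.count x ≠ 0 := by
  simp [sites]

lemma pos_of_count_ne_zero {η : Config} {x : ℝ} (h : η.count x ≠ 0) : 0 < x := by
  by_contra hx
  exact h (η.count_nonpos x (not_lt.1 hx))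

lemma lintegral_toMeasure (η : Config) (f : ℝ → ℝ≥0∞) :
    ∫⁻ x, f x ∂η.toMeasure = ∑' x, (η.count x : ℝ≥0∞) * f x := by
  simp [toMeasure, lintegral_sum_measure, lintegral_smul_measure]

lemma toMeasure_apply (η : Config) {A : Set ℝ} (hA : MeasurableSet A) :
    η.toMeasure A = ∑' x, (η.count x : ℝ≥0∞) * A.indicator 1 x := by
  rw [← lintegral_toMeasure, lintegral_indicator_one hA]

lemma toMeasure_Ioc (η : Config) (a b : ℝ) : η.toMeasure (Set.Ioc a b) = η.num a b := by
  rw [toMeasure_apply _ measurableSet_Ioc,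
    tsum_eq_sum (s := (η.sites b).filter (fun x => a < x)), num]
  · push_cast
    refine Finset.sum_congr rfl fun x hx => ?_
    rw [Finset.mem_filter, mem_sites] at hx
    simp [hx.1.1, hx.2]
  · intro x hx
    rw [Finset.mem_filter, mem_sites] at hx
    by_cases h : x ∈ Set.Ioc a b
    · have : η.count x = 0 := by
        by_contra h0
        exact hx ⟨⟨h.2, h0⟩, h.1⟩
      simp [this]
    · simp [h]

lemma measurable_toMeasure : Measurable toMeasure := comap_measurable _

/-- The point measure of a configuration, as a kernel. -/
noncomputable def pointKernel : Kernel Config ℝ := ⟨toMeasure, measurable_toMeasure⟩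

lemma pointKernel_apply (η : Config) : pointKernel η = η.toMeasure := rfl

/-- The number of particles in an interval is finite but not uniformly bounded over configurations.
The kernel is therefore cut twice: into unit intervals, and according to the number of particles
there, which then bounds the mass of the piece. S-finiteness is what gives measurability of
integrals that depend on a parameter. -/
instance : IsSFiniteKernel pointKernel := by
  have hset : ∀ p : ℕ × ℕ, MeasurableSet
      {η : Config | η.toMeasure (Set.Ioc (p.1 : ℝ) (p.1 + 1)) = p.2} := fun p =>
    (Measure.measurable_coe measurableSet_Ioc).comp measurable_toMeasure (measurableSet_singleton _)
  classical
  let κ : ℕ × ℕ → Kernel Config ℝ := fun p =>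
    Kernel.piecewise (hset p)
      (pointKernel.restrict (measurableSet_Ioc (a := (p.1 : ℝ)) (b := p.1 + 1))) 0
  have hκ : ∀ p η, κ p η = if η.toMeasure (Set.Ioc (p.1 : ℝ) (p.1 + 1)) = p.2 then
      η.toMeasure.restrict (Set.Ioc (p.1 : ℝ) (p.1 + 1)) else 0 := by
    intro p η
    simp only [κ, Kernel.piecewise_apply, Set.mem_ofPred_eq, Kernel.restrict_apply,
      pointKernel_apply, zero_apply]
  have hfin : ∀ p, IsFiniteKernel (κ p) := by
    refine fun p => ⟨⟨p.2, ENNReal.natCast_lt_top _, fun η => ?_⟩⟩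
    rw [hκ]
    split_ifs with h
    · rw [Measure.restrict_apply_univ, h]
    · simp
  have hsum : pointKernel = Kernel.sum κ := by
    ext η A hA
    have hz : η.toMeasure (Set.Iic 0) = 0 := by
      rw [toMeasure_apply _ measurableSet_Iic, ENNReal.tsum_eq_zero]
      intro x
      by_cases hx : x ≤ 0
      · simp [η.count_nonpos x hx]
      · simp [hx]
    have hU : (Set.Iic (0 : ℝ))ᶜ = ⋃ n : ℕ, Set.Ioc (n : ℝ) (n + 1) := by
      ext x
      simp only [Set.mem_compl_iff, Set.mem_Iic, not_le, Set.mem_iUnion, Set.mem_Ioc]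
      constructor
      · intro hx
        have h1 : 1 ≤ ⌈x⌉₊ := Nat.one_le_ceil_iff.2 hx
        have h2 := Nat.ceil_lt_add_one hx.le
        have h3 := Nat.le_ceil x
        refine ⟨⌈x⌉₊ - 1, ?_, ?_⟩ <;> push_cast [h1] <;> linarith
      · rintro ⟨n, h1, -⟩
        exact lt_of_le_of_lt (Nat.cast_nonneg n) h1
    have hdis : Pairwise (Function.onFun Disjoint fun n : ℕ => Set.Ioc (n : ℝ) (n + 1)) := by
      have hc : ∀ (n : ℕ) (x : ℝ), x ∈ Set.Ioc (n : ℝ) (n + 1) → ⌈x⌉₊ = n + 1 := by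
        intro n x hx
        rw [Nat.ceil_eq_iff (by omega)]
        push_cast
        simpa using hx
      intro m n hmn
      refine Set.disjoint_left.2 fun x hm hn => hmn ?_
      have := (hc m x hm).symm.trans (hc n x hn)
      omega
    rw [Kernel.sum_apply' _ _ hA, ENNReal.tsum_prod', pointKernel_apply]
    have h1 : η.toMeasure A = ∑' n : ℕ, η.toMeasure.restrict (Set.Ioc (n : ℝ) (n + 1)) A := by
      rw [← measure_inter_add_sdiff A measurableSet_Iic (μ := η.toMeasure) (t := Set.Iic 0),
        measure_mono_null Set.inter_subset_right hz, zero_add, Set.sdiff_eq, hU,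
        Set.inter_iUnion, measure_iUnion]
      · simp_rw [Measure.restrict_apply hA]
      · exact fun m n hmn => (hdis hmn).mono Set.inter_subset_right Set.inter_subset_right
      · exact fun n => hA.inter measurableSet_Ioc
    rw [h1]
    refine tsum_congr fun n => ?_
    rw [tsum_eq_single (η.num n (n + 1))]
    · rw [hκ, if_pos (toMeasure_Ioc _ _ _)]
    · intro j hj
      rw [hκ, if_neg]
      · rfl
      · rw [toMeasure_Ioc]
        exact_mod_cast hj.symm
  rw [hsum]
  infer_instance

variable {α : Type*} [MeasurableSpace α]

lemma measurable_lintegral_toMeasure {g : α → Config} (hg : Measurable g) {f : α → ℝ → ℝ≥0∞}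
    (hf : Measurable (Function.uncurry f)) :
    Measurable fun a => ∫⁻ x, f a x ∂(g a).toMeasure :=
  Measurable.lintegral_kernel_prod_right (κ := pointKernel.comap g hg) hf

lemma measurable_of_toMeasure {g : α → Config}
    (h : ∀ A, MeasurableSet A → Measurable fun a => (g a).toMeasure A) : Measurable g := by
  refine measurable_iff_comap_le.2 ?_
  change MeasurableSpace.comap g (MeasurableSpace.comap toMeasure _) ≤ _
  rw [MeasurableSpace.comap_comp]
  exact measurable_iff_comap_le.1 (Measure.measurable_of_measurable_coe _ h)

lemma _root_.measurable_nat_of_ennreal {f : α → ℕ} (h : Measurable fun a => (f a : ℝ≥0∞)) :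
    Measurable f := by
  refine measurable_to_countable' fun n => ?_
  have : f ⁻¹' {n} = (fun a => (f a : ℝ≥0∞)) ⁻¹' {(n : ℝ≥0∞)} := by
    ext a
    simp
  rw [this]
  exact h (measurableSet_singleton _)

lemma measurable_count {g : α → Config} (hg : Measurable g) {y : α → ℝ} (hy : Measurable y) :
    Measurable fun a => (g a).count (y a) := by
  apply measurable_nat_of_ennreal
  have h : ∀ a, ((g a).count (y a) : ℝ≥0∞) =
      ∫⁻ x, (if x = y a then 1 else 0) ∂(g a).toMeasure := by
    intro a
    rw [lintegral_toMeasure, tsum_eq_single (y a)]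
    · simp
    · intro x hx
      simp [hx]
  simp_rw [h]
  refine measurable_lintegral_toMeasure hg ?_
  exact Measurable.ite (measurableSet_eq_fun measurable_snd (hy.comp measurable_fst))
    measurable_const measurable_const

lemma measurable_num {g : α → Config} (hg : Measurable g) {x y : α → ℝ} (hx : Measurable x)
    (hy : Measurable y) : Measurable fun a => (g a).num (x a) (y a) := by
  apply measurable_nat_of_ennreal
  have h : ∀ a, ((g a).num (x a) (y a) : ℝ≥0∞) =
      ∫⁻ z, (if x a < z ∧ z ≤ y a then 1 else 0) ∂(g a).toMeasure := by
    intro a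
    rw [← toMeasure_Ioc, ← lintegral_indicator_one measurableSet_Ioc]
    refine lintegral_congr fun z => ?_
    simp [Set.indicator_apply]
  simp_rw [h]
  refine measurable_lintegral_toMeasure hg ?_
  refine Measurable.ite (MeasurableSet.inter ?_ ?_) measurable_const measurable_const
  · exact measurableSet_lt (hx.comp measurable_fst) measurable_snd
  · exact measurableSet_le measurable_snd (hy.comp measurable_fst)

/-- The point measure counts a stack with its size, so each term is divided by that size. Sums over
stacks thereby inherit measurability from integrals against the point measure. -/
lemma sum_sites_eq_lintegral (η : Config) (L : ℝ) (f : ℝ → ℝ≥0∞) :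
    ∑ y ∈ η.sites L, f y =
      ∫⁻ y, (if y ≤ L then f y * (η.count y : ℝ≥0∞)⁻¹ else 0) ∂η.toMeasure := by
  rw [lintegral_toMeasure, tsum_eq_sum (s := η.sites L)]
  · refine Finset.sum_congr rfl fun y hy => ?_
    rw [mem_sites] at hy
    rw [if_pos hy.1, mul_left_comm, ENNReal.mul_inv_cancel (by exact_mod_cast hy.2)
      (ENNReal.natCast_ne_top _), mul_one]
  · intro y hy
    rw [mem_sites] at hy
    by_cases h : y ≤ L
    · have : η.count y = 0 := by
        by_contra h0
        exact hy ⟨h, h0⟩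
      simp [this]
    · simp [h]

lemma measurable_sum_sites {g : α → Config} (hg : Measurable g) (L : ℝ) {f : α → ℝ → ℝ≥0∞}
    (hf : Measurable (Function.uncurry f)) :
    Measurable fun a => ∑ y ∈ (g a).sites L, f a y := by
  simp_rw [sum_sites_eq_lintegral]
  refine measurable_lintegral_toMeasure hg ?_
  refine Measurable.ite (measurableSet_le measurable_snd measurable_const) ?_ measurable_const
  refine hf.mul (Measurable.inv ?_)
  exact (measurable_from_nat (f := fun n : ℕ => (n : ℝ≥0∞))).comp
    (measurable_count (hg.comp measurable_fst) measurable_snd)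

open Classical in
/-- The configuration with the stack size at `y` replaced by `m`; nothing changes if `y ≤ 0`. -/
noncomputable def set (η : Config) (y : ℝ) (m : ℕ) : Config where
  count x := if x = y ∧ 0 < y then m else η.count x
  count_nonpos x hx := by
    rw [if_neg]
    · exact η.count_nonpos x hx
    · rintro ⟨rfl, h⟩
      exact absurd h (not_lt.2 hx)
  locFinite R := by
    refine ((η.locFinite R).union (Set.finite_singleton y)).subset ?_
    rintro x ⟨hx, hne⟩
    by_cases h : x = y
    · exact Or.inr h
    · exact Or.inl ⟨hx, by simpa [h] using hne⟩

lemma count_set_self (η : Config) {y : ℝ} (hy : 0 < y) (m : ℕ) : (η.set y m).count y = m := by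
  simp [set, hy]

lemma count_set_of_ne (η : Config) {x y : ℝ} (h : x ≠ y) (m : ℕ) :
    (η.set y m).count x = η.count x := by
  simp [set, h]

lemma set_of_nonpos (η : Config) {y : ℝ} (hy : y ≤ 0) (m : ℕ) : η.set y m = η := by
  ext x
  simp [set, not_lt.2 hy]

lemma set_set (η : Config) (y : ℝ) (m n : ℕ) : (η.set y m).set y n = η.set y n := by
  ext x
  simp only [set]
  split_ifs <;> rfl

lemma set_count (η : Config) (y : ℝ) : η.set y (η.count y) = η := by
  ext x
  simp only [set]
  split_ifs with h
  · rw [h.1]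
  · rfl

lemma set_count_of_eq (η : Config) {y : ℝ} {m : ℕ} (h : η.count y = m) : η.set y m = η := by
  rw [← h, set_count]

lemma measurable_set {g : α → Config} (hg : Measurable g) {y : α → ℝ} (hy : Measurable y)
    {m : α → ℕ} (hm : Measurable m) : Measurable fun a => (g a).set (y a) (m a) := by
  classical
  refine measurable_of_toMeasure fun A hA => ?_
  have h : ∀ a, ((g a).set (y a) (m a)).toMeasure A =
      ∫⁻ x, (if x ∈ A ∧ ¬ (x = y a ∧ 0 < y a) then 1 else 0) ∂(g a).toMeasure +
        if y a ∈ A ∧ 0 < y a then (m a : ℝ≥0∞) else 0 := by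
    intro a
    have h2 : (if y a ∈ A ∧ 0 < y a then (m a : ℝ≥0∞) else 0) =
        ∑' x, if x = y a then (if y a ∈ A ∧ 0 < y a then (m a : ℝ≥0∞) else 0) else 0 := by
      rw [tsum_ite_eq]
    rw [toMeasure_apply _ hA, lintegral_toMeasure, h2, ← ENNReal.tsum_add]
    refine tsum_congr fun x => ?_
    by_cases hx : x = y a
    · subst hx
      by_cases hp : 0 < y a <;> by_cases hxA : y a ∈ A <;> simp [set, hp, hxA]
    · by_cases hxA : x ∈ A <;> simp [set, hx, hxA]
  simp_rw [h]
  refine Measurable.add (measurable_lintegral_toMeasure hg ?_) ?_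
  · refine Measurable.ite (MeasurableSet.inter ?_ (MeasurableSet.compl (MeasurableSet.inter ?_ ?_)))
      measurable_const measurable_const
    · exact measurable_snd hA
    · exact measurableSet_eq_fun measurable_snd (hy.comp measurable_fst)
    · exact measurableSet_lt measurable_const (hy.comp measurable_fst)
  · refine Measurable.ite (MeasurableSet.inter (hy hA) (measurableSet_lt measurable_const hy))
      ?_ measurable_const
    exact (measurable_from_nat (f := fun n : ℕ => (n : ℝ≥0∞))).comp hm

/-- The configuration with one particle less at `y`. -/
noncomputable def removeAt (η : Config) (y : ℝ) : Config := η.set y (η.count y - 1)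

/-- The configuration with one particle more at `z`; nothing changes if `z ≤ 0`. -/
noncomputable def addAt (η : Config) (z : ℝ) : Config := η.set z (η.count z + 1)

lemma measurable_removeAt {g : α → Config} (hg : Measurable g) {y : α → ℝ} (hy : Measurable y) :
    Measurable fun a => (g a).removeAt (y a) :=
  measurable_set hg hy ((measurable_from_nat (f := fun n : ℕ => n - 1)).comp
    (measurable_count hg hy))

lemma measurable_addAt {g : α → Config} (hg : Measurable g) {y : α → ℝ} (hy : Measurable y) :
    Measurable fun a => (g a).addAt (y a) :=
  measurable_set hg hy ((measurable_from_nat (f := fun n : ℕ => n + 1)).comp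
    (measurable_count hg hy))

lemma count_removeAt (η : Config) (x y : ℝ) :
    (η.removeAt y).count x = if x = y then η.count x - 1 else η.count x := by
  by_cases h : x = y
  · subst h
    by_cases hx : 0 < x
    · simp [removeAt, set, hx]
    · simp [removeAt, set, hx, η.count_nonpos x (not_lt.1 hx)]
  · simp [removeAt, set, h]

lemma count_addAt (η : Config) (x z : ℝ) :
    (η.addAt z).count x = if x = z ∧ 0 < z then η.count x + 1 else η.count x := by
  by_cases h : x = z ∧ 0 < z
  · simp only [addAt, set, h.1]
  · simp only [addAt, set, if_neg h]

/-- `EReal.toReal` sends `⊤` to `0`, where `addAt` does nothing; a particle that leaves the system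
is thus covered without a case distinction. -/
lemma move_eq (η : Config) (y : ℝ) (z : EReal) : η.move y z = (η.removeAt y).addAt z.toReal := by
  ext x
  rw [count_addAt, count_removeAt]
  have : (0 < x ∧ (x : EReal) = z) ↔ (x = z.toReal ∧ 0 < z.toReal) := by
    constructor
    · rintro ⟨h, rfl⟩
      simpa using h
    · rintro ⟨rfl, h⟩
      refine ⟨h, EReal.coe_toReal ?_ ?_⟩ <;> rintro rfl <;> simp at h
  simp only [move, this]
  split_ifs <;> rfl

lemma move_coe (η : Config) (y z : ℝ) : η.move y z = (η.removeAt y).addAt z := by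
  rw [move_eq, EReal.toReal_coe]

lemma removeAt_of_nonpos (η : Config) {z : ℝ} (hz : z ≤ 0) : η.removeAt z = η :=
  η.set_of_nonpos hz _

lemma addAt_removeAt (η : Config) {y : ℝ} (hy : η.count y ≠ 0) : (η.removeAt y).addAt y = η := by
  have hp := pos_of_count_ne_zero hy
  ext x
  rw [count_addAt, count_removeAt]
  by_cases h : x = y
  · subst h
    simp only [hp, and_self, if_true]
    omega
  · simp [h]

lemma measurable_move {g : α → Config} (hg : Measurable g) {y : α → ℝ} (hy : Measurable y)
    {z : α → EReal} (hz : Measurable z) : Measurable fun a => (g a).move (y a) (z a) := by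
  simp_rw [move_eq]
  exact measurable_addAt (measurable_removeAt hg hy) hz.ereal_toReal

lemma sum_count_eq_num (η : Config) (L : ℝ) : ∑ x ∈ η.sites L, η.count x = η.num 0 L := by
  rw [num, Finset.filter_true_of_mem]
  intro x hx
  exact pos_of_count_ne_zero (mem_sites.1 hx).2

lemma card_sites_le_num (η : Config) (L : ℝ) : (η.sites L).card ≤ η.num 0 L := by
  rw [← sum_count_eq_num, Finset.card_eq_sum_ones]
  exact Finset.sum_le_sum fun x hx => Nat.one_le_iff_ne_zero.2 (mem_sites.1 hx).2

lemma num_eq_sum_of_subset (η : Config) {L : ℝ} {s : Finset ℝ} (hs : η.sites L ⊆ s)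
    (hs' : ∀ x ∈ s, x ≤ L) : η.num 0 L = ∑ x ∈ s, η.count x := by
  rw [← sum_count_eq_num]
  refine Finset.sum_subset hs fun x hx hxs => ?_
  by_contra h
  exact hxs (mem_sites.2 ⟨hs' x hx, h⟩)

lemma num_addAt (η : Config) {z L : ℝ} (hz : 0 < z) (hzL : z ≤ L) :
    (η.addAt z).num 0 L = η.num 0 L + 1 := by
  classical
  have hs' : ∀ x ∈ insert z (η.sites L), x ≤ L := by
    intro x hx
    rcases Finset.mem_insert.1 hx with rfl | h
    · exact hzL
    · exact (mem_sites.1 h).1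
  rw [num_eq_sum_of_subset η (Finset.subset_insert z _) hs',
    num_eq_sum_of_subset (η.addAt z) (s := insert z (η.sites L)) ?_ hs']
  · have : ∀ x, (η.addAt z).count x = η.count x + if x = z then 1 else 0 := by
      intro x
      rw [count_addAt]
      by_cases h : x = z <;> simp [h, hz]
    simp_rw [this]
    rw [Finset.sum_add_distrib, Finset.sum_ite_eq' _ z, if_pos (Finset.mem_insert_self _ _)]
  · intro x hx
    rw [mem_sites, count_addAt] at hx
    by_cases h : x = z
    · simp [h]
    · simp only [h, false_and, if_false] at hx
      exact Finset.mem_insert_of_mem (mem_sites.2 hx)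

lemma num_removeAt (η : Config) {y L : ℝ} (hy : y ∈ η.sites L) :
    (η.removeAt y).num 0 L + 1 = η.num 0 L := by
  rw [mem_sites] at hy
  have hp := pos_of_count_ne_zero hy.2
  rw [← num_addAt _ hp hy.1, addAt_removeAt _ hy.2]

lemma num_congr {η ξ : Config} {L : ℝ} (h : ∀ x, x ≤ L → η.count x = ξ.count x) (a : ℝ) :
    η.num a L = ξ.num a L := by
  have hs : η.sites L = ξ.sites L := by
    ext x
    simp only [mem_sites]
    exact and_congr_right fun hx => by rw [h x hx]
  rw [num, num, hs]
  refine Finset.sum_congr rfl fun x hx => ?_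
  rw [Finset.mem_filter, mem_sites] at hx
  exact h x hx.1.1

lemma sites_congr {η ξ : Config} {L : ℝ} (h : ∀ x, x ≤ L → η.count x = ξ.count x) :
    η.sites L = ξ.sites L := by
  ext x
  simp only [mem_sites]
  exact and_congr_right fun hx => by rw [h x hx]

end Config

/-! ### Absolutely continuous exponentials -/

/-- The primitive of a merely integrable `k` is only absolutely continuous. Its range is bounded,
and `exp` is Lipschitz there, so the fundamental theorem of calculus remains available for the
exponential. -/
lemma absolutelyContinuousOnInterval_exp {G : ℝ → ℝ} {a b : ℝ}
    (hG : AbsolutelyContinuousOnInterval G a b) :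
    AbsolutelyContinuousOnInterval (fun x => Real.exp (G x)) a b := by
  obtain ⟨C, hC⟩ := hG.exists_bound
  obtain ⟨K, hK⟩ := (Real.contDiff_exp (n := 1)).contDiffOn.exists_lipschitzOnWith
    (s := Set.Icc (-C) C) (by decide) (convex_Icc _ _) isCompact_Icc
  have hmem : ∀ x ∈ Set.uIcc a b, G x ∈ Set.Icc (-C) C := fun x hx => abs_le.1 (hC x hx)
  rw [absolutelyContinuousOnInterval_iff] at hG ⊢
  intro ε hε
  -- `K + 1` instead of `K`, since the Lipschitz constant may be zero.
  obtain ⟨δ, hδ, h⟩ := hG (ε / (K + 1)) (by positivity)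
  refine ⟨δ, hδ, fun E hE hEδ => ?_⟩
  have h1 := h E hE hEδ
  have h2 : ∑ i ∈ Finset.range E.1, dist (Real.exp (G (E.2 i).1)) (Real.exp (G (E.2 i).2)) ≤
      ∑ i ∈ Finset.range E.1, (K : ℝ) * dist (G (E.2 i).1) (G (E.2 i).2) :=
    Finset.sum_le_sum fun i hi => hK.dist_le_mul _ (hmem _ (hE.1 i hi).1) _ (hmem _ (hE.1 i hi).2)
  rw [← Finset.mul_sum] at h2
  have h0 : 0 ≤ ∑ i ∈ Finset.range E.1, dist (G (E.2 i).1) (G (E.2 i).2) :=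
    Finset.sum_nonneg fun _ _ => dist_nonneg
  rw [lt_div_iff₀ (by positivity)] at h1
  nlinarith

lemma integral_mul_exp_integral {f : ℝ → ℝ} {a b : ℝ}
    (hf : IntervalIntegrable f volume a b) :
    IntervalIntegrable (fun x => f x * Real.exp (∫ t in a..x, f t)) volume a b ∧
    ∫ x in a..b, f x * Real.exp (∫ t in a..x, f t) = Real.exp (∫ t in a..b, f t) - 1 := by
  have hG := hf.absolutelyContinuousOnInterval_intervalIntegral (c := a) Set.left_mem_uIcc
  have hE := absolutelyContinuousOnInterval_exp hG
  refine ⟨hf.mul_continuousOn hE.continuousOn, ?_⟩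
  have := hE.integral_deriv_eq_sub
  rw [intervalIntegral.integral_same, Real.exp_zero] at this
  rw [← this]
  refine intervalIntegral.integral_congr_ae ?_
  filter_upwards [hf.ae_hasDerivAt_integral] with x hx hxab
  have h1 := (hx (Set.uIoc_subset_uIcc hxab) a Set.left_mem_uIcc).exp
  rw [h1.deriv, mul_comm]

namespace Params

variable (M : Params)

/-- The integral of `k` over `(0, x]`. -/
noncomputable def cum (x : ℝ) : ℝ := ∫ t in (0 : ℝ)..max x 0, M.k t

lemma integral_eq_cum {y l : ℝ} (hy : 0 ≤ y) (hl : y ≤ l) :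
    ∫ t in y..l, M.k t = M.cum l - M.cum y := by
  rw [cum, cum, max_eq_left hy, max_eq_left (hy.trans hl), eq_sub_iff_add_eq', 
    intervalIntegral.integral_add_adjacent_intervals (M.intervalIntegrable le_rfl hy)
      (M.intervalIntegrable hy hl)]

lemma cum_mono : Monotone M.cum := by
  intro x y hxy
  have h := max_le_max_right (0 : ℝ) hxy
  have h0 : 0 ≤ max x 0 := le_max_right _ _
  rw [cum, cum, ← sub_nonneg, intervalIntegral.integral_interval_sub_left
    (M.intervalIntegrable le_rfl (le_max_right _ _)) (M.intervalIntegrable le_rfl h0)]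
  exact intervalIntegral.integral_nonneg h fun u hu => (M.k_pos u (h0.trans hu.1)).le

/-- For a Poisson process of intensity `k`: either there is a first point `z` in `(y, l]`, or there
is none. -/
lemma lintegral_exp_cum_left {y l : ℝ} (hy : 0 ≤ y) (hl : y ≤ l) :
    (∫⁻ z in Set.Ioc y l, ENNReal.ofReal (M.k z) * ENNReal.ofReal (Real.exp (M.cum y - M.cum z))) +
      ENNReal.ofReal (Real.exp (M.cum y - M.cum l)) = 1 := by
  obtain ⟨h1, h2⟩ := integral_mul_exp_integral (M.intervalIntegrable hy hl).neg
  rw [intervalIntegral.integral_of_le hl] at h2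
  rw [intervalIntegrable_iff_integrableOn_Ioc_of_le hl] at h1
  have h3 : ∫⁻ z in Set.Ioc y l,
      ENNReal.ofReal (M.k z) * ENNReal.ofReal (Real.exp (M.cum y - M.cum z)) =
      ENNReal.ofReal (1 - Real.exp (M.cum y - M.cum l)) := by
    have h4 : ∫ x in Set.Ioc y l, M.k x * Real.exp (∫ t in y..x, (-M.k) t) =
        1 - Real.exp (M.cum y - M.cum l) := by
      have : ∫ t in y..l, (-M.k) t = M.cum y - M.cum l := by
        rw [← neg_sub, ← M.integral_eq_cum hy hl, ← intervalIntegral.integral_neg]; rfl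
      rw [this] at h2
      rw [← neg_sub, ← h2, ← integral_neg]
      simp
    rw [← h4, ofReal_integral_eq_lintegral_ofReal]
    · refine setLIntegral_congr_fun measurableSet_Ioc fun z hz => ?_
      have hk := (M.k_pos z (hy.trans hz.1.le)).le
      have : ∫ t in y..z, (-M.k) t = M.cum y - M.cum z := by
        rw [← neg_sub, ← M.integral_eq_cum hy hz.1.le, ← intervalIntegral.integral_neg]; rfl
      simp only [this]
      rw [ENNReal.ofReal_mul hk]
    · refine h1.neg.congr ?_
      filter_upwards with x
      simp
    · rw [EventuallyLE, ae_restrict_iff' measurableSet_Ioc]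
      filter_upwards with z hz
      exact mul_nonneg (M.k_pos z (hy.trans hz.1.le)).le (Real.exp_nonneg _)
  have hle : Real.exp (M.cum y - M.cum l) ≤ 1 :=
    Real.exp_le_one_iff.2 (sub_nonpos.2 (M.cum_mono hl))
  rw [h3, ← ENNReal.ofReal_add (sub_nonneg.2 hle) (Real.exp_nonneg _), sub_add_cancel,
    ENNReal.ofReal_one]

/-- The mirror image: either there is a last point `z` in `(y, l]`, or there is none. -/
lemma lintegral_exp_cum_right {y l : ℝ} (hy : 0 ≤ y) (hl : y ≤ l) :
    (∫⁻ z in Set.Ioc y l, ENNReal.ofReal (M.k z) * ENNReal.ofReal (Real.exp (M.cum z - M.cum l))) +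
      ENNReal.ofReal (Real.exp (M.cum y - M.cum l)) = 1 := by
  obtain ⟨h1, h2⟩ := integral_mul_exp_integral (M.intervalIntegrable hy hl)
  rw [intervalIntegral.integral_of_le hl] at h2
  rw [intervalIntegrable_iff_integrableOn_Ioc_of_le hl] at h1
  have hr : ∀ x ∈ Set.Ioc y l, M.k x * Real.exp (∫ t in y..x, M.k t) *
      Real.exp (M.cum y - M.cum l) = M.k x * Real.exp (M.cum x - M.cum l) := by
    intro x hx
    rw [M.integral_eq_cum hy hx.1.le, mul_assoc, ← Real.exp_add]
    ring_nf
  have h3 : ∫⁻ z in Set.Ioc y l,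
      ENNReal.ofReal (M.k z) * ENNReal.ofReal (Real.exp (M.cum z - M.cum l)) =
      ENNReal.ofReal (1 - Real.exp (M.cum y - M.cum l)) := by
    have h4 : ∫ x in Set.Ioc y l, M.k x * Real.exp (M.cum x - M.cum l) =
        1 - Real.exp (M.cum y - M.cum l) := by
      rw [← setIntegral_congr_fun measurableSet_Ioc hr, integral_mul_const, h2,
        M.integral_eq_cum hy hl, sub_mul, ← Real.exp_add]
      ring_nf
      simp
    rw [← h4, ofReal_integral_eq_lintegral_ofReal]
    · refine setLIntegral_congr_fun measurableSet_Ioc fun z hz => ?_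
      have hk := (M.k_pos z (hy.trans hz.1.le)).le
      rw [ENNReal.ofReal_mul hk]
    · exact IntegrableOn.congr_fun (h1.mul_const _) hr measurableSet_Ioc
    · rw [EventuallyLE, ae_restrict_iff' measurableSet_Ioc]
      filter_upwards with z hz
      exact mul_nonneg (M.k_pos z (hy.trans hz.1.le)).le (Real.exp_nonneg _)
  have hle : Real.exp (M.cum y - M.cum l) ≤ 1 :=
    Real.exp_le_one_iff.2 (sub_nonpos.2 (M.cum_mono hl))
  rw [h3, ← ENNReal.ofReal_add (sub_nonneg.2 hle) (Real.exp_nonneg _), sub_add_cancel,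
    ENNReal.ofReal_one]

/-! ### Survival functions with finitely many atoms and their hazard measures -/

/-- The probability to fly over `(y, l]`, when a location `a ∈ S` is passed with probability
`c a`. -/
noncomputable def flight (S : Finset ℝ) (c : ℝ → ℝ) (y l : ℝ) : ℝ :=
  Real.exp (M.cum y - M.cum l) * ∏ a ∈ S, if y < a ∧ a ≤ l then c a else 1

/-- The probability to fly over `(y, l)`, when a location `a ∈ S` is passed with probability
`c a`. -/
noncomputable def flightLt (S : Finset ℝ) (c : ℝ → ℝ) (y l : ℝ) : ℝ :=
  Real.exp (M.cum y - M.cum l) * ∏ a ∈ S, if y < a ∧ a < l then c a else 1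

/-- The hazard measure of the survival functions `flight`. -/
noncomputable def hazard (S : Finset ℝ) (c : ℝ → ℝ) : Measure ℝ :=
  (volume.restrict (Set.Ioi 0)).withDensity (fun z => ENNReal.ofReal (M.k z)) +
    ∑ a ∈ S, ENNReal.ofReal (1 - c a) • Measure.dirac a

variable {S : Finset ℝ} {c : ℝ → ℝ}

lemma lintegral_hazard (S : Finset ℝ) (c : ℝ → ℝ) {f : ℝ → ℝ≥0∞} (hf : Measurable f) :
    ∫⁻ z, f z ∂M.hazard S c = (∫⁻ z in Set.Ioi 0, ENNReal.ofReal (M.k z) * f z) +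
      ∑ a ∈ S, ENNReal.ofReal (1 - c a) * f a := by
  rw [hazard, lintegral_add_measure, lintegral_finsetSum_measure,
    lintegral_withDensity_eq_lintegral_mul _ M.k_measurable.ennreal_ofReal hf]
  simp [lintegral_smul_measure]

lemma setLIntegral_hazard_empty {y l : ℝ} (hy : 0 ≤ y) (f : ℝ → ℝ≥0∞) (hf : Measurable f) :
    ∫⁻ z in Set.Ioc y l, f z ∂M.hazard ∅ c =
      ∫⁻ z in Set.Ioc y l, ENNReal.ofReal (M.k z) * f z := by
  rw [← lintegral_indicator measurableSet_Ioc,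
    M.lintegral_hazard _ _ (hf.indicator measurableSet_Ioc), Finset.sum_empty, add_zero]
  have : Set.Ioc y l = Set.Ioi 0 ∩ Set.Ioc y l := by
    rw [Set.inter_eq_right.2]
    exact fun z hz => lt_of_le_of_lt hy hz.1
  rw [this, Set.inter_comm, ← Measure.restrict_restrict measurableSet_Ioc,
    ← lintegral_indicator measurableSet_Ioc, Set.inter_comm, ← this]
  refine lintegral_congr fun z => ?_
  by_cases h : z ∈ Set.Ioc y l <;> simp [h]

lemma setLIntegral_hazard_insert {a : ℝ} (ha : a ∉ S) {A : Set ℝ} (hA : MeasurableSet A)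
    (f : ℝ → ℝ≥0∞) :
    ∫⁻ z in A, f z ∂M.hazard (insert a S) c =
      (∫⁻ z in A, f z ∂M.hazard S c) + ENNReal.ofReal (1 - c a) * A.indicator f a := by
  have : M.hazard (insert a S) c = M.hazard S c + ENNReal.ofReal (1 - c a) • Measure.dirac a := by
    rw [hazard, hazard, Finset.sum_insert ha, add_assoc, add_comm (∑ a ∈ S, _)]
  rw [this, ← lintegral_indicator hA, ← lintegral_indicator hA, lintegral_add_measure,
    lintegral_smul_measure, lintegral_dirac, smul_eq_mul]

lemma hazard_singleton {a : ℝ} (ha : a ∉ S) : M.hazard S c {a} = 0 := by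
  have h := M.lintegral_hazard S c (f := ({a} : Set ℝ).indicator 1)
    (measurable_one.indicator (measurableSet_singleton a))
  rw [lintegral_indicator_one (measurableSet_singleton a)] at h
  rw [h, Finset.sum_eq_zero, add_zero]
  · rw [lintegral_eq_zero_iff]
    · have : ∀ᵐ z ∂(volume.restrict (Set.Ioi (0 : ℝ))), z ≠ a :=
        ae_restrict_of_ae (Measure.ae_ne _ a)
      filter_upwards [this] with z hz
      simp [hz]
    · exact M.k_measurable.ennreal_ofReal.mul
        (measurable_one.indicator (measurableSet_singleton a))
  · intro b hb
    have : b ≠ a := fun h => ha (h ▸ hb)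
    simp [this]

lemma measurable_cum : Measurable M.cum := M.cum_mono.measurable

lemma measurable_flight_left (S : Finset ℝ) (c : ℝ → ℝ) (l : ℝ) :
    Measurable fun y => M.flight S c y l := by
  refine (Real.measurable_exp.comp (M.measurable_cum.sub_const _)).mul
    (Finset.measurable_prod _ fun a _ => ?_)
  exact Measurable.ite ((measurableSet_lt measurable_id measurable_const).inter
    (MeasurableSet.const _)) measurable_const measurable_const

lemma measurable_flightLt (S : Finset ℝ) (c : ℝ → ℝ) :
    Measurable fun p : ℝ × ℝ => M.flightLt S c p.1 p.2 := by
  refine (Real.measurable_exp.comp ((M.measurable_cum.comp measurable_fst).sub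
    (M.measurable_cum.comp measurable_snd))).mul (Finset.measurable_prod _ fun a _ => ?_)
  exact Measurable.ite ((measurableSet_lt measurable_fst measurable_const).inter
    (measurableSet_lt measurable_const measurable_snd)) measurable_const measurable_const

lemma flightLt_eq_flight_of_notMem {l : ℝ} (hl : l ∉ S) (y : ℝ) :
    M.flightLt S c y l = M.flight S c y l := by
  rw [flightLt, flight]
  congr 1
  refine Finset.prod_congr rfl fun a ha => ?_
  have : a ≠ l := fun h => hl (h ▸ ha)
  simp only [le_iff_lt_or_eq, this, or_false]

/-- Omitting the factor of the endpoint is the same as deleting the atom at the endpoint; identities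
for half-open intervals then yield those for open ones. -/
lemma flightLt_eq_flight_erase (y l : ℝ) : M.flightLt S c y l = M.flight (S.erase l) c y l := by
  rw [← flightLt_eq_flight_of_notMem _ (Finset.notMem_erase l S), flightLt, flightLt]
  congr 1
  by_cases h : l ∈ S
  · rw [← Finset.mul_prod_erase _ _ h, if_neg (by simp), one_mul]
  · rw [Finset.erase_eq_of_notMem h]

/-- A flight from `y` stops for the first time at some `z`, after passing `(y, z)`, or it passes all
of `(y, l]`. The proof inserts the atoms one by one: a new atom `a` multiplies all weights beyond it
by `c a`, and the part `1 - c a` of the probability of reaching `a` stops there. -/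
theorem lintegral_flightLt_add_flight {y l : ℝ} (hy : 0 ≤ y) (hl : y ≤ l)
    (hc : ∀ a ∈ S, 0 ≤ c a ∧ c a ≤ 1) :
    (∫⁻ z in Set.Ioc y l, ENNReal.ofReal (M.flightLt S c y z) ∂M.hazard S c) +
      ENNReal.ofReal (M.flight S c y l) = 1 := by
  have hm : ∀ S, Measurable fun z => ENNReal.ofReal (M.flightLt S c y z) := fun S =>
    ((M.measurable_flightLt S c).comp measurable_prodMk_left).ennreal_ofReal
  induction S using Finset.induction generalizing l with
  | empty =>
    rw [M.setLIntegral_hazard_empty hy _ (hm _)]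
    simpa [flight, flightLt] using M.lintegral_exp_cum_left hy hl
  | insert a S ha ih =>
    have hcS : ∀ b ∈ S, 0 ≤ c b ∧ c b ≤ 1 := fun b hb => hc b (Finset.mem_insert_of_mem hb)
    obtain ⟨hc0, hc1⟩ := hc a (Finset.mem_insert_self a S)
    rw [M.setLIntegral_hazard_insert ha measurableSet_Ioc]
    by_cases hal : a ∈ Set.Ioc y l
    · have h1 := ih hal.1.le hcS
      have h2 := ih hl hcS
      have hsplit : Set.Ioc y l = Set.Ioc y a ∪ Set.Ioc a l :=
        (Set.Ioc_union_Ioc_eq_Ioc hal.1.le hal.2).symm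
      have hdis : Disjoint (Set.Ioc y a) (Set.Ioc a l) :=
        Set.disjoint_left.2 fun z hz hz' => absurd hz'.1 (not_lt.2 hz.2)
      rw [hsplit, lintegral_union measurableSet_Ioc hdis] at h2
      have e1 : ∫⁻ z in Set.Ioc y a, ENNReal.ofReal (M.flightLt (insert a S) c y z)
          ∂M.hazard S c = ∫⁻ z in Set.Ioc y a, ENNReal.ofReal (M.flightLt S c y z)
          ∂M.hazard S c := by
        refine setLIntegral_congr_fun measurableSet_Ioc fun z hz => ?_
        simp [flightLt, Finset.prod_insert ha, not_lt.2 hz.2]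
      have e2 : ∫⁻ z in Set.Ioc a l, ENNReal.ofReal (M.flightLt (insert a S) c y z)
          ∂M.hazard S c = ENNReal.ofReal (c a) *
            ∫⁻ z in Set.Ioc a l, ENNReal.ofReal (M.flightLt S c y z) ∂M.hazard S c := by
        rw [← lintegral_const_mul _ (hm S)]
        refine setLIntegral_congr_fun measurableSet_Ioc fun z hz => ?_
        simp only [flightLt, Finset.prod_insert ha, hal.1, hz.1, and_self, if_true]
        rw [← ENNReal.ofReal_mul hc0]
        ring_nf
      have e3 : (Set.Ioc y l).indicator
          (fun z => ENNReal.ofReal (M.flightLt (insert a S) c y z)) a =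
          ENNReal.ofReal (M.flight S c y a) := by
        rw [Set.indicator_of_mem hal, flightLt_eq_flight_erase, Finset.erase_insert ha]
      have e4 : ENNReal.ofReal (M.flight (insert a S) c y l) =
          ENNReal.ofReal (c a) * ENNReal.ofReal (M.flight S c y l) := by
        rw [← ENNReal.ofReal_mul hc0, flight, flight, Finset.prod_insert ha,
          if_pos (show y < a ∧ a ≤ l from hal)]
        ring_nf
      have e5 : ENNReal.ofReal (1 - c a) + ENNReal.ofReal (c a) = 1 := by
        rw [← ENNReal.ofReal_add (sub_nonneg.2 hc1) hc0, sub_add_cancel, ENNReal.ofReal_one]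
      rw [e3, e4, hsplit, lintegral_union measurableSet_Ioc hdis, e1, e2]
      set X := ∫⁻ z in Set.Ioc y a, ENNReal.ofReal (M.flightLt S c y z) ∂M.hazard S c
      set Y := ∫⁻ z in Set.Ioc a l, ENNReal.ofReal (M.flightLt S c y z) ∂M.hazard S c
      have hX : X ≠ ∞ := ne_top_of_le_ne_top ENNReal.one_ne_top (h1 ▸ le_self_add)
      -- Without the new atom, stopping beyond `a` or passing `l` has the probability of passing
      -- `(y, a]`: this is the difference of the induction hypotheses for `l` and for `a`.
      have h3 : Y + ENNReal.ofReal (M.flight S c y l) = ENNReal.ofReal (M.flight S c y a) := by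
        rw [← ENNReal.add_right_inj hX, ← add_assoc, h2, h1]
      calc _ = X + (ENNReal.ofReal (1 - c a) * ENNReal.ofReal (M.flight S c y a) +
              ENNReal.ofReal (c a) * (Y + ENNReal.ofReal (M.flight S c y l))) := by ring
        _ = 1 := by rw [h3, ← add_mul, e5, one_mul, h1]
    · rw [Set.indicator_of_notMem hal, mul_zero, add_zero, ← ih hl hcS]
      congr 1
      · refine setLIntegral_congr_fun measurableSet_Ioc fun z hz => ?_
        have : ¬ (y < a ∧ a < z) := fun h => hal ⟨h.1, h.2.le.trans hz.2⟩
        simp [flightLt, Finset.prod_insert ha, if_neg this]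
      · rw [flight, Finset.prod_insert ha, if_neg (show ¬ (y < a ∧ a ≤ l) from hal), one_mul,
          flight]

/-- The same decomposition seen from `l`: with independent obstacles of the given hazards, either
some `z` in `(y, l]` is the rightmost obstacle, or there is none. The induction now varies the left
endpoint. This reversed form is the one that balances the starts of flights against their landings.
-/
theorem lintegral_flight_add_flight {y l : ℝ} (hy : 0 ≤ y) (hl : y ≤ l)
    (hc : ∀ a ∈ S, 0 ≤ c a ∧ c a ≤ 1) :
    (∫⁻ z in Set.Ioc y l, ENNReal.ofReal (M.flight S c z l) ∂M.hazard S c) +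
      ENNReal.ofReal (M.flight S c y l) = 1 := by
  have hm : ∀ S, Measurable fun z => ENNReal.ofReal (M.flight S c z l) := fun S =>
    (M.measurable_flight_left S c l).ennreal_ofReal
  induction S using Finset.induction generalizing y with
  | empty =>
    rw [M.setLIntegral_hazard_empty hy _ (hm _)]
    simpa [flight] using M.lintegral_exp_cum_right hy hl
  | insert a S ha ih =>
    have hcS : ∀ b ∈ S, 0 ≤ c b ∧ c b ≤ 1 := fun b hb => hc b (Finset.mem_insert_of_mem hb)
    obtain ⟨hc0, hc1⟩ := hc a (Finset.mem_insert_self a S)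
    rw [M.setLIntegral_hazard_insert ha measurableSet_Ioc]
    by_cases hal : a ∈ Set.Ioc y l
    · have h1 := ih (hy.trans hal.1.le) hal.2 hcS
      have h2 := ih hy hl hcS
      have hsplit : Set.Ioc y l = Set.Ioc y a ∪ Set.Ioc a l :=
        (Set.Ioc_union_Ioc_eq_Ioc hal.1.le hal.2).symm
      have hdis : Disjoint (Set.Ioc y a) (Set.Ioc a l) :=
        Set.disjoint_left.2 fun z hz hz' => absurd hz'.1 (not_lt.2 hz.2)
      rw [hsplit, lintegral_union measurableSet_Ioc hdis] at h2
      have e1 : ∫⁻ z in Set.Ioc a l, ENNReal.ofReal (M.flight (insert a S) c z l)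
          ∂M.hazard S c = ∫⁻ z in Set.Ioc a l, ENNReal.ofReal (M.flight S c z l)
          ∂M.hazard S c := by
        refine setLIntegral_congr_fun measurableSet_Ioc fun z hz => ?_
        simp [flight, Finset.prod_insert ha, not_lt.2 hz.1.le]
      have e2 : ∫⁻ z in Set.Ioc y a, ENNReal.ofReal (M.flight (insert a S) c z l)
          ∂M.hazard S c = ENNReal.ofReal (c a) *
            ∫⁻ z in Set.Ioc y a, ENNReal.ofReal (M.flight S c z l) ∂M.hazard S c := by
        rw [← lintegral_const_mul _ (hm S)]
        -- At `z = a` the identity of the integrands can fail, because a flight started at `a` does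
        -- not pay for `a`. This point has no mass, as `a` is not yet an atom of the hazard measure.
        refine setLIntegral_congr_fun_ae measurableSet_Ioc ?_
        have : ∀ᵐ z ∂M.hazard S c, z ≠ a := by
          rw [ae_iff]
          simpa using M.hazard_singleton ha
        filter_upwards [this] with z hza hz
        have hz' : z < a := lt_of_le_of_ne hz.2 hza
        simp only [flight, Finset.prod_insert ha, hal.2, hz', and_self, if_true]
        rw [← ENNReal.ofReal_mul hc0]
        ring_nf
      have e3 : (Set.Ioc y l).indicator
          (fun z => ENNReal.ofReal (M.flight (insert a S) c z l)) a =
          ENNReal.ofReal (M.flight S c a l) := by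
        rw [Set.indicator_of_mem hal, flight, Finset.prod_insert ha, if_neg (by simp), one_mul,
          flight]
      have e4 : ENNReal.ofReal (M.flight (insert a S) c y l) =
          ENNReal.ofReal (c a) * ENNReal.ofReal (M.flight S c y l) := by
        rw [← ENNReal.ofReal_mul hc0, flight, flight, Finset.prod_insert ha,
          if_pos (show y < a ∧ a ≤ l from hal)]
        ring_nf
      have e5 : ENNReal.ofReal (1 - c a) + ENNReal.ofReal (c a) = 1 := by
        rw [← ENNReal.ofReal_add (sub_nonneg.2 hc1) hc0, sub_add_cancel, ENNReal.ofReal_one]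
      rw [e3, e4, hsplit, lintegral_union measurableSet_Ioc hdis, e1, e2]
      set X := ∫⁻ z in Set.Ioc a l, ENNReal.ofReal (M.flight S c z l) ∂M.hazard S c
      set Y := ∫⁻ z in Set.Ioc y a, ENNReal.ofReal (M.flight S c z l) ∂M.hazard S c
      have hX : X ≠ ∞ := ne_top_of_le_ne_top ENNReal.one_ne_top (h1 ▸ le_self_add)
      have h3 : Y + ENNReal.ofReal (M.flight S c y l) = ENNReal.ofReal (M.flight S c a l) := by
        rw [← ENNReal.add_right_inj hX, h1, ← add_assoc, add_comm X, h2]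
      calc _ = X + (ENNReal.ofReal (1 - c a) * ENNReal.ofReal (M.flight S c a l) +
              ENNReal.ofReal (c a) * (Y + ENNReal.ofReal (M.flight S c y l))) := by ring
        _ = 1 := by rw [h3, ← add_mul, e5, one_mul, h1]
    · rw [Set.indicator_of_notMem hal, mul_zero, add_zero, ← ih hy hl hcS]
      congr 1
      · refine setLIntegral_congr_fun measurableSet_Ioc fun z hz => ?_
        have : ¬ (z < a ∧ a ≤ l) := fun h => hal ⟨hz.1.trans h.1, h.2⟩
        simp [flight, Finset.prod_insert ha, if_neg this]
      · rw [flight, Finset.prod_insert ha, if_neg (show ¬ (y < a ∧ a ≤ l) from hal), one_mul,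
          flight]

/-- An atom at `l` affects neither the integral over the open interval nor `flightLt`, so it can be
erased, and the half-open version applies. Here `l` will be the landing point of a jump and `z` its
start, which lies strictly to the left. -/
theorem lintegral_flightLt_add_flightLt {y l : ℝ} (hy : 0 ≤ y) (hl : y ≤ l)
    (hc : ∀ a ∈ S, 0 ≤ c a ∧ c a ≤ 1) :
    (∫⁻ z in Set.Ioo y l, ENNReal.ofReal (M.flightLt S c z l) ∂M.hazard S c) +
      ENNReal.ofReal (M.flightLt S c y l) = 1 := by
  have hc' : ∀ a ∈ S.erase l, 0 ≤ c a ∧ c a ≤ 1 := fun a ha => hc a (Finset.mem_of_mem_erase ha)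
  rw [← M.lintegral_flight_add_flight hy hl hc', flightLt_eq_flight_erase]
  simp_rw [flightLt_eq_flight_erase]
  congr 1
  have h1 : ∫⁻ z in Set.Ioc y l, ENNReal.ofReal (M.flight (S.erase l) c z l)
      ∂M.hazard (S.erase l) c = ∫⁻ z in Set.Ioo y l, ENNReal.ofReal (M.flight (S.erase l) c z l)
      ∂M.hazard (S.erase l) c := by
    refine (setLIntegral_congr ?_).symm
    exact Ioo_ae_eq_Ioc' (M.hazard_singleton (Finset.notMem_erase l S))
  rw [h1]
  by_cases h : l ∈ S
  · have h2 := M.setLIntegral_hazard_insert (c := c) (Finset.notMem_erase l S)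
      (measurableSet_Ioo (a := y) (b := l))
      (fun z => ENNReal.ofReal (M.flight (S.erase l) c z l))
    rw [Finset.insert_erase h] at h2
    rw [h2]
    simp
  · rw [Finset.erase_eq_of_notMem h]

end Params

namespace Params

variable (M : Params)

/-! ### The hazard measure of a configuration -/

/-- The roadblocks in `(0, L]`. -/
noncomputable def roads (L : ℝ) : Finset ℝ := (M.B_locFinite L).toFinset.filter (fun b => 0 < b)

lemma mem_roads {L b : ℝ} : b ∈ M.roads L ↔ b ∈ M.B ∧ 0 < b ∧ b ≤ L := by
  simp [roads]
  tauto

/-- The locations in `(0, L]` with a stack or a roadblock. -/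
noncomputable def atoms (η : Config) (L : ℝ) : Finset ℝ := η.sites L ∪ M.roads L

open Classical in
/-- The probability to pass the location `a`, up to the continuous part. -/
noncomputable def pass (η : Config) (a : ℝ) : ℝ := M.q ^ η.count a * if a ∈ M.B then M.p a else 1

lemma pass_mem_Icc (η : Config) (a : ℝ) : 0 ≤ M.pass η a ∧ M.pass η a ≤ 1 := by
  have h1 := pow_nonneg M.q_nonneg (η.count a)
  have h2 : M.q ^ η.count a ≤ 1 := pow_le_one₀ M.q_nonneg M.q_lt_one.le
  unfold pass
  split_ifs with h
  · exact ⟨mul_nonneg h1 (M.p_nonneg a h), mul_le_one₀ h2 (M.p_nonneg a h) (M.p_le_one a h)⟩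
  · simpa using ⟨h1, h2⟩

lemma mem_atoms {η : Config} {L a : ℝ} :
    a ∈ M.atoms η L ↔ 0 < a ∧ a ≤ L ∧ (η.count a ≠ 0 ∨ a ∈ M.B) := by
  rw [atoms, Finset.mem_union, Config.mem_sites, mem_roads]
  constructor
  · rintro (h | h)
    · exact ⟨Config.pos_of_count_ne_zero h.2, h.1, Or.inl h.2⟩
    · exact ⟨h.2.1, h.2.2, Or.inr h.1⟩
  · rintro ⟨h1, h2, h | h⟩
    · exact Or.inl ⟨h2, h⟩
    · exact Or.inr ⟨h, h1, h2⟩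

lemma sites_subset_atoms (η : Config) (L : ℝ) : η.sites L ⊆ M.atoms η L :=
  Finset.subset_union_left

lemma roads_subset_atoms (η : Config) (L : ℝ) : M.roads L ⊆ M.atoms η L :=
  Finset.subset_union_right

/-- The set of atoms varies with `η`. A power of `q`, with a particle number as its exponent, times
a product over the fixed finite set of roadblocks is measurable in `η`; it is also the form in which
`surv` is given. -/
lemma prod_atoms (η : Config) (L : ℝ) (Q : ℝ → Prop) [DecidablePred Q] :
    ∏ a ∈ M.atoms η L, (if Q a then M.pass η a else 1) =
      M.q ^ (∑ a ∈ η.sites L, if Q a then η.count a else 0) *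
        ∏ b ∈ M.roads L, if Q b then M.p b else 1 := by
  classical
  have h : ∀ a, (if Q a then M.pass η a else 1) = M.q ^ (if Q a then η.count a else 0) *
      (if a ∈ M.B then (if Q a then M.p a else 1) else 1) := by
    intro a
    unfold pass
    split_ifs <;> simp
  simp_rw [h]
  rw [Finset.prod_mul_distrib, Finset.prod_pow_eq_pow_sum]
  refine congrArg₂ _ (congrArg _ ?_) ?_
  · refine (Finset.sum_subset (M.sites_subset_atoms η L) fun x hx hxs => ?_).symm
    rw [mem_atoms] at hx
    have : η.count x = 0 := by
      by_contra h0
      exact hxs (Config.mem_sites.2 ⟨hx.2.1, h0⟩)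
    simp [this]
  · rw [← Finset.prod_subset (M.roads_subset_atoms η L)]
    · refine Finset.prod_congr rfl fun b hb => ?_
      rw [if_pos (M.mem_roads.1 hb).1]
    · intro x hx hxs
      rw [if_neg]
      intro hB
      have := M.mem_atoms.1 hx
      exact hxs (M.mem_roads.2 ⟨hB, this.1, this.2.1⟩)

lemma surv_eq_flight (η : Config) {y l L : ℝ} (hy : 0 ≤ y) (hyl : y ≤ l) (hl : l ≤ L) :
    M.surv η y l = M.flight (M.atoms η L) (M.pass η) y l := by
  rw [surv, flight, prod_atoms, M.integral_eq_cum hy hyl, neg_sub, mul_assoc]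
  congr 2
  · congr 1
    rw [Config.num, ← Finset.sum_filter]
    refine Finset.sum_congr ?_ fun _ _ => rfl
    ext x
    simp only [Finset.mem_filter, Config.mem_sites]
    constructor
    · rintro ⟨⟨h1, h2⟩, h3⟩
      exact ⟨⟨h1.trans hl, h2⟩, h3, h1⟩
    · rintro ⟨⟨-, h2⟩, h3, h1⟩
      exact ⟨⟨h1, h2⟩, h3⟩
  · rw [← Finset.prod_filter, ← finprod_mem_coe_finset]
    have : M.B ∩ Set.Ioc y l =
        (((M.roads L).filter (fun a => y < a ∧ a ≤ l) : Finset ℝ) : Set ℝ) := by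
      ext b
      simp only [Set.mem_inter_iff, Set.mem_Ioc, Finset.coe_filter, mem_roads, Set.mem_ofPred_eq]
      constructor
      · rintro ⟨h1, h2, h3⟩
        exact ⟨⟨h1, lt_of_le_of_lt hy h2, h3.trans hl⟩, h2, h3⟩
      · rintro ⟨⟨h1, -, -⟩, h2, h3⟩
        exact ⟨h1, h2, h3⟩
    rw [this]

/-- The hazard measure on `(0, L]` of a configuration. -/
noncomputable def haz (L : ℝ) (η : Config) : Measure ℝ :=
  (M.hazard (M.atoms η L) (M.pass η)).restrict (Set.Ioc 0 L)

lemma lintegral_haz (L : ℝ) (η : Config) {f : ℝ → ℝ≥0∞} (hf : Measurable f) :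
    ∫⁻ z, f z ∂M.haz L η = (∫⁻ z in Set.Ioc 0 L, ENNReal.ofReal (M.k z) * f z) +
      ∑ a ∈ M.atoms η L, ENNReal.ofReal (1 - M.pass η a) * f a := by
  rw [haz, ← lintegral_indicator measurableSet_Ioc,
    lintegral_hazard _ _ _ (hf.indicator measurableSet_Ioc)]
  congr 1
  · have : Set.Ioc 0 L = Set.Ioc 0 L ∩ Set.Ioi 0 := by
      rw [Set.inter_eq_left.2]
      exact fun z hz => hz.1
    rw [this, ← Measure.restrict_restrict measurableSet_Ioc,
      ← lintegral_indicator measurableSet_Ioc, ← this]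
    refine lintegral_congr fun z => ?_
    by_cases h : z ∈ Set.Ioc 0 L <;> simp [h]
  · refine Finset.sum_congr rfl fun a ha => ?_
    have := M.mem_atoms.1 ha
    rw [Set.indicator_of_mem (show a ∈ Set.Ioc 0 L from ⟨this.1, this.2.1⟩)]

-- The splitting mirrors the structure of the initial law: stacks off the roadblocks, treated by the
-- Mecke formula, and a fixed finite set of roadblocks, each treated by its own weights.
open Classical in
lemma sum_atoms (L : ℝ) (η : Config) (f : ℝ → ℝ≥0∞) :
    ∑ a ∈ M.atoms η L, ENNReal.ofReal (1 - M.pass η a) * f a =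
      (∑ a ∈ η.sites L,
        if a ∈ M.B then 0 else ENNReal.ofReal (1 - M.q ^ η.count a) * f a) +
      ∑ b ∈ M.roads L, ENNReal.ofReal (1 - M.p b * M.q ^ η.count b) * f b := by
  have h : ∀ a, ENNReal.ofReal (1 - M.pass η a) * f a =
      (if a ∈ M.B then 0 else ENNReal.ofReal (1 - M.q ^ η.count a) * f a) +
      (if a ∈ M.B then ENNReal.ofReal (1 - M.p a * M.q ^ η.count a) * f a else 0) := by
    intro a
    unfold pass
    split_ifs
    · rw [zero_add, mul_comm (M.q ^ _)]
    · rw [add_zero, mul_one]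
  simp_rw [h]
  rw [Finset.sum_add_distrib]
  congr 1
  · refine (Finset.sum_subset (M.sites_subset_atoms η L) fun x hx hxs => ?_).symm
    rw [mem_atoms] at hx
    have : η.count x = 0 := by
      by_contra h0
      exact hxs (Config.mem_sites.2 ⟨hx.2.1, h0⟩)
    simp [this]
  · rw [← Finset.sum_subset (M.roads_subset_atoms η L)]
    · refine Finset.sum_congr rfl fun b hb => ?_
      rw [if_pos (M.mem_roads.1 hb).1]
    · intro x hx hxs
      rw [if_neg]
      intro hB
      have := M.mem_atoms.1 hx
      exact hxs (M.mem_roads.2 ⟨hB, this.1, this.2.1⟩)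

lemma countable_B : M.B.Countable := by
  have : M.B = ⋃ n : ℕ, M.B ∩ Set.Iic (n : ℝ) := by
    rw [← Set.inter_iUnion, Set.inter_eq_left.2]
    intro b _
    obtain ⟨n, hn⟩ := exists_nat_ge b
    exact Set.mem_iUnion.2 ⟨n, hn⟩
  rw [this]
  exact Set.countable_iUnion fun n => (M.B_locFinite n).countable

lemma measurableSet_B : MeasurableSet M.B := M.countable_B.measurableSet

section Measurability

variable {α : Type*} [MeasurableSpace α] {g : α → Config}

lemma measurable_lintegral_haz (L : ℝ) (hg : Measurable g) {f : α → ℝ → ℝ≥0∞}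
    (hf : Measurable (Function.uncurry f)) :
    Measurable fun a => ∫⁻ z, f a z ∂M.haz L (g a) := by
  classical
  have h : ∀ a, Measurable (f a) := fun a => hf.comp measurable_prodMk_left
  have hq : ∀ (p : ℝ) {β : Type _} [MeasurableSpace β] (n : β → ℕ), Measurable n →
      Measurable fun b => ENNReal.ofReal (1 - p * M.q ^ n b) := fun p β _ n hn =>
    (measurable_from_nat (f := fun n : ℕ => ENNReal.ofReal (1 - p * M.q ^ n))).comp hn
  simp_rw [M.lintegral_haz L _ (h _), M.sum_atoms]
  refine Measurable.add ?_ (Measurable.add ?_ ?_)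
  · exact Measurable.lintegral_prod_right
      (Measurable.mul (M.k_measurable.ennreal_ofReal.comp measurable_snd) hf)
  · refine Config.measurable_sum_sites hg L ?_
    refine Measurable.ite (measurable_snd M.measurableSet_B) measurable_const (Measurable.mul ?_ hf)
    simpa using hq 1 _ (Config.measurable_count (hg.comp measurable_fst) measurable_snd)
  · refine Finset.measurable_sum _ fun b _ => ?_
    exact (hq _ _ (Config.measurable_count hg measurable_const)).mul
      (hf.comp (measurable_id.prodMk measurable_const))

lemma measurable_sum_count (L : ℝ) (hg : Measurable g) {Q : α → ℝ → Prop}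
    [∀ a, DecidablePred (Q a)] (hQ : MeasurableSet {p : α × ℝ | Q p.1 p.2}) :
    Measurable fun a => ∑ x ∈ (g a).sites L, if Q a x then (g a).count x else 0 := by
  apply measurable_nat_of_ennreal
  have : ∀ a, ((∑ x ∈ (g a).sites L, if Q a x then (g a).count x else 0 : ℕ) : ℝ≥0∞) =
      ∑ x ∈ (g a).sites L, if Q a x then ((g a).count x : ℝ≥0∞) else 0 := by
    intro a
    push_cast
    exact Finset.sum_congr rfl fun x _ => by split_ifs <;> simp
  simp_rw [this]
  refine Config.measurable_sum_sites hg L (Measurable.ite hQ ?_ measurable_const)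
  exact (measurable_from_nat (f := fun n : ℕ => (n : ℝ≥0∞))).comp
    (Config.measurable_count (hg.comp measurable_fst) measurable_snd)

variable {y z : α → ℝ}

lemma measurable_flight_atoms (L : ℝ) (hg : Measurable g) (hy : Measurable y) (hz : Measurable z) :
    Measurable fun a => M.flight (M.atoms (g a) L) (M.pass (g a)) (y a) (z a) := by
  simp_rw [flight, M.prod_atoms]
  refine (Real.measurable_exp.comp ((M.measurable_cum.comp hy).sub
    (M.measurable_cum.comp hz))).mul (Measurable.mul ?_ (Finset.measurable_prod _ fun b _ => ?_))
  · refine (measurable_from_nat (f := fun n : ℕ => M.q ^ n)).comp (measurable_sum_count L hg ?_)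
    exact (measurableSet_lt (hy.comp measurable_fst) measurable_snd).inter
      (measurableSet_le measurable_snd (hz.comp measurable_fst))
  · exact Measurable.ite ((measurableSet_lt hy measurable_const).inter
      (measurableSet_le measurable_const hz)) measurable_const measurable_const

lemma measurable_flightLt_atoms (L : ℝ) (hg : Measurable g) (hy : Measurable y)
    (hz : Measurable z) :
    Measurable fun a => M.flightLt (M.atoms (g a) L) (M.pass (g a)) (y a) (z a) := by
  simp_rw [flightLt, M.prod_atoms]
  refine (Real.measurable_exp.comp ((M.measurable_cum.comp hy).sub
    (M.measurable_cum.comp hz))).mul (Measurable.mul ?_ (Finset.measurable_prod _ fun b _ => ?_))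
  · refine (measurable_from_nat (f := fun n : ℕ => M.q ^ n)).comp (measurable_sum_count L hg ?_)
    exact (measurableSet_lt (hy.comp measurable_fst) measurable_snd).inter
      (measurableSet_lt measurable_snd (hz.comp measurable_fst))
  · exact Measurable.ite ((measurableSet_lt hy measurable_const).inter
      (measurableSet_lt measurable_const hz)) measurable_const measurable_const

end Measurability

/-! ### Jumps -/

/-- The expectation of `f` after a particle from `y` has landed in `(y, L]`, or of `g` if it has
crossed `L`; the configuration `ξ` does not contain the jumping particle. -/
noncomputable def afterJump (L : ℝ) (f g : Config → ℝ≥0∞) (y : ℝ) (ξ : Config) : ℝ≥0∞ :=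
  (∫⁻ z, (if y < z then
      ENNReal.ofReal (M.flightLt (M.atoms ξ L) (M.pass ξ) y z) * f (ξ.addAt z) else 0)
    ∂M.haz L ξ) + ENNReal.ofReal (M.flight (M.atoms ξ L) (M.pass ξ) y L) * g ξ

lemma measurable_afterJump (L : ℝ) {f g : Config → ℝ≥0∞} (hf : Measurable f) (hg : Measurable g)
    {α : Type*} [MeasurableSpace α] {y : α → ℝ} (hy : Measurable y) {ξ : α → Config}
    (hξ : Measurable ξ) : Measurable fun a => M.afterJump L f g (y a) (ξ a) := by
  refine Measurable.add (M.measurable_lintegral_haz L hξ ?_) (Measurable.mul ?_ (hg.comp hξ))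
  · refine Measurable.ite (measurableSet_lt (hy.comp measurable_fst) measurable_snd)
      (Measurable.mul ?_ ?_) measurable_const
    · exact (M.measurable_flightLt_atoms L (hξ.comp measurable_fst) (hy.comp measurable_fst)
        measurable_snd).ennreal_ofReal
    · exact hf.comp (Config.measurable_addAt (hξ.comp measurable_fst) measurable_snd)
  · exact (M.measurable_flight_atoms L hξ hy measurable_const).ennreal_ofReal

/-- A jump from `y` only sees what lies to the right of `y`. This and the next congruences allow the
jumping particle to be deleted from the configuration that governs its flight. -/
lemma atoms_filter_congr {η ξ : Config} {y L : ℝ}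
    (h : ∀ x, y < x → x ≤ L → η.count x = ξ.count x) :
    (M.atoms η L).filter (fun a => y < a) = (M.atoms ξ L).filter (fun a => y < a) := by
  ext a
  simp only [Finset.mem_filter, mem_atoms]
  constructor
  · rintro ⟨⟨h1, h2, h3⟩, h4⟩
    exact ⟨⟨h1, h2, h a h4 h2 ▸ h3⟩, h4⟩
  · rintro ⟨⟨h1, h2, h3⟩, h4⟩
    exact ⟨⟨h1, h2, (h a h4 h2).symm ▸ h3⟩, h4⟩

lemma prod_atoms_congr {η ξ : Config} {y L : ℝ}
    (h : ∀ x, y < x → x ≤ L → η.count x = ξ.count x) (Q : ℝ → Prop) [DecidablePred Q]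
    (hQ : ∀ a, Q a → y < a) :
    ∏ a ∈ M.atoms η L, (if Q a then M.pass η a else 1) =
      ∏ a ∈ M.atoms ξ L, if Q a then M.pass ξ a else 1 := by
  have key : ∀ ζ : Config, ∏ a ∈ M.atoms ζ L, (if Q a then M.pass ζ a else 1) =
      ∏ a ∈ (M.atoms ζ L).filter (fun a => y < a), if Q a then M.pass ζ a else 1 := by
    intro ζ
    refine (Finset.prod_filter_of_ne fun a _ ha => ?_).symm
    by_contra hya
    exact ha (if_neg fun hq => hya (hQ a hq))
  rw [key, key, M.atoms_filter_congr h]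
  refine Finset.prod_congr rfl fun a ha => ?_
  rw [Finset.mem_filter, mem_atoms] at ha
  rw [pass, pass, h a ha.2 ha.1.2.1]

lemma flight_congr {η ξ : Config} {y L : ℝ}
    (h : ∀ x, y < x → x ≤ L → η.count x = ξ.count x) (l : ℝ) :
    M.flight (M.atoms η L) (M.pass η) y l = M.flight (M.atoms ξ L) (M.pass ξ) y l := by
  rw [flight, flight, M.prod_atoms_congr h _ fun a ha => ha.1]

lemma flightLt_congr {η ξ : Config} {y L : ℝ}
    (h : ∀ x, y < x → x ≤ L → η.count x = ξ.count x) (l : ℝ) :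
    M.flightLt (M.atoms η L) (M.pass η) y l = M.flightLt (M.atoms ξ L) (M.pass ξ) y l := by
  rw [flightLt, flightLt, M.prod_atoms_congr h _ fun a ha => ha.1]

lemma lintegral_haz_congr {η ξ : Config} {y L : ℝ}
    (h : ∀ x, y < x → x ≤ L → η.count x = ξ.count x) {f : ℝ → ℝ≥0∞} (hf : Measurable f) :
    ∫⁻ z, (if y < z then f z else 0) ∂M.haz L η = ∫⁻ z, (if y < z then f z else 0) ∂M.haz L ξ := by
  have hm : Measurable fun z => if y < z then f z else 0 :=
    Measurable.ite (measurableSet_lt measurable_const measurable_id) hf measurable_const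
  rw [M.lintegral_haz L η hm, M.lintegral_haz L ξ hm]
  congr 1
  have key : ∀ ζ : Config,
      ∑ a ∈ M.atoms ζ L, ENNReal.ofReal (1 - M.pass ζ a) * (if y < a then f a else 0) =
      ∑ a ∈ (M.atoms ζ L).filter (fun a => y < a), ENNReal.ofReal (1 - M.pass ζ a) * f a := by
    intro ζ
    rw [Finset.sum_filter]
    exact Finset.sum_congr rfl fun a _ => by split_ifs <;> simp
  rw [key, key, M.atoms_filter_congr h]
  refine Finset.sum_congr rfl fun a ha => ?_
  rw [Finset.mem_filter, mem_atoms] at ha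
  rw [pass, pass, h a ha.2 ha.1.2.1]

lemma jumpLaw_Ioi_self (η : Config) {y : ℝ} (hy : 0 ≤ y) :
    M.jumpLaw η y (Set.Ioi (y : EReal)) = 1 := by
  have hnum : η.num y y = 0 := by
    refine Finset.sum_eq_zero fun x hx => ?_
    simp only [Finset.mem_filter, Config.mem_sites] at hx
    linarith [hx.1.1, hx.2]
  rw [M.jumpLaw_Ioi η hy le_rfl]
  simp [surv, hnum]

lemma jumpLaw_Ioc_add_Ioi (η : Config) {y l : ℝ} (hy : 0 ≤ y) (hyl : y ≤ l) :
    M.jumpLaw η y (Set.Ioc (y : EReal) l) + M.jumpLaw η y (Set.Ioi (l : EReal)) = 1 := by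
  rw [← measure_union _ measurableSet_Ioi, Set.Ioc_union_Ioi_eq_Ioi (EReal.coe_le_coe_iff.2 hyl),
    M.jumpLaw_Ioi_self η hy]
  exact Set.disjoint_left.2 fun z hz hz' => absurd hz.2 (not_le.2 hz')

/-- Both sides complete the same finite tail `surv η y l` to `1`: the left by the definition of the
jump law, the right by the decomposition at the first stopping point. -/
lemma jumpLaw_Ioc (η : Config) {y l L : ℝ} (hy : 0 ≤ y) (hyl : y ≤ l) (hl : l ≤ L) :
    M.jumpLaw η y (Set.Ioc y l) =
      ∫⁻ z in Set.Ioc y l, ENNReal.ofReal (M.flightLt (M.atoms η L) (M.pass η) y z)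
        ∂M.hazard (M.atoms η L) (M.pass η) := by
  have h1 := M.lintegral_flightLt_add_flight (S := M.atoms η L) hy hyl
    fun a _ => M.pass_mem_Icc η a
  rw [← M.surv_eq_flight η hy hyl hl, ← M.jumpLaw_Ioi η hy hyl] at h1
  have h2 := M.jumpLaw_Ioc_add_Ioi η hy hyl
  rw [← h1] at h2
  exact (ENNReal.add_left_inj (measure_ne_top _ _)).1 h2

/-- The jump law was defined by inverse transform sampling; here it gets a density with respect to
the hazard measure. The two measures have the same distribution function, by `jumpLaw_Ioc`. -/
lemma map_jumpLaw (η : Config) {y L : ℝ} (hy : 0 ≤ y) :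
    ((M.jumpLaw η y).restrict (Set.Ioc (y : EReal) L)).map EReal.toReal =
      ((M.hazard (M.atoms η L) (M.pass η)).restrict (Set.Ioc y L)).withDensity
        fun z => ENNReal.ofReal (M.flightLt (M.atoms η L) (M.pass η) y z) := by
  have : IsFiniteMeasure (((M.jumpLaw η y).restrict (Set.Ioc (y : EReal) L)).map EReal.toReal) :=
    inferInstance
  refine Measure.ext_of_Iic _ _ fun l => ?_
  rw [Measure.map_apply measurable_ereal_toReal measurableSet_Iic,
    Measure.restrict_apply (measurable_ereal_toReal measurableSet_Iic),
    withDensity_apply _ measurableSet_Iic, Measure.restrict_restrict measurableSet_Iic]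
  have e1 : EReal.toReal ⁻¹' Set.Iic l ∩ Set.Ioc (y : EReal) L = Set.Ioc (y : EReal) (min l L : ℝ) := by
    ext z
    induction z with
    | bot => simp
    | top => simp
    | coe z => simp [and_left_comm]
  have e2 : Set.Iic l ∩ Set.Ioc y L = Set.Ioc y (min l L) := by
    ext z
    simp
    tauto
  rw [e1, e2]
  rcases le_or_gt y (min l L) with h | h
  · exact M.jumpLaw_Ioc η hy h (min_le_right _ _)
  · rw [Set.Ioc_eq_empty (not_lt.2 h.le), Set.Ioc_eq_empty]
    · simp
    · exact not_lt.2 (EReal.coe_le_coe_iff.2 h.le)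

lemma lintegral_jumpLaw (η : Config) {y L : ℝ} (hy : 0 ≤ y) (hL : y ≤ L) {f : ℝ → ℝ≥0∞}
    (hf : Measurable f) (a : ℝ≥0∞) :
    ∫⁻ z, (if (L : EReal) < z then a else f z.toReal) ∂M.jumpLaw η y =
      (∫⁻ z, (if y < z then
        ENNReal.ofReal (M.flightLt (M.atoms η L) (M.pass η) y z) * f z else 0) ∂M.haz L η) +
      ENNReal.ofReal (M.flight (M.atoms η L) (M.pass η) y L) * a := by
  have hae : ∀ᵐ z ∂M.jumpLaw η y, (y : EReal) < z :=
    (prob_compl_eq_zero_iff measurableSet_Ioi).2 (M.jumpLaw_Ioi_self η hy)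
  have hfl : Measurable fun z =>
      ENNReal.ofReal (M.flightLt (M.atoms η L) (M.pass η) y z) :=
    ((M.measurable_flightLt _ _).comp measurable_prodMk_left).ennreal_ofReal
  rw [← lintegral_add_compl _ (measurableSet_Ioi (a := (L : EReal))), add_comm]
  congr 1
  · have e1 : ∫⁻ z in (Set.Ioi (L : EReal))ᶜ, (if (L : EReal) < z then a else f z.toReal)
        ∂M.jumpLaw η y = ∫⁻ z in Set.Ioc (y : EReal) L, f z.toReal ∂M.jumpLaw η y := by
      have : ((Set.Ioi (L : EReal))ᶜ : Set EReal) =ᵐ[M.jumpLaw η y] Set.Ioc (y : EReal) L := by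
        filter_upwards [hae] with z hz
        apply propext
        change ¬ ((L : EReal) < z) ↔ ((y : EReal) < z ∧ z ≤ L)
        rw [not_lt]
        exact ⟨fun h => ⟨hz, h⟩, fun h => h.2⟩
      rw [setLIntegral_congr this]
      refine setLIntegral_congr_fun measurableSet_Ioc fun z hz => ?_
      rw [if_neg (not_lt.2 hz.2)]
    rw [e1, ← lintegral_map hf measurable_ereal_toReal, M.map_jumpLaw η hy,
      lintegral_withDensity_eq_lintegral_mul _ hfl hf, haz, ← lintegral_indicator measurableSet_Ioc,
      ← lintegral_indicator measurableSet_Ioc]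
    refine lintegral_congr fun z => ?_
    simp only [Set.indicator_apply, Set.mem_Ioc, Pi.mul_apply]
    by_cases h1 : y < z <;> by_cases h2 : z ≤ L <;> simp [h1, h2, lt_of_le_of_lt hy]
  · rw [← M.surv_eq_flight η hy hL le_rfl, ← M.jumpLaw_Ioi η hy hL, mul_comm,
      ← setLIntegral_const]
    refine setLIntegral_congr_fun measurableSet_Ioi fun z hz => ?_
    exact if_pos hz

/-- The outcome of a jump is expressed by its start and the configuration without the jumping
particle only, which is the form that the removal formula for the initial law accepts. -/
theorem lintegral_jumpLaw_move (η : Config) {y L : ℝ} (hy : 0 ≤ y) (hL : y ≤ L)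
    {f g : Config → ℝ≥0∞} (hf : Measurable f) :
    ∫⁻ z, (if (L : EReal) < z then g (η.removeAt y) else f (η.move y z)) ∂M.jumpLaw η y =
      M.afterJump L f g y (η.removeAt y) := by
  have hm : Measurable fun z => f ((η.removeAt y).addAt z) :=
    hf.comp (Config.measurable_addAt measurable_const measurable_id)
  have hfl : ∀ ξ : Config, Measurable fun z =>
      ENNReal.ofReal (M.flightLt (M.atoms ξ L) (M.pass ξ) y z) := fun ξ =>
    ((M.measurable_flightLt _ _).comp measurable_prodMk_left).ennreal_ofReal
  have hag : ∀ x, y < x → x ≤ L → η.count x = (η.removeAt y).count x := fun x hx _ => by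
    rw [Config.count_removeAt, if_neg hx.ne']
  simp_rw [Config.move_eq]
  have e := M.lintegral_haz_congr hag ((hfl η).mul hm)
  simp only [Pi.mul_apply] at e
  rw [M.lintegral_jumpLaw η hy hL hm, afterJump, M.flight_congr hag, e]
  simp_rw [M.flightLt_congr hag]

end Params

/-! ### Numbers of stacks -/

lemma coe_numStacks (S : Set ℝ) (C : Set (ℝ × ℕ)) (η : Config) :
    (numStacks S C η : ℝ≥0∞) =
      ∑' y, {y : ℝ | y ∈ S ∧ η.count y ≠ 0 ∧ (y, η.count y) ∈ C}.indicator 1 y := by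
  rw [numStacks, ← ENNReal.tsum_set_one, tsum_subtype _ (fun _ => (1 : ℝ≥0∞))]
  rfl

lemma measurable_numStacks {S : Set ℝ} (hS : MeasurableSet S) {C : Set (ℝ × ℕ)}
    (hC : MeasurableSet C) : Measurable (numStacks S C) := by
  classical
  have h : Measurable fun η => (numStacks S C η : ℝ≥0∞) := by
    have : ∀ η : Config, (numStacks S C η : ℝ≥0∞) =
        ∫⁻ y, (if y ∈ S ∧ (y, η.count y) ∈ C then (η.count y : ℝ≥0∞)⁻¹ else 0) ∂η.toMeasure := by
      intro η
      rw [coe_numStacks, Config.lintegral_toMeasure]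
      refine tsum_congr fun y => ?_
      by_cases h0 : η.count y = 0
      · simp [h0]
      · by_cases h1 : y ∈ S ∧ (y, η.count y) ∈ C
        · rw [if_pos h1, ENNReal.mul_inv_cancel (by exact_mod_cast h0) (ENNReal.natCast_ne_top _)]
          exact Set.indicator_of_mem
            (s := {y : ℝ | y ∈ S ∧ η.count y ≠ 0 ∧ (y, η.count y) ∈ C}) ⟨h1.1, h0, h1.2⟩ 1
        · rw [if_neg h1, Set.indicator_of_notMem, mul_zero]
          exact fun h => h1 ⟨h.1, h.2.2⟩
    simp_rw [this]
    refine Config.measurable_lintegral_toMeasure measurable_id ?_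
    have hc : Measurable fun p : Config × ℝ => p.1.count p.2 :=
      Config.measurable_count measurable_fst measurable_snd
    refine Measurable.ite ((measurable_snd hS).inter ((measurable_snd.prodMk hc) hC)) ?_
      measurable_const
    exact ((measurable_from_nat (f := fun n : ℕ => (n : ℝ≥0∞)⁻¹)).comp hc)
  refine ENat.measurable_iff.2 fun n => ?_
  have : numStacks S C ⁻¹' {(n : ℕ∞)} =
      (fun η => (numStacks S C η : ℝ≥0∞)) ⁻¹' {((n : ℕ∞) : ℝ≥0∞)} := by
    ext η
    simp only [Set.mem_preimage, Set.mem_singleton_iff, ENat.toENNReal_inj]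
  rw [this]
  exact h (measurableSet_singleton _)

/-- Additivity over a finite partition. It rewrites the counts of arbitrary, possibly overlapping,
sets through the counts of disjoint cells, which are independent. -/
lemma numStacks_preimage (S : Set ℝ) {T : Type*} [Fintype T] (τ : ℝ × ℕ → T) (Q : T → Prop)
    [DecidablePred Q] (η : Config) :
    numStacks S {x | Q (τ x)} η = ∑ t, if Q t then numStacks S (τ ⁻¹' {t}) η else 0 := by
  classical
  rw [← ENat.toENNReal_inj, coe_numStacks]
  have : ((∑ t, if Q t then numStacks S (τ ⁻¹' {t}) η else 0 : ℕ∞) : ℝ≥0∞) =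
      ∑ t, if Q t then (numStacks S (τ ⁻¹' {t}) η : ℝ≥0∞) else 0 := by
    refine (map_sum ENat.toENNRealRingHom _ _).trans (Finset.sum_congr rfl fun t _ => ?_)
    split_ifs
    · rfl
    · exact map_zero ENat.toENNRealRingHom
  rw [this]
  simp_rw [coe_numStacks]
  have h2 : ∀ t, (if Q t then ∑' y, {y : ℝ | y ∈ S ∧ η.count y ≠ 0 ∧
      (y, η.count y) ∈ τ ⁻¹' {t}}.indicator (1 : ℝ → ℝ≥0∞) y else 0) =
      ∑' y, if Q t then {y : ℝ | y ∈ S ∧ η.count y ≠ 0 ∧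
      (y, η.count y) ∈ τ ⁻¹' {t}}.indicator (1 : ℝ → ℝ≥0∞) y else 0 := by
    intro t
    split_ifs <;> simp
  simp_rw [h2]
  rw [← Summable.tsum_finsetSum fun _ _ => ENNReal.summable]
  refine tsum_congr fun y => ?_
  rw [Finset.sum_eq_single (τ (y, η.count y))]
  · by_cases hQ : Q (τ (y, η.count y)) <;>
      simp [Set.indicator_apply, hQ]
  · intro t _ ht
    simp [ht.symm]
  · simp

lemma numStacks_set_zero_of_mem {S : Set ℝ} {C : Set (ℝ × ℕ)} {η : Config} {y : ℝ}
    (hy : y ∈ S) (h0 : η.count y ≠ 0) (hC : (y, η.count y) ∈ C) :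
    numStacks S C (η.set y 0) = numStacks S C η - 1 := by
  have hp := Config.pos_of_count_ne_zero h0
  have : {x : ℝ | x ∈ S ∧ η.count x ≠ 0 ∧ (x, η.count x) ∈ C} =
      insert y {x : ℝ | x ∈ S ∧ (η.set y 0).count x ≠ 0 ∧ (x, (η.set y 0).count x) ∈ C} := by
    ext x
    by_cases hx : x = y
    · subst hx
      simp [hy, h0, hC]
    · simp [hx, Config.count_set_of_ne]
  rw [numStacks, numStacks, this, Set.encard_insert_of_notMem]
  · exact (ENat.addLECancellable_of_ne_top ENat.one_ne_top).add_tsub_cancel_right.symm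
  · simp [Config.count_set_self _ hp]

lemma numStacks_set_zero_of_notMem {S : Set ℝ} {C : Set (ℝ × ℕ)} {η : Config} {y : ℝ}
    (h : ¬ (y ∈ S ∧ (y, η.count y) ∈ C)) (h0 : η.count y ≠ 0) :
    numStacks S C (η.set y 0) = numStacks S C η := by
  have hp := Config.pos_of_count_ne_zero h0
  rw [numStacks, numStacks]
  congr 1
  ext x
  by_cases hx : x = y
  · subst hx
    simp only [Set.mem_ofPred_eq, Config.count_set_self _ hp]
    exact ⟨fun h' => absurd rfl h'.2.1, fun h' => absurd ⟨h'.1, h'.2.2⟩ h⟩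
  · simp [Config.count_set_of_ne _ hx]

lemma sum_sites_eq_numStacks {S : Set ℝ} {C : Set (ℝ × ℕ)} {L : ℝ} (hC : ∀ x ∈ C, x.1 ≤ L)
    (η : Config) :
    ∑ y ∈ η.sites L, {y : ℝ | y ∈ S ∧ (y, η.count y) ∈ C}.indicator (1 : ℝ → ℝ≥0∞) y =
      numStacks S C η := by
  rw [coe_numStacks, tsum_eq_sum (s := η.sites L)]
  · refine Finset.sum_congr rfl fun y hy => ?_
    have := (Config.mem_sites.1 hy).2
    exact Set.indicator_eq_indicator ⟨fun h => ⟨h.1, this, h.2⟩, fun h => ⟨h.1, h.2.2⟩⟩ rfl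
  · intro y hy
    refine Set.indicator_of_notMem (fun h => hy (Config.mem_sites.2 ⟨hC _ h.2.2, h.2.1⟩)) _

/-! ### Poisson variables -/

lemma lintegral_poissonMeasure (r : ℝ≥0) (f : ℕ → ℝ≥0∞) :
    ∫⁻ n, f n ∂poissonMeasure r =
      ∑' n : ℕ, ENNReal.ofReal (Real.exp (-r) * r ^ n / n.factorial) * f n := by
  rw [poissonMeasure, lintegral_sum_measure]
  simp [lintegral_smul_measure]

/-- The Mecke formula for a single Poisson variable: `n r^n / n! = r · r^(n-1) / (n-1)!`. The
truncated predecessor at `n = 0` is harmless because of the factor `n`. -/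
lemma lintegral_poissonMeasure_mul_pred (r : ℝ≥0) (f : ℕ → ℝ≥0∞) :
    ∫⁻ n, (n : ℝ≥0∞) * f (n - 1) ∂poissonMeasure r = r * ∫⁻ n, f n ∂poissonMeasure r := by
  rw [lintegral_poissonMeasure, lintegral_poissonMeasure,
    tsum_eq_zero_add' ENNReal.summable, ← ENNReal.tsum_mul_left]
  simp only [Nat.cast_zero, zero_mul, mul_zero, zero_add, Nat.add_sub_cancel]
  refine tsum_congr fun n => ?_
  rw [← mul_assoc, ← mul_assoc]
  congr 1
  rw [← ENNReal.ofReal_natCast, ← ENNReal.ofReal_mul (by positivity), ← ENNReal.ofReal_coe_nnreal,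
    ← ENNReal.ofReal_mul (by positivity)]
  congr 1
  rw [Nat.factorial_succ, pow_succ]
  push_cast
  field_simp

/-- The one-variable formula, applied to the coordinate `t` with the others held fixed; independence
and Fubini justify this. -/
lemma lintegral_poisson_family {Ω : Type*} [MeasurableSpace Ω] {P : Measure Ω}
    {T : Type*} [Fintype T] [DecidableEq T] {W : T → Ω → ℕ∞} (hW : ∀ t, Measurable (W t))
    (hind : iIndepFun W P) {t : T} {r : ℝ≥0}
    (ht : P.map (W t) = (poissonMeasure r).map (Nat.cast : ℕ → ℕ∞)) (φ : (T → ℕ∞) → ℝ≥0∞) :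
    ∫⁻ ω, (W t ω : ℝ≥0∞) * φ (Function.update (fun s => W s ω) t (W t ω - 1)) ∂P =
      r * ∫⁻ ω, φ (fun s => W s ω) ∂P := by
  have : IsProbabilityMeasure P := hind.isProbabilityMeasure
  let U := Finset.univ.erase t
  let Y : Ω → U → ℕ∞ := fun ω s => W s ω
  have hY : Measurable Y := measurable_pi_lambda _ fun s => hW s
  let comb : ℕ∞ × (U → ℕ∞) → T → ℕ∞ := fun p s =>
    if h : s = t then p.1 else p.2 ⟨s, Finset.mem_erase.2 ⟨h, Finset.mem_univ s⟩⟩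
  have hXY : IndepFun (W t) Y P := by
    have := hind.indepFun_finset {t} U (by simp [U]) hW
    exact this.comp (φ := fun w : (({t} : Finset T) → ℕ∞) => w ⟨t, Finset.mem_singleton_self t⟩)
      (ψ := id) (measurable_pi_apply _) measurable_id
  have hlaw := (indepFun_iff_map_prod_eq_prod_map_map (hW t).aemeasurable hY.aemeasurable).1 hXY
  -- No measurability of `φ` is needed: `T` is finite, so all spaces of counts are countable.
  have hφ : Measurable fun p => φ (comb p) := measurable_of_countable _
  have e1 : ∀ ω, (fun s => W s ω) = comb (W t ω, Y ω) := by
    intro ω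
    ext s
    by_cases h : s = t
    · simp [comb, h]
    · simp [comb, h, Y]
  have e2 : ∀ ω, Function.update (fun s => W s ω) t (W t ω - 1) = comb (W t ω - 1, Y ω) := by
    intro ω
    ext s
    by_cases h : s = t
    · subst h; simp [comb]
    · simp [comb, h, Y]
  have key : ∀ F : ℕ∞ × (U → ℕ∞) → ℝ≥0∞, ∫⁻ ω, F (W t ω, Y ω) ∂P =
      ∫⁻ y, ∫⁻ n, F ((n : ℕ), y) ∂poissonMeasure r ∂P.map Y := by
    intro F
    have hF : Measurable F := measurable_of_countable _
    rw [← lintegral_map hF ((hW t).prodMk hY), hlaw, lintegral_prod_symm _ hF.aemeasurable, ht]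
    refine lintegral_congr fun y => ?_
    rw [lintegral_map (measurable_of_countable _) (measurable_of_countable _)]
  simp_rw [e2, e1]
  rw [key (fun p => (p.1 : ℝ≥0∞) * φ (comb (p.1 - 1, p.2))), key (fun p => φ (comb p)),
    ← lintegral_const_mul _ (measurable_of_countable _)]
  refine lintegral_congr fun y => ?_
  rw [← lintegral_poissonMeasure_mul_pred r fun n => φ (comb (n, y))]
  refine lintegral_congr fun n => ?_
  simp

/-! ### The Mecke formula on cylinder events. -/

namespace Params

variable (M : Params)

lemma measurableSet_freeSet : MeasurableSet M.freeSet := measurableSet_Ioi.diff M.measurableSet_B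

/-- The stack sizes at the roadblocks. -/
noncomputable def roadCounts (η : Config) (b : {b : ℝ // b ∈ M.B ∧ 0 < b}) : ℕ := η.count b

lemma measurable_roadCounts : Measurable M.roadCounts :=
  measurable_pi_lambda _ fun _ => Config.measurable_count measurable_id measurable_const

/-- The events that depend on finitely many numbers of free stacks and on the stack sizes at the
roadblocks. -/
def cylinders : Set (Set Config) :=
  {G | ∃ (n : ℕ) (C : Fin n → Set (ℝ × ℕ)) (g : Set (Fin n → ℕ∞))
    (r : Set ({b : ℝ // b ∈ M.B ∧ 0 < b} → ℕ)), (∀ i, MeasurableSet (C i)) ∧ MeasurableSet r ∧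
    G = {η | (fun i => numStacks M.freeSet (C i) η) ∈ g} ∩ M.roadCounts ⁻¹' r}

lemma isPiSystem_cylinders : IsPiSystem M.cylinders := by
  rintro _ ⟨n, C, g, r, hC, hr, rfl⟩ _ ⟨n', C', g', r', hC', hr', rfl⟩ -
  refine ⟨n + n', Fin.append C C',
    {w | (fun i => w (Fin.castAdd n' i)) ∈ g ∧ (fun i => w (Fin.natAdd n i)) ∈ g'}, r ∩ r', ?_,
    hr.inter hr', ?_⟩
  · intro i
    induction i using Fin.addCases with
    | left i => rw [Fin.append_left]; exact hC i
    | right i => rw [Fin.append_right]; exact hC' i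
  · ext η
    simp only [Set.mem_inter_iff, Set.mem_ofPred_eq, Set.mem_preimage, Fin.append_left,
      Fin.append_right]
    tauto

lemma univ_mem_cylinders : Set.univ ∈ M.cylinders :=
  ⟨0, fun i => i.elim0, Set.univ, Set.univ, fun i => i.elim0, MeasurableSet.univ, by simp⟩

lemma measurableSet_of_mem_cylinders {G : Set Config} (hG : G ∈ M.cylinders) :
    MeasurableSet G := by
  obtain ⟨n, C, g, r, hC, hr, rfl⟩ := hG
  refine MeasurableSet.inter ?_ (M.measurable_roadCounts hr)
  have : Measurable fun η => fun i => numStacks M.freeSet (C i) η :=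
    measurable_pi_lambda _ fun i => measurable_numStacks M.measurableSet_freeSet (hC i)
  exact this (Set.to_countable g).measurableSet

/-- The particle numbers are recovered from the numbers of free stacks of each size and from the
stacks at the roadblocks. These are exactly the quantities whose joint law `IsInitialLaw`
prescribes, so the cylinders generate the `σ`-algebra. -/
lemma toMeasure_eq (η : Config) {A : Set ℝ} (hA : MeasurableSet A) :
    η.toMeasure A = (∑' m : ℕ, (m : ℝ≥0∞) * (numStacks M.freeSet (A ×ˢ {m}) η : ℝ≥0∞)) +
      ∑' b : {b : ℝ // b ∈ M.B ∧ 0 < b}, (M.roadCounts η b : ℝ≥0∞) * A.indicator 1 b.1 := by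
  classical
  have h1 : ∀ m : ℕ, (m : ℝ≥0∞) * (numStacks M.freeSet (A ×ˢ {m}) η : ℝ≥0∞) =
      ∑' y, {y : ℝ | y ∈ M.freeSet ∧ y ∈ A ∧ η.count y = m}.indicator
        (fun y => (η.count y : ℝ≥0∞)) y := by
    intro m
    rw [coe_numStacks, ← ENNReal.tsum_mul_left]
    refine tsum_congr fun y => ?_
    simp only [Set.indicator_apply, Set.mem_ofPred_eq, Set.mem_prod, Set.mem_singleton_iff]
    by_cases h : y ∈ M.freeSet ∧ y ∈ A ∧ η.count y = m
    · rw [if_pos h]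
      by_cases h0 : η.count y = 0
      · simp [h0]
      · rw [if_pos ⟨h.1, h0, h.2⟩, h.2.2]; simp
    · rw [if_neg h, if_neg fun h' => h ⟨h'.1, h'.2.2⟩, mul_zero]
  have h2 : ∀ y, (∑' m : ℕ, {y : ℝ | y ∈ M.freeSet ∧ y ∈ A ∧ η.count y = m}.indicator
        (fun y => (η.count y : ℝ≥0∞)) y) =
      (η.count y : ℝ≥0∞) * (if y ∈ M.freeSet ∧ y ∈ A then 1 else 0) := by
    intro y
    rw [tsum_eq_single (η.count y)]
    · by_cases h : y ∈ M.freeSet ∧ y ∈ A <;> simp [h]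
    · intro m hm
      exact Set.indicator_of_notMem (fun h => hm h.2.2.symm) _
  simp_rw [h1]
  rw [ENNReal.tsum_comm]
  have h3 := tsum_subtype {b : ℝ | b ∈ M.B ∧ 0 < b}
    (fun b => (η.count b : ℝ≥0∞) * A.indicator 1 b)
  have h4 : ∑' b : {b : ℝ // b ∈ M.B ∧ 0 < b}, (M.roadCounts η b : ℝ≥0∞) * A.indicator 1 b.1 =
    ∑' b, {b : ℝ | b ∈ M.B ∧ 0 < b}.indicator
      (fun b => (η.count b : ℝ≥0∞) * A.indicator 1 b) b := h3
  rw [h4, ← ENNReal.tsum_add, Config.toMeasure_apply _ hA]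
  refine tsum_congr fun y => ?_
  rw [h2]
  by_cases hp : 0 < y
  · by_cases hB : y ∈ M.B <;> by_cases hyA : y ∈ A <;> simp [freeSet, hp, hB, hyA]
  · simp [η.count_nonpos y (not_lt.1 hp), Set.indicator_apply]

lemma generateFrom_cylinders :
    MeasurableSpace.generateFrom M.cylinders = (inferInstance : MeasurableSpace Config) := by
  apply le_antisymm
  · exact MeasurableSpace.generateFrom_le fun G hG => M.measurableSet_of_mem_cylinders hG
  · have hcount : Countable {b : ℝ // b ∈ M.B ∧ 0 < b} := by
      exact (M.countable_B.mono fun b hb => hb.1 : {b : ℝ | b ∈ M.B ∧ 0 < b}.Countable).to_subtype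
    let m₀ : MeasurableSpace Config := MeasurableSpace.generateFrom M.cylinders
    have hN : ∀ C : Set (ℝ × ℕ), MeasurableSet C →
        Measurable[m₀] (fun η => (numStacks M.freeSet C η : ℝ≥0∞)) := by
      intro C hC
      have : Measurable[m₀] (numStacks M.freeSet C) := by
        refine @ENat.measurable_iff _ m₀ _ |>.2 fun n => ?_
        refine MeasurableSpace.measurableSet_generateFrom
          ⟨1, fun _ => C, {w | w 0 = n}, Set.univ, fun _ => hC, MeasurableSet.univ, ?_⟩
        ext η
        simp
      have hc : Measurable fun n : ℕ∞ => (n : ℝ≥0∞) := measurable_of_countable _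
      exact hc.comp this
    have hR : ∀ b, Measurable[m₀] (fun η => (M.roadCounts η b : ℝ≥0∞)) := by
      intro b
      have : Measurable[m₀] (fun η => M.roadCounts η b) := by
        refine @measurable_to_countable' ℕ Config _ _ m₀ _ fun n => ?_
        refine MeasurableSpace.measurableSet_generateFrom
          ⟨0, fun i => i.elim0, Set.univ, {w | w b = n}, fun i => i.elim0, ?_, ?_⟩
        · exact measurableSet_eq_fun (measurable_pi_apply b) measurable_const
        · ext η
          simp
      have hc : Measurable fun n : ℕ => (n : ℝ≥0∞) := measurable_of_countable _
      exact hc.comp this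
    refine MeasurableSpace.comap_le_iff_le_map.2 ?_
    have : Measurable[m₀] Config.toMeasure := by
      refine @Measure.measurable_of_measurable_coe _ _ _ m₀ _ fun A hA => ?_
      simp_rw [M.toMeasure_eq _ hA]
      refine Measurable.add (Measurable.tsum fun m => ?_)
        (Measurable.tsum fun b => ?_)
      · exact (hN _ (hA.prod (measurableSet_singleton m))).const_mul _
      · exact (hR b).mul_const _
    exact measurable_iff_le_map.1 this

variable {M} {u : ℝ} {P : Measure Config}

lemma IsInitialLaw.iIndepFun_numStacks (hP : M.IsInitialLaw u P) {T : Type*} [Fintype T]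
    (C : T → Set (ℝ × ℕ)) (hC : ∀ t, MeasurableSet (C t))
    (hd : ∀ s t, s ≠ t → Disjoint (C s) (C t)) :
    iIndepFun (fun t => numStacks M.freeSet (C t)) P := by
  let e := Fintype.equivFin T
  have := hP.free.indep _ (fun i => C (e.symm i)) (fun i => hC _)
    fun i j hij => hd _ _ fun h => hij (e.symm.injective h)
  simpa using this.precomp e.injective

lemma IsInitialLaw.indepFun_roadCounts (hP : M.IsInitialLaw u P) {T : Type*} [Fintype T]
    (C : T → Set (ℝ × ℕ)) (hC : ∀ t, MeasurableSet (C t)) :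
    IndepFun (fun η t => numStacks M.freeSet (C t) η) M.roadCounts P := by
  let e := Fintype.equivFin T
  have := hP.indep_free_roadblock _ (fun i => C (e.symm i)) (fun i => hC _)
  have h2 := this.comp (φ := fun w t => w (e t)) (ψ := id)
    (measurable_pi_lambda _ fun t => measurable_pi_apply _) measurable_id
  change IndepFun _ (fun (η : Config) (b : {b : ℝ // b ∈ M.B ∧ 0 < b}) => η.count b) P
  simpa [Function.comp_def] using h2

/-- The Mecke formula on rectangles. -/
lemma IsInitialLaw.mecke_cylinder (hP : M.IsInitialLaw u P) {L : ℝ} {D : Set (ℝ × ℕ)}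
    (hD : MeasurableSet D) (hDL : ∀ x ∈ D, x.1 ≤ L)
    (hfin : markedIntensity M.freeSet (M.stackRate u) (M.markLaw u) D ≠ ∞) {G : Set Config}
    (hG : G ∈ M.cylinders) :
    ∫⁻ η, ∑ y ∈ η.sites L, {y : ℝ | y ∈ M.freeSet ∧ (y, η.count y) ∈ D}.indicator
        (fun y => G.indicator 1 (η.set y 0)) y ∂P =
      markedIntensity M.freeSet (M.stackRate u) (M.markLaw u) D * P G := by
  classical
  have := hP.isProbabilityMeasure
  have hGm := M.measurableSet_of_mem_cylinders hG
  obtain ⟨n, C, g, r, hC, hr, rfl⟩ := hG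
  set lam := markedIntensity M.freeSet (M.stackRate u) (M.markLaw u) with hlam
  -- A point of `T` records membership in each `C i` and in `D`. The fibres of `τ` are disjoint
  -- cells with independent counts `W`; both the event `G` and the set `D` are described by them.
  let T := (Fin n → Prop) × Prop
  let τ : ℝ × ℕ → T := fun x => (fun i => x ∈ C i, x ∈ D)
  have hτ : Measurable τ :=
    (measurable_pi_lambda _ fun i => measurable_mem.2 (hC i)).prodMk (measurable_mem.2 hD)
  let A : T → Set (ℝ × ℕ) := fun t => τ ⁻¹' {t}
  have hA : ∀ t, MeasurableSet (A t) := fun t => hτ (measurableSet_singleton t)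
  have hAd : ∀ s t, s ≠ t → Disjoint (A s) (A t) := fun s t hst =>
    Disjoint.preimage _ (by simpa using hst)
  have hAD : ∀ t : T, t.2 → A t ⊆ D := by
    rintro t ht x hx
    have : x ∈ D ↔ t.2 := by rw [← show τ x = t from hx]
    exact this.2 ht
  let W : T → Config → ℕ∞ := fun t => numStacks M.freeSet (A t)
  have hWm : ∀ t, Measurable (W t) := fun t => measurable_numStacks M.measurableSet_freeSet (hA t)
  have hWind : iIndepFun W P := hP.iIndepFun_numStacks A hA hAd
  have hWR : IndepFun (fun η t => W t η) M.roadCounts P := hP.indepFun_roadCounts A hA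
  let ψ : (T → ℕ∞) → ℝ≥0∞ := fun w =>
    g.indicator 1 fun i => ∑ t : T, if t.1 i then w t else 0
  let ρ : Config → ℝ≥0∞ := fun η => r.indicator 1 (M.roadCounts η)
  have hCW : ∀ i η, numStacks M.freeSet (C i) η = ∑ t : T, if t.1 i then W t η else 0 := by
    intro i η
    exact numStacks_preimage M.freeSet τ (fun t => t.1 i) η
  have hind : ∀ η, ({η | (fun i => numStacks M.freeSet (C i) η) ∈ g} ∩
      M.roadCounts ⁻¹' r).indicator (1 : Config → ℝ≥0∞) η = ψ (fun t => W t η) * ρ η := by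
    intro η
    rw [Set.inter_indicator_one]
    simp only [ψ, ρ, ← hCW]
    rfl
  -- Removing a free stack in the cell `t` lowers `W t` by one and changes neither the other cells
  -- nor the roadblocks. All `W t` stacks of a cell thus contribute the same value.
  have hpt : ∀ η : Config, ∑ y ∈ η.sites L,
      {y : ℝ | y ∈ M.freeSet ∧ (y, η.count y) ∈ D}.indicator
        (fun y => ({η | (fun i => numStacks M.freeSet (C i) η) ∈ g} ∩
          M.roadCounts ⁻¹' r).indicator (1 : Config → ℝ≥0∞) (η.set y 0)) y =
      ∑ t : T, if t.2 then
        ((W t η : ℝ≥0∞) * ψ (Function.update (fun s => W s η) t (W t η - 1))) * ρ η else 0 := by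
    intro η
    have h1 : ∀ t : T, (if t.2 then
        ((W t η : ℝ≥0∞) * ψ (Function.update (fun s => W s η) t (W t η - 1))) * ρ η else 0) =
        ∑ y ∈ η.sites L, if t.2 then
          {y : ℝ | y ∈ M.freeSet ∧ (y, η.count y) ∈ A t}.indicator 1 y *
          (ψ (Function.update (fun s => W s η) t (W t η - 1)) * ρ η) else 0 := by
      intro t
      by_cases ht : t.2
      · simp only [ht, if_true]
        rw [← Finset.sum_mul, sum_sites_eq_numStacks (fun x hx => hDL x (hAD t ht hx)), mul_assoc]
      · simp [ht]
    simp_rw [h1]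
    rw [Finset.sum_comm]
    refine Finset.sum_congr rfl fun y hy => ?_
    have h0 := (Config.mem_sites.1 hy).2
    rw [Finset.sum_eq_single (τ (y, η.count y))]
    · by_cases hyD : (y, η.count y) ∈ D
      · have h2 : (τ (y, η.count y)).2 := hyD
        rw [if_pos h2]
        by_cases hyS : y ∈ M.freeSet
        · rw [Set.indicator_of_mem (show y ∈ {y : ℝ | y ∈ M.freeSet ∧ (y, η.count y) ∈ D} from
            ⟨hyS, hyD⟩), Set.indicator_of_mem (show y ∈ {x : ℝ | x ∈ M.freeSet ∧
            (x, η.count x) ∈ A (τ (y, η.count y))} from ⟨hyS, rfl⟩), hind]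
          rw [Pi.one_apply, one_mul]
          congr 1
          · congr 1
            ext t
            by_cases ht : t = τ (y, η.count y)
            · subst ht
              rw [Function.update_self]
              exact numStacks_set_zero_of_mem hyS h0 rfl
            · rw [Function.update_of_ne ht]
              exact numStacks_set_zero_of_notMem (fun h => ht h.2.symm) h0
          · have : M.roadCounts (η.set y 0) = M.roadCounts η := by
              ext b
              refine Config.count_set_of_ne _ ?_ _
              rintro rfl
              exact hyS.2 b.2.1
            simp only [ρ, this]
        · rw [Set.indicator_of_notMem fun h => hyS h.1, Set.indicator_of_notMem fun h => hyS h.1,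
            zero_mul]
      · rw [Set.indicator_of_notMem fun h => hyD h.2, if_neg]
        exact hyD
    · intro t _ ht
      rw [Set.indicator_of_notMem, zero_mul, ite_self]
      exact fun h => ht h.2.symm
    · simp
  have hψm : Measurable ψ := measurable_of_countable _
  have hWv : Measurable fun η t => W t η := measurable_pi_lambda _ hWm
  have hρm : Measurable (r.indicator fun _ => (1 : ℝ≥0∞)) :=
    measurable_const.indicator hr
  have hfac : ∀ F : (T → ℕ∞) → ℝ≥0∞, ∫⁻ η, F (fun t => W t η) * ρ η ∂P =
      (∫⁻ η, F (fun t => W t η) ∂P) * ∫⁻ η, ρ η ∂P := by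
    intro F
    have hF : Measurable F := measurable_of_countable _
    exact lintegral_mul_eq_lintegral_mul_lintegral_of_indepFun (hF.comp hWv)
      (hρm.comp M.measurable_roadCounts) (hWR.comp hF hρm)
  have hPG : P ({η | (fun i => numStacks M.freeSet (C i) η) ∈ g} ∩ M.roadCounts ⁻¹' r) =
      (∫⁻ η, ψ (fun t => W t η) ∂P) * ∫⁻ η, ρ η ∂P := by
    rw [← lintegral_indicator_one hGm, ← hfac]
    exact lintegral_congr hind
  have hterm : ∀ t : T, ∫⁻ η, (if t.2 then
      ((W t η : ℝ≥0∞) * ψ (Function.update (fun s => W s η) t (W t η - 1))) * ρ η else 0) ∂P =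
      (if t.2 then lam (A t) else 0) *
        ((∫⁻ η, ψ (fun t => W t η) ∂P) * ∫⁻ η, ρ η ∂P) := by
    intro t
    by_cases ht : t.2
    · simp only [ht, if_true]
      -- Only the cells inside `D` have to have finite intensity; the laws of the other counts play
      -- no role.
      have hlt : lam (A t) ≠ ∞ := ne_top_of_le_ne_top hfin (measure_mono (hAD t ht))
      have h1 := lintegral_poisson_family hWm hWind (hP.free.law (A t) (hA t) hlt) ψ
      rw [ENNReal.coe_toNNReal hlt] at h1
      rw [hfac (fun w => (w t : ℝ≥0∞) * ψ (Function.update w t (w t - 1))), h1, mul_assoc]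
    · simp [ht]
  have hsumD : lam D = ∑ t : T, if t.2 then lam (A t) else 0 := by
    have hU : D = ⋃ t ∈ Finset.univ.filter (fun t : T => t.2), A t := by
      ext x
      simp only [Set.mem_iUnion, Finset.mem_filter, Finset.mem_univ, true_and]
      constructor
      · exact fun hx => ⟨τ x, hx, rfl⟩
      · rintro ⟨t, ht, hx⟩
        exact hAD t ht hx
    conv_lhs => rw [hU]
    rw [measure_biUnion_finset (fun s _ t _ hst => hAd s t hst) fun t _ => hA t,
      Finset.sum_filter]
  simp_rw [hpt]
  rw [lintegral_finsetSum]
  · simp_rw [hterm]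
    rw [← Finset.sum_mul, ← hsumD, hPG]
  · intro t _
    by_cases ht : t.2
    · simp only [ht, if_true]
      have hF : Measurable fun w : T → ℕ∞ => (w t : ℝ≥0∞) * ψ (Function.update w t (w t - 1)) :=
        measurable_of_countable _
      exact (hF.comp hWv).mul (hρm.comp M.measurable_roadCounts)
    · simp [ht]

end Params

/-! ### The intensity of the free stacks and the general Mecke formula. -/

lemma summable_psiZero {q z : ℝ} (hq0 : 0 ≤ q) (hq1 : q < 1) (hz0 : 0 ≤ z) (hz1 : z < 1) :
    Summable fun k : ℕ => z ^ (k + 1) / (1 - q ^ (k + 1)) := by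
  have h1q : 0 < 1 - q := sub_pos.2 hq1
  refine Summable.of_nonneg_of_le (fun k => ?_) (fun k => ?_)
    (((summable_geometric_of_lt_one hz0 hz1).mul_left z).mul_right (1 - q)⁻¹)
  · exact div_nonneg (pow_nonneg hz0 _) (sub_nonneg.2 (pow_le_one₀ hq0 hq1.le))
  · rw [pow_succ' z, div_eq_mul_inv]
    have h2 : q ^ (k + 1) ≤ q := pow_le_of_le_one hq0 hq1.le (Nat.succ_ne_zero k)
    have h3 : (1 - q ^ (k + 1))⁻¹ ≤ (1 - q)⁻¹ := inv_anti₀ h1q (by linarith)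
    have := pow_nonneg hz0 k
    gcongr

lemma psiZero_pos {q z : ℝ} (hq0 : 0 ≤ q) (hq1 : q < 1) (hz0 : 0 < z) (hz1 : z < 1) :
    0 < psiZero q z := by
  refine (summable_psiZero hq0 hq1 hz0.le hz1).tsum_pos (fun k => ?_) 0 ?_
  · exact div_nonneg (pow_nonneg hz0.le _) (sub_nonneg.2 (pow_le_one₀ hq0 hq1.le))
  · simp only [zero_add, pow_one]
    exact div_pos hz0 (sub_pos.2 hq1)

namespace Params

variable {M : Params} {u : ℝ}

/-- The intensity of stacks of size `m + 1` at `y`. -/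
noncomputable def stackWeight (M : Params) (u : ℝ) (m : ℕ) (y : ℝ) : ℝ :=
  M.k y * ((u / M.v y) ^ (m + 1) / (1 - M.q ^ (m + 1)))

lemma one_sub_pow_pos (M : Params) (m : ℕ) : 0 < 1 - M.q ^ (m + 1) :=
  sub_pos.2 (pow_lt_one₀ M.q_nonneg M.q_lt_one (Nat.succ_ne_zero m))

lemma measurable_stackWeight (M : Params) (u : ℝ) (m : ℕ) : Measurable (M.stackWeight u m) :=
  M.k_measurable.mul (((measurable_const.div M.v_measurable).pow_const _).div_const _)

section

variable (hu : 0 < u) (hv : ∀ y, 0 < y → u < M.v y)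

include hu hv

lemma div_v_mem {y : ℝ} (hy : 0 < y) : 0 < u / M.v y ∧ u / M.v y < 1 :=
  ⟨div_pos hu (M.v_pos y hy.le), (div_lt_one (M.v_pos y hy.le)).2 (hv y hy)⟩

/-- The normalization `ψ₀` cancels, since it is positive; here `u < v(y)` makes its series converge.
-/
lemma stackRate_mul_markLaw {y : ℝ} (hy : 0 < y) (m : ℕ) :
    M.stackRate u y * M.markLaw u y (m + 1) = M.stackWeight u m y := by
  obtain ⟨h0, h1⟩ := div_v_mem hu hv hy
  have := psiZero_pos M.q_nonneg M.q_lt_one h0 h1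
  rw [stackRate, markLaw, stackWeight]
  field_simp

lemma lintegral_markedIntensity {G : ℝ × ℕ → ℝ≥0∞} (hG : Measurable G) :
    ∫⁻ x, G x ∂markedIntensity M.freeSet (M.stackRate u) (M.markLaw u) =
      ∑' m : ℕ, ∫⁻ y in M.freeSet, ENNReal.ofReal (M.stackWeight u m y) * G (y, m + 1) := by
  -- Stacks of size `m + 1` have the weight of index `m`, hence the shift; the size `0` is excluded
  -- from the intensity measure.
  let d : ℝ × ℕ → ℝ≥0∞ := fun x => ENNReal.ofReal (M.stackWeight u (x.2 - 1) x.1)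
  have hd : Measurable d := by
    refine measurable_from_prod_countable_left fun m => ?_
    exact (M.measurable_stackWeight u (m - 1)).ennreal_ofReal
  have hae : (fun x : ℝ × ℕ => ENNReal.ofReal (M.stackRate u x.1 * M.markLaw u x.1 x.2)) =ᵐ[
      (volume.restrict M.freeSet).prod (Measure.count.restrict {m : ℕ | 1 ≤ m})] d := by
    rw [Measure.prod_restrict]
    refine (ae_restrict_iff' (M.measurableSet_freeSet.prod
      (Set.to_countable _).measurableSet)).2 (ae_of_all _ ?_)
    rintro ⟨y, m⟩ ⟨hy, hm⟩
    obtain ⟨m, rfl⟩ := Nat.exists_eq_add_of_le' (show 1 ≤ m from hm)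
    simp only [d, Nat.add_sub_cancel]
    rw [stackRate_mul_markLaw hu hv hy.1]
  rw [markedIntensity, withDensity_congr_ae hae, lintegral_withDensity_eq_lintegral_mul _ hd hG,
    lintegral_prod_symm _ (hd.mul hG).aemeasurable, ← lintegral_indicator
    (Set.to_countable _).measurableSet, lintegral_count, tsum_eq_zero_add' ENNReal.summable]
  simp [d]

lemma tsum_stackWeight {y : ℝ} (hy : 0 < y) :
    ∑' m : ℕ, ENNReal.ofReal (M.stackWeight u m y) = ENNReal.ofReal (M.stackRate u y) := by
  obtain ⟨h0, h1⟩ := div_v_mem hu hv hy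
  rw [stackRate, psiZero, ← tsum_mul_left, ENNReal.ofReal_tsum_of_nonneg]
  · rfl
  · intro m
    exact mul_nonneg (M.k_pos y hy.le).le
      (div_nonneg (pow_nonneg h0.le _) (M.one_sub_pow_pos m).le)
  · exact (summable_psiZero M.q_nonneg M.q_lt_one h0.le h1).mul_left _

lemma markedIntensity_window_lt_top {L : ℝ}
    (hrate : IntegrableOn (M.stackRate u) (Set.Ioc 0 L)) :
    markedIntensity M.freeSet (M.stackRate u) (M.markLaw u) {x | x.1 ≤ L} < ∞ := by
  have hm : MeasurableSet {x : ℝ × ℕ | x.1 ≤ L} := measurableSet_le measurable_fst measurable_const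
  rw [← lintegral_indicator_one hm, lintegral_markedIntensity hu hv (measurable_one.indicator hm),
    ← lintegral_tsum]
  · refine lt_of_le_of_lt ?_ hrate.lintegral_lt_top
    rw [← lintegral_indicator M.measurableSet_freeSet, ← lintegral_indicator measurableSet_Ioc]
    refine lintegral_mono fun y => ?_
    by_cases hy : y ∈ M.freeSet
    · rw [Set.indicator_of_mem hy]
      by_cases hL : y ≤ L
      · rw [Set.indicator_of_mem (show y ∈ Set.Ioc 0 L from ⟨hy.1, hL⟩),
          ← tsum_stackWeight hu hv hy.1]
        simp [hL]
      · simp [hL]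
    · rw [Set.indicator_of_notMem hy]
      exact zero_le
  · intro m
    refine ((M.measurable_stackWeight u m).ennreal_ofReal.mul ?_).aemeasurable
    exact (measurable_one.indicator hm).comp measurable_prodMk_right

end

variable {P : Measure Config}

/-- The Mecke formula for the free stacks. -/
theorem IsInitialLaw.mecke (hP : M.IsInitialLaw u P) (hu : 0 < u)
    (hv : ∀ y, 0 < y → u < M.v y) {L : ℝ}
    (hrate : IntegrableOn (M.stackRate u) (Set.Ioc 0 L)) {G : (ℝ × ℕ) × Config → ℝ≥0∞}
    (hG : Measurable G) :
    ∫⁻ η, ∑ y ∈ η.sites L, M.freeSet.indicator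
        (fun y => G ((y, η.count y), η.set y 0)) y ∂P =
      ∑' m : ℕ, ∫⁻ y in M.freeSet ∩ Set.Iic L, ENNReal.ofReal (M.stackWeight u m y) *
        ∫⁻ ξ, G ((y, m + 1), ξ) ∂P := by
  classical
  have := hP.isProbabilityMeasure
  set lam := markedIntensity M.freeSet (M.stackRate u) (M.markLaw u) with hlam
  let Win : Set (ℝ × ℕ) := {x | x.1 ≤ L}
  have hWin : MeasurableSet Win := measurableSet_le measurable_fst measurable_const
  have hfin : lam Win < ∞ := markedIntensity_window_lt_top hu hv hrate
  have : IsFiniteMeasure (lam.restrict Win) := ⟨by rwa [Measure.restrict_apply_univ]⟩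
  let D : Config → ℝ → Measure ((ℝ × ℕ) × Config) := fun η y =>
    M.freeSet.indicator (fun y => Measure.dirac ((y, η.count y), η.set y 0)) y
  -- Each free stack of `η` in the window becomes a unit mass at the pair (stack, configuration
  -- without it). Averaged over `P`, this measure will turn out to be the product of the intensity
  -- and `P`.
  let m : Config → Measure ((ℝ × ℕ) × Config) := fun η => ∑ y ∈ η.sites L, D η y
  have hint : ∀ (η : Config) (F : (ℝ × ℕ) × Config → ℝ≥0∞), Measurable F → ∫⁻ x, F x ∂m η =
      ∑ y ∈ η.sites L, M.freeSet.indicator (fun y => F ((y, η.count y), η.set y 0)) y := by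
    intro η F hF
    rw [lintegral_finsetSum_measure]
    refine Finset.sum_congr rfl fun y _ => ?_
    by_cases hy : y ∈ M.freeSet
    · simp only [D, Set.indicator_of_mem hy]
      exact lintegral_dirac' _ hF
    · simp [D, Set.indicator_of_notMem hy]
  have hFm : ∀ F : (ℝ × ℕ) × Config → ℝ≥0∞, Measurable F → Measurable fun p : Config × ℝ =>
      M.freeSet.indicator (fun y => F ((y, p.1.count y), p.1.set y 0)) p.2 := by
    intro F hF
    have h1 : Measurable fun p : Config × ℝ => F ((p.2, p.1.count p.2), p.1.set p.2 0) :=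
      hF.comp ((measurable_snd.prodMk (Config.measurable_count measurable_fst measurable_snd)).prodMk
        (Config.measurable_set measurable_fst measurable_snd measurable_const))
    exact h1.indicator (measurable_snd M.measurableSet_freeSet)
  have hm : Measurable m := by
    refine Measure.measurable_of_measurable_coe _ fun E hE => ?_
    have : ∀ η, m η E = ∑ y ∈ η.sites L, M.freeSet.indicator
        (fun y => E.indicator 1 ((y, η.count y), η.set y 0)) y := by
      intro η
      rw [← hint _ _ (measurable_one.indicator hE), lintegral_indicator_one hE]
    simp_rw [this]
    exact Config.measurable_sum_sites measurable_id L (hFm _ (measurable_one.indicator hE))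
  -- `mecke_cylinder` gives equality on rectangles with a cylinder as second side. These form a
  -- `π`-system that generates the product, and the window makes the first factor finite.
  have hprod : (lam.restrict Win).prod P = P.bind m := by
    refine Measure.prod_eq_generateFrom (C := {s | MeasurableSet s}) (D := M.cylinders)
      MeasurableSpace.generateFrom_measurableSet M.generateFrom_cylinders
      MeasurableSpace.isPiSystem_measurableSet M.isPiSystem_cylinders
      ⟨fun _ => Set.univ, fun _ => MeasurableSet.univ, fun _ => measure_lt_top _ _,
        Set.iUnion_const _⟩
      ⟨fun _ => Set.univ, fun _ => M.univ_mem_cylinders, fun _ => measure_lt_top _ _,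
        Set.iUnion_const _⟩ fun s hs G hG => ?_
    have hs : MeasurableSet s := hs
    have hGm := M.measurableSet_of_mem_cylinders hG
    rw [← lintegral_indicator_one (hs.prod hGm), Measure.lintegral_bind hm.aemeasurable
      (measurable_one.indicator (hs.prod hGm)).aemeasurable, Measure.restrict_apply hs,
      ← hP.mecke_cylinder (hs.inter hWin) (L := L) (fun x hx => hx.2)
        (ne_top_of_le_ne_top hfin.ne (measure_mono Set.inter_subset_right)) hG]
    refine lintegral_congr fun η => ?_
    rw [hint _ _ (measurable_one.indicator (hs.prod hGm))]
    refine Finset.sum_congr rfl fun y hy => ?_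
    have hyL := (Config.mem_sites.1 hy).1
    by_cases h1 : y ∈ M.freeSet
    · by_cases h2 : (y, η.count y) ∈ s <;> by_cases h3 : η.set y 0 ∈ G <;>
        simp [Set.indicator_apply, h1, h2, h3, Win, hyL]
    · simp [Set.indicator_apply, h1]
  have hin : Measurable fun x : ℝ × ℕ => ∫⁻ ξ, G (x, ξ) ∂P := hG.lintegral_prod_right'
  calc _ = ∫⁻ η, ∫⁻ x, G x ∂m η ∂P := lintegral_congr fun η => (hint η G hG).symm
    _ = ∫⁻ x, G x ∂P.bind m := (Measure.lintegral_bind hm.aemeasurable hG.aemeasurable).symm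
    _ = ∫⁻ x, Win.indicator (fun x => ∫⁻ ξ, G (x, ξ) ∂P) x ∂lam := by
      rw [← hprod, lintegral_prod _ hG.aemeasurable, lintegral_indicator hWin]
    _ = _ := by
      rw [lintegral_markedIntensity hu hv (hin.indicator hWin)]
      refine tsum_congr fun m => ?_
      rw [Set.inter_comm, ← Measure.restrict_restrict measurableSet_Iic,
        ← lintegral_indicator measurableSet_Iic]
      refine lintegral_congr fun y => ?_
      by_cases hy : y ≤ L <;> simp [Win, hy]

/-! ### The stacks at the roadblocks -/

/-- The rest of the configuration consists of the free stacks and the other roadblocks. On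
cylinders, the independence of the roadblocks among themselves and from the free stacks factorizes
the probability; a `π`-`λ` argument extends this to all events. -/
lemma IsInitialLaw.indepFun_count_set (hP : M.IsInitialLaw u P) {b : ℝ} (hb : b ∈ M.B)
    (hb0 : 0 < b) : IndepFun (fun η : Config => η.count b) (fun η => η.set b 0) P := by
  classical
  have := hP.isProbabilityMeasure
  let b' : {b : ℝ // b ∈ M.B ∧ 0 < b} := ⟨b, hb, hb0⟩
  have hcm : Measurable fun η : Config => η.count b :=
    Config.measurable_count measurable_id measurable_const
  have hsm : Measurable fun η : Config => η.set b 0 :=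
    Config.measurable_set measurable_id measurable_const measurable_const
  have hup : Measurable fun w : {b : ℝ // b ∈ M.B ∧ 0 < b} → ℕ => Function.update w b' 0 :=
    measurable_update_left.comp measurable_id
  have hR : IndepFun (fun η : Config => η.count b)
      (fun η => Function.update (M.roadCounts η) b' 0) P := by
    have h1 := indep_iSup_of_disjoint (S := {b'}) (T := {b'}ᶜ)
      (fun i : {b : ℝ // b ∈ M.B ∧ 0 < b} =>
        (Config.measurable_count measurable_id measurable_const).comap_le)
      hP.indep_roadblock.iIndep disjoint_compl_right
    refine indep_of_indep_of_le_left (indep_of_indep_of_le_right h1 ?_) ?_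
    · refine measurable_iff_comap_le.1 ?_
      refine @measurable_pi_lambda _ _ _ (_) _ _ fun i => ?_
      by_cases hi : i = b'
      · subst hi
        simp
      · simp only [Function.update_of_ne hi]
        refine Measurable.mono (comap_measurable (fun η : Config => η.count i.1)) ?_ le_rfl
        exact le_iSup₂_of_le i hi le_rfl
    · exact le_iSup₂_of_le b' rfl le_rfl
  rw [indepFun_iff_measure_inter_preimage_eq_mul]
  intro s G hs hG
  have hn : ∀ (C : Set (ℝ × ℕ)) (η : Config),
      numStacks M.freeSet C (η.set b 0) = numStacks M.freeSet C η := by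
    intro C η
    by_cases h0 : η.count b = 0
    · rw [Config.set_count_of_eq _ h0]
    · exact numStacks_set_zero_of_notMem (fun h => h.1.2 hb) h0
  have hr : ∀ η : Config, M.roadCounts (η.set b 0) = Function.update (M.roadCounts η) b' 0 := by
    intro η
    ext i
    by_cases hi : i = b'
    · subst hi
      simp [roadCounts, b', Config.count_set_self _ hb0]
    · rw [Function.update_of_ne hi]
      exact Config.count_set_of_ne _ (fun h => hi (Subtype.ext h)) _
  -- For a fixed event `s` of the stack at `b`, both sides of the product formula are finite
  -- measures in the event of the rest, and can be compared on cylinders.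
  let μ₁ : Measure Config := (P.restrict ((fun η => η.count b) ⁻¹' s)).map (fun η => η.set b 0)
  let μ₂ : Measure Config := P ((fun η => η.count b) ⁻¹' s) • P.map (fun η => η.set b 0)
  have hfin2 : IsFiniteMeasure μ₂ := ⟨by
    simpa [μ₂] using ENNReal.mul_lt_top (measure_lt_top P _) (measure_lt_top _ _)⟩
  have happ : ∀ E, MeasurableSet E →
      μ₁ E = P ((fun η => η.count b) ⁻¹' s ∩ (fun η => η.set b 0) ⁻¹' E) ∧
      μ₂ E = P ((fun η => η.count b) ⁻¹' s) * P ((fun η => η.set b 0) ⁻¹' E) := by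
    intro E hE
    constructor
    · rw [Measure.map_apply hsm hE, Measure.restrict_apply (hsm hE), Set.inter_comm]
    · rw [Measure.smul_apply, Measure.map_apply hsm hE, smul_eq_mul]
  have heq : μ₁ = μ₂ := by
    refine ext_of_generate_finite M.cylinders M.generateFrom_cylinders.symm
      M.isPiSystem_cylinders ?_ ?_
    · intro E hE
      rw [(happ E (M.measurableSet_of_mem_cylinders hE)).1,
        (happ E (M.measurableSet_of_mem_cylinders hE)).2]
      obtain ⟨n, C, g, r, hC, hrm, rfl⟩ := hE
      have hind := hP.indepFun_roadCounts C hC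
      have hgm : MeasurableSet g := (Set.to_countable g).measurableSet
      let r' : Set ({b : ℝ // b ∈ M.B ∧ 0 < b} → ℕ) := (fun w => Function.update w b' 0) ⁻¹' r
      let s' : Set ({b : ℝ // b ∈ M.B ∧ 0 < b} → ℕ) := (fun w => w b') ⁻¹' s
      have hr' : MeasurableSet r' := hup hrm
      have hs' : MeasurableSet s' := (measurable_pi_apply b') hs
      have e1 : (fun η : Config => η.set b 0) ⁻¹'
          ({η | (fun i => numStacks M.freeSet (C i) η) ∈ g} ∩ M.roadCounts ⁻¹' r) =
          (fun η i => numStacks M.freeSet (C i) η) ⁻¹' g ∩ M.roadCounts ⁻¹' r' := by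
        ext η
        simp [hn, hr, r']
      have e2 : (fun η : Config => η.count b) ⁻¹' s ∩
          ((fun η i => numStacks M.freeSet (C i) η) ⁻¹' g ∩ M.roadCounts ⁻¹' r') =
          (fun η i => numStacks M.freeSet (C i) η) ⁻¹' g ∩ M.roadCounts ⁻¹' (s' ∩ r') := by
        rw [Set.preimage_inter, Set.inter_left_comm]
        rfl
      have e3 := hR.measure_inter_preimage_eq_mul _ _ hs hrm
      rw [e1, e2, hind.measure_inter_preimage_eq_mul _ _ hgm (hs'.inter hr'),
        hind.measure_inter_preimage_eq_mul _ _ hgm hr', Set.preimage_inter]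
      have e4 : P (M.roadCounts ⁻¹' s' ∩ M.roadCounts ⁻¹' r') =
          P ((fun η : Config => η.count b) ⁻¹' s) * P (M.roadCounts ⁻¹' r') := e3
      rw [e4]
      ring
    · rw [(happ _ MeasurableSet.univ).1, (happ _ MeasurableSet.univ).2]
      simp
  rw [← (happ G hG).1, heq, (happ G hG).2]

lemma IsInitialLaw.lintegral_count_set (hP : M.IsInitialLaw u P) {b : ℝ} (hb : b ∈ M.B)
    (hb0 : 0 < b) {H : ℕ → Config → ℝ≥0∞} (hH : ∀ m, Measurable (H m)) :
    ∫⁻ η, H (η.count b) (η.set b 0) ∂P =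
      ∑' m : ℕ, ENNReal.ofReal (M.roadblockLaw u b m) * ∫⁻ η, H m (η.set b 0) ∂P := by
  have hcm : Measurable fun η : Config => η.count b :=
    Config.measurable_count measurable_id measurable_const
  have hsm : Measurable fun η : Config => η.set b 0 :=
    Config.measurable_set measurable_id measurable_const measurable_const
  have h1 : ∀ η : Config, H (η.count b) (η.set b 0) =
      ∑' m : ℕ, ({m} : Set ℕ).indicator 1 (η.count b) * H m (η.set b 0) := by
    intro η
    rw [tsum_eq_single (η.count b)]
    · simp
    · intro m hm
      simp [hm.symm]
  simp_rw [h1]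
  have hi : ∀ m : ℕ, Measurable (({m} : Set ℕ).indicator (1 : ℕ → ℝ≥0∞)) := fun m =>
    measurable_of_countable _
  refine (lintegral_tsum fun m => (((hi m).comp hcm).mul ((hH m).comp hsm)).aemeasurable).trans ?_
  refine tsum_congr fun m => ?_
  have h2 := lintegral_mul_eq_lintegral_mul_lintegral_of_indepFun ((hi m).comp hcm)
    ((hH m).comp hsm) ((hP.indepFun_count_set hb hb0).comp (hi m) (hH m))
  refine h2.trans ?_
  congr 1
  rw [← hP.roadblock b hb hb0 m]
  have h3 : MeasurableSet {η : Config | η.count b = m} := hcm (measurableSet_singleton m)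
  rw [← lintegral_indicator_one h3]
  rfl

lemma qPoch_succ (q z : ℝ) (n : ℕ) : qPoch q z (n + 1) = qPoch q z n * (1 - z * q ^ n) :=
  Finset.prod_range_succ _ _

/-- The infinite products are a common factor, and only the last factors of the finite ones remain.
The two coefficients are the activation rate of `m + 1` particles and `u` times the hazard of a
roadblock with `m` particles. -/
lemma roadblockLaw_succ (M : Params) (u : ℝ) {b : ℝ} (hb : 0 < b) (m : ℕ) :
    M.v b * (1 - M.q ^ (m + 1)) * M.roadblockLaw u b (m + 1) =
      u * (1 - M.p b * M.q ^ m) * M.roadblockLaw u b m := by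
  have hv := (M.v_pos b hb.le).ne'
  have hq : ∀ n, qPoch M.q M.q n ≠ 0 := fun n => Finset.prod_ne_zero_iff.2 fun j _ => by
    rw [← pow_succ']
    exact (M.one_sub_pow_pos j).ne'
  have h1 := (M.one_sub_pow_pos m).ne'
  have h2 := hq m
  have h3 : qPoch M.q M.q (m + 1) = qPoch M.q M.q m * (1 - M.q ^ (m + 1)) := by
    rw [qPoch_succ, ← pow_succ']
  rw [roadblockLaw, roadblockLaw, h3, qPoch_succ, pow_succ (u / M.v b)]
  field_simp

lemma IsInitialLaw.lintegral_roadblock (hP : M.IsInitialLaw u P) (hu : 0 < u) {b : ℝ}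
    (hb : b ∈ M.B) (hb0 : 0 < b) {h : Config → ℝ≥0∞} (hh : Measurable h) :
    ∫⁻ η, ENNReal.ofReal (M.v b * (1 - M.q ^ η.count b)) * h (η.removeAt b) ∂P =
      ENNReal.ofReal u *
        ∫⁻ η, ENNReal.ofReal (1 - M.p b * M.q ^ η.count b) * h η ∂P := by
  have hset : ∀ m : ℕ, Measurable fun ξ : Config => h (ξ.set b m) := fun m =>
    hh.comp (Config.measurable_set measurable_id measurable_const measurable_const)
  have h1 := hP.lintegral_count_set hb hb0
    (H := fun m ξ => ENNReal.ofReal (M.v b * (1 - M.q ^ m)) * h (ξ.set b (m - 1)))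
    fun m => (hset _).const_mul _
  have h2 := hP.lintegral_count_set hb hb0
    (H := fun m ξ => ENNReal.ofReal (1 - M.p b * M.q ^ m) * h (ξ.set b m))
    fun m => (hset _).const_mul _
  simp only [Config.set_set, Config.set_count] at h1 h2
  have h3 : ∀ η : Config, η.removeAt b = η.set b (η.count b - 1) := fun _ => rfl
  simp_rw [h3]
  -- An empty roadblock has activation rate zero, so the first term drops out and the size can be
  -- shifted by one.
  rw [h1, h2, tsum_eq_zero_add' ENNReal.summable, ← ENNReal.tsum_mul_left]
  simp only [pow_zero, sub_self, mul_zero, ENNReal.ofReal_zero, zero_mul, lintegral_zero, zero_add,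
    Nat.add_sub_cancel]
  refine tsum_congr fun m => ?_
  rw [lintegral_const_mul _ (hset m), lintegral_const_mul _ (hset m), ← mul_assoc, ← mul_assoc,
    ← mul_assoc]
  congr 1
  have hp : 0 ≤ 1 - M.p b * M.q ^ m := sub_nonneg.2 (mul_le_one₀ (M.p_le_one b hb)
    (pow_nonneg M.q_nonneg m) (pow_le_one₀ M.q_nonneg M.q_lt_one.le))
  rw [mul_comm (ENNReal.ofReal (M.roadblockLaw u b (m + 1))),
    ← ENNReal.ofReal_mul (mul_nonneg (M.v_pos b hb0.le).le (M.one_sub_pow_pos m).le),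
    M.roadblockLaw_succ u hb0, ENNReal.ofReal_mul (mul_nonneg hu.le hp), ENNReal.ofReal_mul hu.le]
  ring

end Params

/-! ### The removal formula and the balance of gains and losses. -/

namespace Params

variable {M : Params} {u : ℝ} {P : Measure Config}

lemma measurable_ofReal_comp_count {f : ℝ → ℕ → ℝ} (hf : ∀ m, Measurable fun y => f y m) :
    Measurable fun p : Config × ℝ => ENNReal.ofReal (f p.2 (p.1.count p.2)) := by
  have h1 : Measurable fun x : ℝ × ℕ => ENNReal.ofReal (f x.1 x.2) :=
    measurable_from_prod_countable_left fun m => (hf m).ennreal_ofReal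
  exact h1.comp (measurable_snd.prodMk (Config.measurable_count measurable_fst measurable_snd))

lemma measurable_rate (M : Params) :
    Measurable fun p : Config × ℝ => ENNReal.ofReal (M.v p.2 * (1 - M.q ^ p.1.count p.2)) :=
  measurable_ofReal_comp_count (f := fun y m => M.v y * (1 - M.q ^ m)) fun _ =>
    M.v_measurable.mul_const _

/-- The free stacks, when one of their particles is removed. -/
lemma IsInitialLaw.lintegral_free (hP : M.IsInitialLaw u P) (hu : 0 < u)
    (hv : ∀ y, 0 < y → u < M.v y) {L : ℝ} (hrate : IntegrableOn (M.stackRate u) (Set.Ioc 0 L))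
    {h : ℝ → Config → ℝ≥0∞} (hh : Measurable (Function.uncurry h)) :
    ∫⁻ η, ∑ y ∈ η.sites L, M.freeSet.indicator (fun y =>
        ENNReal.ofReal (M.v y * (1 - M.q ^ η.count y)) * h y (η.removeAt y)) y ∂P =
      ENNReal.ofReal u * ((∫⁻ η, (∫⁻ y in Set.Ioc 0 L, ENNReal.ofReal (M.k y) * h y η) ∂P) +
        ∫⁻ η, ∑ y ∈ η.sites L, M.freeSet.indicator (fun y =>
          ENNReal.ofReal (1 - M.q ^ η.count y) * h y η) y ∂P) := by
  classical
  have := hP.isProbabilityMeasure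
  have hF : MeasurableSet (M.freeSet ∩ Set.Iic L) := M.measurableSet_freeSet.inter measurableSet_Iic
  have hd : ∀ f : ℕ → ℝ → ℝ, (∀ m, Measurable (f m)) → Measurable fun p : (ℝ × ℕ) × Config =>
      ENNReal.ofReal (f p.1.2 p.1.1) := by
    intro f hf
    have h1 : Measurable fun x : ℝ × ℕ => ENNReal.ofReal (f x.2 x.1) :=
      measurable_from_prod_countable_left fun m => (hf m).ennreal_ofReal
    exact h1.comp measurable_fst
  have hset : ∀ m : ℕ → ℕ, Measurable fun p : (ℝ × ℕ) × Config =>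
      h p.1.1 (p.2.set p.1.1 (m p.1.2)) := by
    intro m
    refine hh.comp ((measurable_fst.comp measurable_fst).prodMk (Config.measurable_set
      measurable_snd (measurable_fst.comp measurable_fst) ?_))
    exact (measurable_from_nat (f := m)).comp (measurable_snd.comp measurable_fst)
  have hset' : ∀ (m : ℕ) (y : ℝ), Measurable fun ξ : Config => h y (ξ.set y m) := fun m y =>
    hh.comp (measurable_const.prodMk
      (Config.measurable_set measurable_id measurable_const measurable_const))
  have hset2 : ∀ m : ℕ, Measurable fun y => ∫⁻ ξ, h y (ξ.set y m) ∂P := fun m =>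
    Measurable.lintegral_prod_right (hh.comp (measurable_fst.prodMk
      (Config.measurable_set measurable_snd measurable_fst measurable_const)))
  have m1 := hP.mecke hu hv hrate
    (G := fun p => ENNReal.ofReal (M.v p.1.1 * (1 - M.q ^ p.1.2)) *
      h p.1.1 (p.2.set p.1.1 (p.1.2 - 1)))
    ((hd (fun m y => M.v y * (1 - M.q ^ m)) fun m => M.v_measurable.mul_const _).mul
      (hset fun m => m - 1))
  have m2 := hP.mecke hu hv hrate
    (G := fun p => ENNReal.ofReal (1 - M.q ^ p.1.2) * h p.1.1 (p.2.set p.1.1 p.1.2))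
    ((hd (fun m _ => 1 - M.q ^ m) fun m => measurable_const).mul (hset fun m => m))
  simp only [Config.set_set, Config.set_count, Nat.add_sub_cancel] at m1 m2
  have hdef : ∀ (η : Config) (y : ℝ), η.removeAt y = η.set y (η.count y - 1) := fun _ _ => rfl
  simp_rw [hdef]
  rw [m1, m2]
  -- The activation factor, as well as the hazard of a stack, cancels the `1 - q^(m+1)` in the stack
  -- weight. What is left is `u c m` for the removal from a stack of size `m + 1` and `c (m + 1)`
  -- for the hazard of such a stack. The two series differ by the term `c 0 = k`, which is the
  -- continuous part of the hazard.
  let c : ℕ → ℝ → ℝ≥0∞ := fun m y => ENNReal.ofReal (M.k y * (u / M.v y) ^ m)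
  have e1 : ∀ (m : ℕ), ∫⁻ y in M.freeSet ∩ Set.Iic L, ENNReal.ofReal (M.stackWeight u m y) *
      ∫⁻ ξ, ENNReal.ofReal (M.v y * (1 - M.q ^ (m + 1))) * h y (ξ.set y m) ∂P =
      ENNReal.ofReal u * ∫⁻ y in M.freeSet ∩ Set.Iic L, c m y * ∫⁻ ξ, h y (ξ.set y m) ∂P := by
    intro m
    have hcm : Measurable (c m) :=
      (M.k_measurable.mul ((measurable_const.div M.v_measurable).pow_const _)).ennreal_ofReal
    refine Eq.trans ?_ (lintegral_const_mul (ENNReal.ofReal u) (hcm.mul (hset2 m)))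
    refine setLIntegral_congr_fun hF fun y hy => ?_
    have hy0 : 0 < y := hy.1.1
    have hvy := M.v_pos y hy0.le
    have hq := M.one_sub_pow_pos m
    have hw : 0 ≤ M.stackWeight u m y := mul_nonneg (M.k_pos y hy0.le).le
      (div_nonneg (pow_nonneg (div_nonneg hu.le hvy.le) _) hq.le)
    simp only [c]
    rw [lintegral_const_mul _ (hset' m y), ← mul_assoc, ← mul_assoc,
      ← ENNReal.ofReal_mul hw, ← ENNReal.ofReal_mul hu.le]
    congr 2
    rw [stackWeight, pow_succ (u / M.v y)]
    field_simp
  have e2 : ∀ (m : ℕ), ∫⁻ y in M.freeSet ∩ Set.Iic L, ENNReal.ofReal (M.stackWeight u m y) *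
      ∫⁻ ξ, ENNReal.ofReal (1 - M.q ^ (m + 1)) * h y (ξ.set y (m + 1)) ∂P =
      ∫⁻ y in M.freeSet ∩ Set.Iic L, c (m + 1) y * ∫⁻ ξ, h y (ξ.set y (m + 1)) ∂P := by
    intro m
    refine setLIntegral_congr_fun hF fun y hy => ?_
    have hy0 : 0 < y := hy.1.1
    have hvy := M.v_pos y hy0.le
    have hq := M.one_sub_pow_pos m
    have hw : 0 ≤ M.stackWeight u m y := mul_nonneg (M.k_pos y hy0.le).le
      (div_nonneg (pow_nonneg (div_nonneg hu.le hvy.le) _) hq.le)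
    simp only [c]
    rw [lintegral_const_mul _ (hset' _ y), ← mul_assoc, ← ENNReal.ofReal_mul hw]
    congr 2
    rw [stackWeight]
    field_simp
  simp_rw [e1, e2]
  rw [ENNReal.tsum_mul_left, tsum_eq_zero_add' ENNReal.summable]
  congr 2
  have hk : Measurable fun p : ℝ × Config => ENNReal.ofReal (M.k p.1) * h p.1 p.2 :=
    (M.k_measurable.ennreal_ofReal.comp measurable_fst).mul hh
  have hae : (M.freeSet ∩ Set.Iic L : Set ℝ) =ᵐ[volume] Set.Ioc 0 L := by
    have hn : ∀ᵐ y : ℝ, y ∉ M.B := by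
      rw [ae_iff]
      simpa using M.countable_B.measure_zero volume
    filter_upwards [hn] with y hy
    apply propext
    change (0 < y ∧ y ∉ M.B) ∧ y ≤ L ↔ 0 < y ∧ y ≤ L
    tauto
  have e3 : ∀ y, c 0 y * ∫⁻ ξ, h y (ξ.set y 0) ∂P =
      ∫⁻ ξ, ENNReal.ofReal (M.k y) * h y (ξ.set y 0) ∂P := by
    intro y
    rw [lintegral_const_mul _ (hset' 0 y)]
    simp [c]
  simp_rw [e3]
  rw [setLIntegral_congr hae, lintegral_lintegral_swap]
  · refine lintegral_congr fun ξ => lintegral_congr_ae ?_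
    -- A Lebesgue-typical location carries no stack, so emptying it changes nothing.
    have hn : ∀ᵐ y ∂(volume.restrict (Set.Ioc 0 L)), y ∉ ξ.sites L :=
      ae_restrict_of_ae (by
        rw [ae_iff]
        simpa using (ξ.sites L).countable_toSet.measure_zero volume)
    filter_upwards [hn, ae_restrict_mem measurableSet_Ioc] with y hy hyL
    have : ξ.count y = 0 := by
      by_contra h0
      exact hy (Config.mem_sites.2 ⟨hyL.2, h0⟩)
    rw [Config.set_count_of_eq _ this]
  · refine Measurable.aemeasurable ?_
    exact hk.comp (measurable_fst.prodMk
      (Config.measurable_set measurable_snd measurable_fst measurable_const))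

/-- The law `𝒫(u, v, k, p)` is characterized by the effect of removing a particle. -/
theorem IsInitialLaw.lintegral_sum_removeAt (hP : M.IsInitialLaw u P) (hu : 0 < u)
    (hv : ∀ y, 0 < y → u < M.v y) {L : ℝ} (hrate : IntegrableOn (M.stackRate u) (Set.Ioc 0 L))
    {h : ℝ → Config → ℝ≥0∞} (hh : Measurable (Function.uncurry h)) :
    ∫⁻ η, ∑ y ∈ η.sites L,
        ENNReal.ofReal (M.v y * (1 - M.q ^ η.count y)) * h y (η.removeAt y) ∂P =
      ENNReal.ofReal u * ∫⁻ η, ∫⁻ y, h y η ∂M.haz L η ∂P := by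
  classical
  have hhη : ∀ η, Measurable fun y => h y η := fun η => hh.comp measurable_prodMk_right
  have hhy : ∀ y, Measurable fun η => h y η := fun y => hh.comp measurable_prodMk_left
  have hh' : Measurable fun p : Config × ℝ => h p.2 p.1 := hh.comp measurable_swap
  have hrem : Measurable fun p : Config × ℝ => h p.2 (p.1.removeAt p.2) :=
    hh.comp (measurable_snd.prodMk (Config.measurable_removeAt measurable_fst measurable_snd))
  -- The second sum may run over all roadblocks of the window, since those without particles
  -- contribute zero.
  have hsplit : ∀ η : Config, ∑ y ∈ η.sites L,
      ENNReal.ofReal (M.v y * (1 - M.q ^ η.count y)) * h y (η.removeAt y) =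
      (∑ y ∈ η.sites L, M.freeSet.indicator (fun y =>
        ENNReal.ofReal (M.v y * (1 - M.q ^ η.count y)) * h y (η.removeAt y)) y) +
      ∑ b ∈ M.roads L,
        ENNReal.ofReal (M.v b * (1 - M.q ^ η.count b)) * h b (η.removeAt b) := by
    intro η
    set f : ℝ → ℝ≥0∞ := fun y =>
      ENNReal.ofReal (M.v y * (1 - M.q ^ η.count y)) * h y (η.removeAt y) with hf
    have h1 : ∑ b ∈ M.roads L, f b = ∑ y ∈ η.sites L, if y ∈ M.B then f y else 0 := by
      rw [← Finset.sum_filter]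
      refine (Finset.sum_subset ?_ ?_).symm
      · intro y hy
        rw [Finset.mem_filter, Config.mem_sites] at hy
        exact M.mem_roads.2 ⟨hy.2, Config.pos_of_count_ne_zero hy.1.2, hy.1.1⟩
      · intro b hb hbs
        have hb' := M.mem_roads.1 hb
        have : η.count b = 0 := by
          by_contra h0
          exact hbs (Finset.mem_filter.2 ⟨Config.mem_sites.2 ⟨hb'.2.2, h0⟩, hb'.1⟩)
        simp [hf, this]
    rw [h1, ← Finset.sum_add_distrib]
    refine Finset.sum_congr rfl fun y hy => ?_
    have hp := Config.pos_of_count_ne_zero (Config.mem_sites.1 hy).2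
    by_cases hB : y ∈ M.B
    · rw [Set.indicator_of_notMem (fun h => h.2 hB), zero_add, if_pos hB]
    · rw [Set.indicator_of_mem (show y ∈ M.freeSet from ⟨hp, hB⟩), if_neg hB,
        add_zero]
  have hhaz : ∀ η : Config, ∫⁻ y, h y η ∂M.haz L η =
      ((∫⁻ y in Set.Ioc 0 L, ENNReal.ofReal (M.k y) * h y η) +
        ∑ y ∈ η.sites L, M.freeSet.indicator (fun y =>
          ENNReal.ofReal (1 - M.q ^ η.count y) * h y η) y) +
        ∑ b ∈ M.roads L, ENNReal.ofReal (1 - M.p b * M.q ^ η.count b) * h b η := by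
    intro η
    rw [M.lintegral_haz L η (hhη η), M.sum_atoms, ← add_assoc]
    congr 2
    refine Finset.sum_congr rfl fun y hy => ?_
    have hp := Config.pos_of_count_ne_zero (Config.mem_sites.1 hy).2
    by_cases hB : y ∈ M.B
    · rw [Set.indicator_of_notMem (fun h => h.2 hB), if_pos hB]
    · rw [Set.indicator_of_mem (show y ∈ M.freeSet from ⟨hp, hB⟩), if_neg hB]
  simp_rw [hsplit, hhaz]
  have hmk : Measurable fun η : Config => ∫⁻ y in Set.Ioc 0 L, ENNReal.ofReal (M.k y) * h y η :=
    Measurable.lintegral_prod_right ((M.k_measurable.ennreal_ofReal.comp measurable_snd).mul hh')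
  have hfree : MeasurableSet {p : Config × ℝ | p.2 ∈ M.freeSet} :=
    measurable_snd M.measurableSet_freeSet
  have hm1 : Measurable fun η : Config => ∑ y ∈ η.sites L, M.freeSet.indicator (fun y =>
        ENNReal.ofReal (M.v y * (1 - M.q ^ η.count y)) * h y (η.removeAt y)) y :=
    Config.measurable_sum_sites measurable_id L (((measurable_rate M).mul hrem).indicator hfree)
  have hm2 : Measurable fun η : Config => ∑ y ∈ η.sites L, M.freeSet.indicator (fun y =>
        ENNReal.ofReal (1 - M.q ^ η.count y) * h y η) y :=
    Config.measurable_sum_sites measurable_id L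
      (((measurable_ofReal_comp_count (f := fun _ m => 1 - M.q ^ m) fun _ =>
        measurable_const).mul hh').indicator hfree)
  have hrb : ∀ b (f : ℕ → ℝ), Measurable fun η : Config => ENNReal.ofReal (f (η.count b)) :=
    fun b f => (measurable_from_nat (f := fun m => ENNReal.ofReal (f m))).comp
      (Config.measurable_count measurable_id measurable_const)
  have hmk2 : Measurable fun η : Config => (∫⁻ y in Set.Ioc 0 L, ENNReal.ofReal (M.k y) * h y η) +
      ∑ y ∈ η.sites L, M.freeSet.indicator (fun y =>
        ENNReal.ofReal (1 - M.q ^ η.count y) * h y η) y := hmk.add hm2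
  rw [lintegral_add_left hm1, lintegral_add_left hmk2, lintegral_add_left hmk,
    hP.lintegral_free hu hv hrate hh, mul_add (ENNReal.ofReal u) (_ + _)]
  congr 1
  rw [lintegral_finsetSum, lintegral_finsetSum, Finset.mul_sum]
  · refine Finset.sum_congr rfl fun b hb => ?_
    have hb' := M.mem_roads.1 hb
    exact hP.lintegral_roadblock hu hb'.1 hb'.2.1 (hhy b)
  · exact fun b _ => (hrb b fun m => 1 - M.p b * M.q ^ m).mul (hhy b)
  · exact fun b _ => (hrb b fun m => M.v b * (1 - M.q ^ m)).mul ((hhy b).comp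
      (Config.measurable_removeAt measurable_id measurable_const))

/-- The gain part of the generator: `f` is evaluated after jumps inside `(0, L]`, and `g` after
jumps over `L`. -/
noncomputable def gain (M : Params) (L : ℝ) (f g : Config → ℝ≥0∞) (η : Config) : ℝ≥0∞ :=
  ENNReal.ofReal (M.v 0) * M.afterJump L f g 0 η +
    ∑ y ∈ η.sites L, ENNReal.ofReal (M.v y * (1 - M.q ^ η.count y)) *
      M.afterJump L f g y (η.removeAt y)

lemma measurable_gain (M : Params) (L : ℝ) {f g : Config → ℝ≥0∞} (hf : Measurable f)
    (hg : Measurable g) : Measurable (M.gain L f g) := by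
  refine Measurable.add ((M.measurable_afterJump L hf hg measurable_const
    measurable_id).const_mul _) (Config.measurable_sum_sites measurable_id L ?_)
  exact (measurable_rate M).mul (M.measurable_afterJump L hf hg measurable_snd
    (Config.measurable_removeAt measurable_fst measurable_snd))

/-- Fubini: the total over starts `y` of jumps is rearranged as a total over landing points `z`. -/
lemma lintegral_lintegral_lt {m : Measure ℝ} [SFinite m] {K : ℝ → ℝ → ℝ≥0∞}
    (hK : Measurable (Function.uncurry K)) {φ ψ : ℝ → ℝ≥0∞} (hφ : Measurable φ)
    (hψ : Measurable ψ) (b : ℝ≥0∞) :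
    ∫⁻ y, ((∫⁻ z, (if y < z then K y z * φ z else 0) ∂m) + ψ y * b) ∂m =
      (∫⁻ z, (∫⁻ y, (if y < z then K y z else 0) ∂m) * φ z ∂m) + (∫⁻ y, ψ y ∂m) * b := by
  have hm : Measurable (Function.uncurry fun y z => if y < z then K y z * φ z else 0) :=
    Measurable.ite (measurableSet_lt measurable_fst measurable_snd)
      (hK.mul (hφ.comp measurable_snd)) measurable_const
  rw [lintegral_add_right _ (hψ.mul_const _), lintegral_mul_const _ hψ,
    lintegral_lintegral_swap hm.aemeasurable]
  congr 1
  refine lintegral_congr fun z => ?_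
  rw [← lintegral_mul_const]
  · refine lintegral_congr fun y => ?_
    split_ifs <;> simp
  · exact Measurable.ite (measurableSet_lt measurable_id measurable_const)
      (hK.comp measurable_prodMk_right) measurable_const

/-- Splitting a jump from `0` at its landing location in all possible ways. -/
lemma lintegral_splitting (M : Params) {S : Finset ℝ} {c : ℝ → ℝ}
    (hc : ∀ a ∈ S, 0 ≤ c a ∧ c a ≤ 1) {L : ℝ} (hL : 0 ≤ L) {m : Measure ℝ} [SFinite m]
    (hm : m = (M.hazard S c).restrict (Set.Ioc 0 L)) {φ : ℝ → ℝ≥0∞} (hφ : Measurable φ)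
    (b : ℝ≥0∞) :
    ((∫⁻ z, (if 0 < z then ENNReal.ofReal (M.flightLt S c 0 z) * φ z else 0) ∂m) +
        ENNReal.ofReal (M.flight S c 0 L) * b) +
      ∫⁻ y, ((∫⁻ z, (if y < z then ENNReal.ofReal (M.flightLt S c y z) * φ z else 0) ∂m) +
        ENNReal.ofReal (M.flight S c y L) * b) ∂m = (∫⁻ z, φ z ∂m) + b := by
  have hLt : Measurable (Function.uncurry fun y z => ENNReal.ofReal (M.flightLt S c y z)) := by
    have h := (M.measurable_flightLt S c).ennreal_ofReal
    rw [Function.uncurry_def]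
    exact h
  have hfl : Measurable fun y => ENNReal.ofReal (M.flight S c y L) :=
    (M.measurable_flight_left S c L).ennreal_ofReal
  have h2 : (∫⁻ y, ENNReal.ofReal (M.flight S c y L) ∂m) +
      ENNReal.ofReal (M.flight S c 0 L) = 1 := by
    rw [hm]
    exact M.lintegral_flight_add_flight le_rfl hL hc
  -- The decomposition at the rightmost obstacle before `z`: the weights of all possible starts of a
  -- flight that reaches `z` add up to one. `h2` is the same for flights over `L`.
  have h3 : ∀ z ∈ Set.Ioc 0 L,
      (∫⁻ y, (if y < z then ENNReal.ofReal (M.flightLt S c y z) else 0) ∂m) +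
      ENNReal.ofReal (M.flightLt S c 0 z) = 1 := by
    intro z hz
    rw [← M.lintegral_flightLt_add_flightLt le_rfl hz.1.le hc]
    congr 1
    rw [hm, ← lintegral_indicator measurableSet_Ioc, ← lintegral_indicator measurableSet_Ioo]
    refine lintegral_congr fun y => ?_
    simp only [Set.indicator_apply, Set.mem_Ioc, Set.mem_Ioo]
    by_cases h0 : 0 < y <;> by_cases hyz : y < z <;> simp [h0, hyz]
    intro hLy
    exact absurd (hyz.trans_le hz.2) (not_lt.2 hLy.le)
  have hmem : ∀ᵐ z ∂m, z ∈ Set.Ioc 0 L := hm ▸ ae_restrict_mem measurableSet_Ioc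
  have hLt0 : Measurable fun z => ENNReal.ofReal (M.flightLt S c 0 z) := by
    have h := ((M.measurable_flightLt S c).comp (measurable_prodMk_left (x := (0 : ℝ))))
    exact h.ennreal_ofReal
  have hm0 : Measurable fun z => if 0 < z then ENNReal.ofReal (M.flightLt S c 0 z) * φ z else 0 :=
    Measurable.ite (measurableSet_lt measurable_const measurable_id)
      (hLt0.mul hφ) measurable_const
  have h4 : (∫⁻ z, (if 0 < z then ENNReal.ofReal (M.flightLt S c 0 z) * φ z else 0) ∂m) +
      ∫⁻ z, (∫⁻ y, (if y < z then ENNReal.ofReal (M.flightLt S c y z) else 0) ∂m) * φ z ∂m =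
      ∫⁻ z, φ z ∂m := by
    rw [← lintegral_add_left hm0]
    refine lintegral_congr_ae ?_
    filter_upwards [hmem] with z hz
    rw [if_pos hz.1, ← add_mul, add_comm, h3 z hz, one_mul]
  rw [lintegral_lintegral_lt hLt hφ hfl, ← h4, add_add_add_comm, ← add_mul,
    add_comm (ENNReal.ofReal _), h2, one_mul]

/-- For a fixed configuration, flights started from a unit mass at `0` and from the hazard measure
land in the window with the hazard measure as intensity, and cross `L` with total weight one. -/
lemma afterJump_add_lintegral_afterJump (M : Params) {L : ℝ} (hL : 0 ≤ L) {f : Config → ℝ≥0∞}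
    (g : Config → ℝ≥0∞) (hf : Measurable f) (ξ : Config) :
    M.afterJump L f g 0 ξ + ∫⁻ y, M.afterJump L f g y ξ ∂M.haz L ξ =
      (∫⁻ z, f (ξ.addAt z) ∂M.haz L ξ) + g ξ := by
  have : IsFiniteMeasure (M.haz L ξ) := by
    refine ⟨?_⟩
    have h1 := M.lintegral_haz L ξ (f := fun _ => 1) measurable_const
    rw [lintegral_one] at h1
    rw [h1]
    refine ENNReal.add_lt_top.2 ⟨?_, ENNReal.sum_lt_top.2 fun a _ => ?_⟩
    · simpa using (M.k_locInt L).lintegral_lt_top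
    · simp
  exact M.lintegral_splitting (m := M.haz L ξ) (fun a _ => M.pass_mem_Icc ξ a) hL rfl
    (hf.comp (Config.measurable_addAt measurable_const measurable_id)) (g ξ)

/-- The balance of gains and losses under the stationary law. -/
theorem IsInitialLaw.lintegral_gain (hP : M.IsInitialLaw (M.v 0) P)
    (hv : ∀ y, 0 < y → M.v 0 < M.v y) {L : ℝ} (hL : 0 ≤ L)
    (hrate : IntegrableOn (M.stackRate (M.v 0)) (Set.Ioc 0 L)) {f g : Config → ℝ≥0∞}
    (hf : Measurable f) (hg : Measurable g) :
    ∫⁻ η, M.gain L f g η ∂P =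
      (∫⁻ η, (∑ y ∈ η.sites L, ENNReal.ofReal (M.v y * (1 - M.q ^ η.count y))) * f η ∂P) +
        ENNReal.ofReal (M.v 0) * ∫⁻ η, g η ∂P := by
  have hu := M.v_pos 0 le_rfl
  have haj : Measurable (Function.uncurry (M.afterJump L f g)) := by
    have h := M.measurable_afterJump L hf hg (measurable_fst (α := ℝ) (β := Config)) measurable_snd
    rwa [Function.uncurry_def]
  have haj0 : Measurable (M.afterJump L f g 0) := by
    have h := M.measurable_afterJump L hf hg (measurable_const (β := Config) (a := (0 : ℝ)))
      measurable_id
    exact h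
  have hadd : Measurable (Function.uncurry fun (z : ℝ) (ξ : Config) => f (ξ.addAt z)) := by
    have h : Measurable fun p : ℝ × Config => p.2.addAt p.1 :=
      Config.measurable_addAt measurable_snd measurable_fst
    rw [Function.uncurry_def]
    exact hf.comp h
  -- The removal formula is used in both directions: `h1` converts activations into starts with
  -- hazard intensity, and `h2` converts landings with hazard intensity into the loss term, as `(η -
  -- δ_y) + δ_y = η`. The injection rate `v(0)` is the remaining unit mass at `0` precisely because
  -- `u = v(0)`.
  have h1 := hP.lintegral_sum_removeAt hu hv hrate haj
  have h2 := hP.lintegral_sum_removeAt hu hv hrate hadd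
  have h3 : ∀ η : Config, ∑ y ∈ η.sites L,
      ENNReal.ofReal (M.v y * (1 - M.q ^ η.count y)) * f ((η.removeAt y).addAt y) =
      (∑ y ∈ η.sites L, ENNReal.ofReal (M.v y * (1 - M.q ^ η.count y))) * f η := by
    intro η
    rw [Finset.sum_mul]
    refine Finset.sum_congr rfl fun y hy => ?_
    rw [Config.addAt_removeAt _ (Config.mem_sites.1 hy).2]
  simp_rw [h3] at h2
  unfold gain
  rw [lintegral_add_left (haj0.const_mul _), lintegral_const_mul _ haj0, h1, ← mul_add,
    ← lintegral_add_left haj0, h2, ← mul_add, ← lintegral_add_right _ hg]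
  congr 1
  exact lintegral_congr fun ξ => M.afterJump_add_lintegral_afterJump hL g hf ξ

end Params

/-! ### Bounds, locality and stationary mean of the generator on test functions. -/

/-- Test functions with an explicit bound `C` and an explicit bound `m` on the total number of
particles. -/
structure IsBoundedTest (L : ℝ) (m : ℕ) (C : ℝ) (F : Config → ℤ → ℝ) : Prop where
  measurable : ∀ n, Measurable fun η => F η n
  bounded : ∀ η n, |F η n| ≤ C
  isLocal : ∀ η ξ : Config, (∀ x, x ≤ L → η.count x = ξ.count x) → ∀ n, F η n = F ξ n
  vanishes : ∀ η n, (m : ℤ) < (η.num 0 L : ℤ) + n → F η n = 0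

lemma IsBoundedTest.isTestFunction {L : ℝ} {m : ℕ} {C : ℝ} {F : Config → ℤ → ℝ}
    (hF : IsBoundedTest L m C F) : IsTestFunction L F :=
  ⟨hF.measurable, ⟨C, hF.bounded⟩, hF.isLocal, ⟨m, hF.vanishes⟩⟩

namespace Config

lemma count_move_of_lt (η : Config) (y : ℝ) {L : ℝ} {z : EReal} (hz : (L : EReal) < z) {x : ℝ}
    (hx : x ≤ L) : (η.move y z).count x = (η.removeAt y).count x := by
  rw [count_removeAt]
  simp only [move]
  have h : ¬(0 < x ∧ (x : EReal) = z) := by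
    rintro ⟨-, rfl⟩
    exact absurd hz (not_lt.2 (EReal.coe_le_coe_iff.2 hx))
  rw [if_neg h, add_zero]

lemma num_le_num_removeAt (η : Config) {y L : ℝ} (hy : y = 0 ∨ y ∈ η.sites L) :
    η.num 0 L ≤ (η.removeAt y).num 0 L + 1 := by
  rcases hy with rfl | hy
  · rw [removeAt_of_nonpos _ le_rfl]
    omega
  · exact (num_removeAt η hy).ge

/-- A particle that jumps either stays in the window or is counted by the flux, and an injection
adds one. The window count plus the flux thus never decreases, which makes the vanishing condition
on test functions stable under the dynamics. -/
lemma num_le_num_move (η : Config) {y L : ℝ} (hy : y = 0 ∨ y ∈ η.sites L) {z : EReal}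
    (hz : (y : EReal) < z) :
    (η.num 0 L : ℤ) ≤ (η.move y z).num 0 L + if (L : EReal) < z then 1 else 0 := by
  have hle := num_le_num_removeAt η hy
  have hy0 : 0 ≤ y := by
    rcases hy with rfl | hy
    · exact le_rfl
    · exact (pos_of_count_ne_zero (mem_sites.1 hy).2).le
  split_ifs with h
  · rw [num_congr (fun x hx => η.count_move_of_lt y h hx) 0]
    exact_mod_cast hle
  · induction z with
    | bot => exact absurd hz not_lt_bot
    | top => exact absurd (EReal.coe_lt_top L) h
    | coe z =>
      rw [move_coe, num_addAt _ (hy0.trans_lt (EReal.coe_lt_coe_iff.1 hz))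
        (EReal.coe_le_coe_iff.1 (not_lt.1 h))]
      exact_mod_cast hle

end Config

namespace Params

variable (M : Params) {L : ℝ} {m : ℕ} {C : ℝ} {F : Config → ℤ → ℝ}

/-- The rate at which particles in `(0, L]` become active. -/
noncomputable def totalRate (L : ℝ) (η : Config) : ℝ :=
  ∑ y ∈ η.sites L, M.v y * (1 - M.q ^ η.count y)

lemma rate_nonneg (η : Config) {y : ℝ} (hy : 0 ≤ y) : 0 ≤ M.v y * (1 - M.q ^ η.count y) :=
  mul_nonneg (M.v_pos y hy).le (sub_nonneg.2 (pow_le_one₀ M.q_nonneg M.q_lt_one.le))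

lemma nonneg_of_mem_sites {η : Config} {y : ℝ} (hy : y ∈ η.sites L) : 0 ≤ y :=
  (Config.pos_of_count_ne_zero (Config.mem_sites.1 hy).2).le

lemma totalRate_nonneg (η : Config) : 0 ≤ M.totalRate L η :=
  Finset.sum_nonneg fun _ hy => M.rate_nonneg η (nonneg_of_mem_sites hy)

lemma ofReal_totalRate (η : Config) : ENNReal.ofReal (M.totalRate L η) =
    ∑ y ∈ η.sites L, ENNReal.ofReal (M.v y * (1 - M.q ^ η.count y)) :=
  ENNReal.ofReal_sum_of_nonneg fun _ hy => M.rate_nonneg η (nonneg_of_mem_sites hy)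

lemma measurable_totalRate : Measurable (M.totalRate L) := by
  have h : M.totalRate L = fun η => (∑ y ∈ η.sites L,
      ENNReal.ofReal (M.v y * (1 - M.q ^ η.count y))).toReal := by
    ext η
    rw [← ofReal_totalRate, ENNReal.toReal_ofReal (M.totalRate_nonneg η)]
  rw [h]
  exact (Config.measurable_sum_sites measurable_id L
    (f := fun η y => ENNReal.ofReal (M.v y * (1 - M.q ^ η.count y)))
    (measurable_rate M)).ennreal_toReal

/-- A bound for the speed in `(0, L]`. -/
noncomputable def speedBound (L : ℝ) : ℝ := (M.v_locBdd L).choose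

lemma le_speedBound {y : ℝ} (hy : 0 ≤ y) (hyL : y ≤ L) : M.v y ≤ M.speedBound L :=
  (M.v_locBdd L).choose_spec y hy hyL

lemma speedBound_nonneg (hL : 0 ≤ L) : 0 ≤ M.speedBound L :=
  (M.v_pos 0 le_rfl).le.trans (M.le_speedBound le_rfl hL)

lemma totalRate_le (hL : 0 ≤ L) (η : Config) :
    M.totalRate L η ≤ M.speedBound L * η.num 0 L := by
  have h : ∀ y ∈ η.sites L, M.v y * (1 - M.q ^ η.count y) ≤ M.speedBound L := by
    intro y hy
    have hy0 : 0 ≤ y := nonneg_of_mem_sites hy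
    have h1 := M.le_speedBound hy0 (Config.mem_sites.1 hy).1
    have h2 := pow_nonneg M.q_nonneg (η.count y)
    have h3 := M.v_pos y hy0
    nlinarith
  refine (Finset.sum_le_card_nsmul _ _ _ h).trans ?_
  rw [nsmul_eq_mul, mul_comm]
  exact mul_le_mul_of_nonneg_left (by exact_mod_cast η.card_sites_le_num L)
    (M.speedBound_nonneg hL)

lemma totalRate_congr {η ξ : Config} (h : ∀ x, x ≤ L → η.count x = ξ.count x) :
    M.totalRate L η = M.totalRate L ξ := by
  rw [totalRate, totalRate, Config.sites_congr h]
  refine Finset.sum_congr rfl fun y hy => ?_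
  rw [h y (Config.mem_sites.1 hy).1]

section Jump

lemma measurable_jump (hF : IsBoundedTest L m C F) (η : Config) (n : ℤ) (y : ℝ) :
    Measurable fun z : EReal => F (η.move y z) (n + if (L : EReal) < z then 1 else 0) := by
  have hmove : Measurable fun z : EReal => η.move y z :=
    Config.measurable_move measurable_const measurable_const measurable_id
  have h : (fun z : EReal => F (η.move y z) (n + if (L : EReal) < z then 1 else 0)) =
      fun z : EReal => if (L : EReal) < z then F (η.move y z) (n + 1) else F (η.move y z) n := by
    ext z
    split_ifs <;> simp
  rw [h]
  exact Measurable.ite (measurableSet_lt measurable_const measurable_id)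
    ((hF.measurable (n + 1)).comp hmove) ((hF.measurable n).comp hmove)

lemma integrable_jump (hF : IsBoundedTest L m C F) (η : Config) (n : ℤ) (y : ℝ) :
    Integrable (fun z : EReal => F (η.move y z) (n + if (L : EReal) < z then 1 else 0))
      (M.jumpLaw η y) :=
  Integrable.of_bound (measurable_jump hF η n y).aestronglyMeasurable C
    (Eventually.of_forall fun _ => hF.bounded _ _)

lemma lintegral_jump (hF : IsBoundedTest L m C F) (η : Config) (n : ℤ) {y : ℝ} (hy : 0 ≤ y)
    (hyL : y ≤ L) :
    ∫⁻ z, ENNReal.ofReal (F (η.move y z) (n + if (L : EReal) < z then 1 else 0)) ∂M.jumpLaw η y =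
      M.afterJump L (fun ξ => ENNReal.ofReal (F ξ n)) (fun ξ => ENNReal.ofReal (F ξ (n + 1))) y
        (η.removeAt y) := by
  rw [← M.lintegral_jumpLaw_move η hy hyL (hF.measurable n).ennreal_ofReal]
  refine lintegral_congr fun z => ?_
  split_ifs with h
  · rw [hF.isLocal _ _ (fun x hx => η.count_move_of_lt y h hx)]
  · rw [add_zero]

lemma afterJump_ne_top (hF : IsBoundedTest L m C F) (η : Config) (n : ℤ) {y : ℝ} (hy : 0 ≤ y)
    (hyL : y ≤ L) :
    M.afterJump L (fun ξ => ENNReal.ofReal (F ξ n)) (fun ξ => ENNReal.ofReal (F ξ (n + 1))) y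
        (η.removeAt y) ≠ ∞ := by
  rw [← M.lintegral_jump hF η n hy hyL]
  refine ne_top_of_le_ne_top (b := ENNReal.ofReal C) ENNReal.ofReal_ne_top ?_
  calc _ ≤ ∫⁻ _, ENNReal.ofReal C ∂M.jumpLaw η y :=
        lintegral_mono fun _ => ENNReal.ofReal_le_ofReal ((le_abs_self _).trans (hF.bounded _ _))
    _ = _ := by simp

lemma integral_jump (hF : IsBoundedTest L m C F) (h0 : ∀ η n, 0 ≤ F η n) (η : Config) (n : ℤ)
    {y : ℝ} (hy : 0 ≤ y) (hyL : y ≤ L) :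
    ∫ z, (F (η.move y z) (n + if (L : EReal) < z then 1 else 0) - F η n) ∂M.jumpLaw η y =
      (M.afterJump L (fun ξ => ENNReal.ofReal (F ξ n)) (fun ξ => ENNReal.ofReal (F ξ (n + 1))) y
        (η.removeAt y)).toReal - F η n := by
  rw [integral_sub (M.integrable_jump hF η n y) (integrable_const _), integral_const,
    ← M.lintegral_jump hF η n hy hyL, integral_eq_lintegral_of_nonneg_ae
      (Eventually.of_forall fun z => h0 _ _) (measurable_jump hF η n y).aestronglyMeasurable]
  simp

end Jump

/-- Nonnegativity lets the gain be computed with values in `ℝ≥0∞`, where the balance identity holds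
without integrability. General test functions are reduced to this case by their positive and
negative parts. -/
lemma gen_eq_gain (hL : 0 ≤ L) (hF : IsBoundedTest L m C F) (h0 : ∀ η n, 0 ≤ F η n) (η : Config)
    (n : ℤ) :
    M.gen L F η n =
      (M.gain L (fun ξ => ENNReal.ofReal (F ξ n)) (fun ξ => ENNReal.ofReal (F ξ (n + 1))) η).toReal -
        (M.v 0 + M.totalRate L η) * F η n := by
  have hz := M.afterJump_ne_top hF η n le_rfl hL
  have hi := M.integral_jump hF h0 η n le_rfl hL
  rw [Config.removeAt_of_nonpos _ le_rfl] at hz hi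
  rw [gen, gain, hi, ENNReal.toReal_add (ENNReal.mul_ne_top ENNReal.ofReal_ne_top hz)
    (ENNReal.sum_ne_top.2 fun y hy => ENNReal.mul_ne_top ENNReal.ofReal_ne_top
      (M.afterJump_ne_top hF η n (nonneg_of_mem_sites hy) (Config.mem_sites.1 hy).1)),
    ENNReal.toReal_mul, ENNReal.toReal_ofReal (M.v_pos 0 le_rfl).le, ENNReal.toReal_sum
      fun y hy => ENNReal.mul_ne_top ENNReal.ofReal_ne_top
        (M.afterJump_ne_top hF η n (nonneg_of_mem_sites hy) (Config.mem_sites.1 hy).1)]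
  have hs : ∑ y ∈ η.sites L, M.v y * (1 - M.q ^ η.count y) *
      ∫ z, (F (η.move y z) (n + if (L : EReal) < z then 1 else 0) - F η n) ∂M.jumpLaw η y =
      (∑ y ∈ η.sites L, (ENNReal.ofReal (M.v y * (1 - M.q ^ η.count y)) *
        M.afterJump L (fun ξ => ENNReal.ofReal (F ξ n)) (fun ξ => ENNReal.ofReal (F ξ (n + 1))) y
        (η.removeAt y)).toReal) - M.totalRate L η * F η n := by
    rw [totalRate, Finset.sum_mul, ← Finset.sum_sub_distrib]
    refine Finset.sum_congr rfl fun y hy => ?_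
    have hy0 : 0 ≤ y := nonneg_of_mem_sites hy
    rw [M.integral_jump hF h0 η n hy0 (Config.mem_sites.1 hy).1, ENNReal.toReal_mul,
      ENNReal.toReal_ofReal (M.rate_nonneg η hy0), mul_sub]
  rw [hs]
  ring

lemma gen_sub {G : Config → ℤ → ℝ} {m' : ℕ} {C' : ℝ} (hF : IsBoundedTest L m C F)
    (hG : IsBoundedTest L m' C' G) (η : Config) (n : ℤ) :
    M.gen L (fun η n => F η n - G η n) η n = M.gen L F η n - M.gen L G η n := by
  have h : ∀ y, ∫ z, ((F (η.move y z) (n + if (L : EReal) < z then 1 else 0) -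
      G (η.move y z) (n + if (L : EReal) < z then 1 else 0)) - (F η n - G η n)) ∂M.jumpLaw η y =
      (∫ z, (F (η.move y z) (n + if (L : EReal) < z then 1 else 0) - F η n) ∂M.jumpLaw η y) -
      ∫ z, (G (η.move y z) (n + if (L : EReal) < z then 1 else 0) - G η n) ∂M.jumpLaw η y := by
    intro y
    refine Eq.trans ?_ (integral_sub ((M.integrable_jump hF η n y).sub (integrable_const _))
      ((M.integrable_jump hG η n y).sub (integrable_const _)))
    refine integral_congr_ae (Eventually.of_forall fun z => ?_)
    simp only
    ring
  simp only [gen, h, mul_sub, Finset.sum_sub_distrib]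
  ring

lemma gen_eq_zero (hF : IsBoundedTest L m C F) {η : Config} {n : ℤ}
    (hm : (m : ℤ) < (η.num 0 L : ℤ) + n) : M.gen L F η n = 0 := by
  have h : ∀ y, y = 0 ∨ y ∈ η.sites L →
      ∫ z, (F (η.move y z) (n + if (L : EReal) < z then 1 else 0) - F η n) ∂M.jumpLaw η y = 0 := by
    intro y hy
    have hy0 : 0 ≤ y := by
      rcases hy with rfl | hy
      · exact le_rfl
      · exact nonneg_of_mem_sites hy
    have hae : ∀ᵐ z ∂M.jumpLaw η y, (y : EReal) < z :=
      (prob_compl_eq_zero_iff measurableSet_Ioi).2 (M.jumpLaw_Ioi_self η hy0)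
    rw [← integral_zero EReal ℝ (μ := M.jumpLaw η y)]
    refine integral_congr_ae ?_
    filter_upwards [hae] with z hz
    have := η.num_le_num_move hy hz
    rw [hF.vanishes η n hm, hF.vanishes _ _ (by linarith), sub_zero]
  rw [gen, h 0 (Or.inl rfl), mul_zero, zero_add]
  exact Finset.sum_eq_zero fun y hy => by rw [h y (Or.inr hy), mul_zero]

lemma abs_gen_le (hF : IsBoundedTest L m C F) (η : Config) (n : ℤ) :
    |M.gen L F η n| ≤ (M.v 0 + M.totalRate L η) * (2 * C) := by
  have h : ∀ y, |∫ z, (F (η.move y z) (n + if (L : EReal) < z then 1 else 0) - F η n)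
      ∂M.jumpLaw η y| ≤ 2 * C := by
    intro y
    have := norm_integral_le_of_norm_le_const (μ := M.jumpLaw η y) (C := 2 * C)
      (f := fun z => F (η.move y z) (n + if (L : EReal) < z then 1 else 0) - F η n)
      (Eventually.of_forall fun z => by
        have h1 := hF.bounded (η.move y z) (n + if (L : EReal) < z then 1 else 0)
        have h2 := hF.bounded η n
        rw [Real.norm_eq_abs]
        exact (abs_sub _ _).trans (by linarith))
    simpa using this
  rw [gen, add_mul, totalRate, Finset.sum_mul]
  refine (abs_add_le _ _).trans (add_le_add ?_ ((Finset.abs_sum_le_sum_abs _ _).trans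
    (Finset.sum_le_sum fun y hy => ?_)))
  · rw [abs_mul, abs_of_pos (M.v_pos 0 le_rfl)]
    exact mul_le_mul_of_nonneg_left (h 0) (M.v_pos 0 le_rfl).le
  · have := M.rate_nonneg η (nonneg_of_mem_sites hy)
    rw [abs_mul, abs_of_nonneg this]
    exact mul_le_mul_of_nonneg_left (h y) this

/-- Particles only move to the right, and a flight is stopped or passed on according to what lies up
to `L`. The window therefore evolves autonomously. -/
lemma gain_congr {f g : Config → ℝ≥0∞} (hf : Measurable f)
    (hfl : ∀ η ξ : Config, (∀ x, x ≤ L → η.count x = ξ.count x) → f η = f ξ)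
    (hgl : ∀ η ξ : Config, (∀ x, x ≤ L → η.count x = ξ.count x) → g η = g ξ) {η ξ : Config}
    (h : ∀ x, x ≤ L → η.count x = ξ.count x) : M.gain L f g η = M.gain L f g ξ := by
  have haj : ∀ (y : ℝ) {η ξ : Config}, (∀ x, x ≤ L → η.count x = ξ.count x) →
      M.afterJump L f g y η = M.afterJump L f g y ξ := by
    intro y η ξ h
    have h' : ∀ x, y < x → x ≤ L → η.count x = ξ.count x := fun x _ hx => h x hx
    have hadd : ∀ z, f (η.addAt z) = f (ξ.addAt z) := fun z => hfl _ _ fun x hx => by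
      rw [Config.count_addAt, Config.count_addAt, h x hx]
    have hm : Measurable fun z =>
        ENNReal.ofReal (M.flightLt (M.atoms η L) (M.pass η) y z) * f (η.addAt z) :=
      ((M.measurable_flightLt _ _).comp measurable_prodMk_left).ennreal_ofReal.mul
        (hf.comp (Config.measurable_addAt measurable_const measurable_id))
    rw [afterJump, afterJump, M.lintegral_haz_congr h' hm, M.flight_congr h', hgl η ξ h]
    simp_rw [M.flightLt_congr h', hadd]
  rw [gain, gain, haj 0 h, Config.sites_congr h]
  congr 1
  refine Finset.sum_congr rfl fun y hy => ?_
  rw [h y (Config.mem_sites.1 hy).1, haj y]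
  intro x hx
  rw [Config.count_removeAt, Config.count_removeAt, h x hx]

end Params

namespace IsBoundedTest

variable {L : ℝ} {m : ℕ} {C : ℝ} {F : Config → ℤ → ℝ}

lemma posPart (hF : IsBoundedTest L m C F) : IsBoundedTest L m C fun η n => max (F η n) 0 where
  measurable n := (hF.measurable n).max measurable_const
  bounded η n := by
    rw [abs_of_nonneg (le_max_right _ _)]
    exact max_le ((le_abs_self _).trans (hF.bounded η n)) ((abs_nonneg _).trans (hF.bounded η n))
  isLocal η ξ h n := by rw [hF.isLocal η ξ h n]
  vanishes η n h := by rw [hF.vanishes η n h, max_self]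

lemma neg (hF : IsBoundedTest L m C F) : IsBoundedTest L m C fun η n => -F η n where
  measurable n := (hF.measurable n).neg
  bounded η n := by rw [abs_neg]; exact hF.bounded η n
  isLocal η ξ h n := by rw [hF.isLocal η ξ h n]
  vanishes η n h := by rw [hF.vanishes η n h, neg_zero]

lemma gen_eq (M : Params) (hF : IsBoundedTest L m C F) (η : Config) (n : ℤ) :
    M.gen L F η n = M.gen L (fun η n => max (F η n) 0) η n -
      M.gen L (fun η n => max (-F η n) 0) η n := by
  rw [← M.gen_sub hF.posPart hF.neg.posPart]
  congr 1
  ext η n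
  rcases le_total 0 (F η n) with h | h
  · rw [max_eq_left h, max_eq_right (by linarith), sub_zero]
  · rw [max_eq_right h, max_eq_left (by linarith)]
    ring

lemma measurable_gen (M : Params) (hL : 0 ≤ L) (hF : IsBoundedTest L m C F) (n : ℤ) :
    Measurable fun η => M.gen L F η n := by
  have key : ∀ {G : Config → ℤ → ℝ}, IsBoundedTest L m C G → (∀ η n, 0 ≤ G η n) →
      Measurable fun η => M.gen L G η n := by
    intro G hG h0
    simp_rw [M.gen_eq_gain hL hG h0]
    exact (Params.measurable_gain M L (hG.measurable _).ennreal_ofReal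
      (hG.measurable _).ennreal_ofReal).ennreal_toReal.sub
      ((measurable_const.add M.measurable_totalRate).mul (hG.measurable n))
  simp_rw [hF.gen_eq M]
  exact (key hF.posPart fun _ _ => le_max_right _ _).sub
    (key hF.neg.posPart fun _ _ => le_max_right _ _)

lemma gen_congr (M : Params) (hL : 0 ≤ L) (hF : IsBoundedTest L m C F) {η ξ : Config}
    (h : ∀ x, x ≤ L → η.count x = ξ.count x) (n : ℤ) : M.gen L F η n = M.gen L F ξ n := by
  have key : ∀ {G : Config → ℤ → ℝ}, IsBoundedTest L m C G → (∀ η n, 0 ≤ G η n) →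
      M.gen L G η n = M.gen L G ξ n := by
    intro G hG h0
    rw [M.gen_eq_gain hL hG h0, M.gen_eq_gain hL hG h0, M.totalRate_congr h, hG.isLocal η ξ h,
      M.gain_congr (hG.measurable n).ennreal_ofReal (fun η ξ h => by rw [hG.isLocal η ξ h])
        (fun η ξ h => by rw [hG.isLocal η ξ h]) h]
  rw [hF.gen_eq M, hF.gen_eq M, key hF.posPart fun _ _ => le_max_right _ _,
    key hF.neg.posPart fun _ _ => le_max_right _ _]

end IsBoundedTest

namespace Params

variable (M : Params) {L : ℝ} {m : ℕ} {C : ℝ} {F : Config → ℤ → ℝ}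

/-- The generator, for nonnegative counts only. -/
noncomputable def posGen (L : ℝ) (F : Config → ℤ → ℝ) (η : Config) (n : ℤ) : ℝ :=
  if 0 ≤ n then M.gen L F η n else 0

/-- A bound for the norm of the generator on test functions. -/
noncomputable def genBound (L : ℝ) (m : ℕ) : ℝ := (M.v 0 + M.speedBound L * m) * 2

lemma genBound_nonneg (hL : 0 ≤ L) (m : ℕ) : 0 ≤ M.genBound L m := by
  have := M.speedBound_nonneg hL
  have := M.v_pos 0 le_rfl
  unfold genBound
  positivity

end Params

/-- For `n ≥ 0` and a total of at most `m`, the window has at most `m` particles, which bounds the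
activation rate; negative `n` would allow arbitrarily many. The truncation is harmless, as the flux
is never negative. The class is thus invariant, with a bound that can be iterated. -/
lemma IsBoundedTest.posGen (M : Params) {L : ℝ} {m : ℕ} {C : ℝ} {F : Config → ℤ → ℝ}
    (hL : 0 ≤ L) (hC : 0 ≤ C) (hF : IsBoundedTest L m C F) :
    IsBoundedTest L m (M.genBound L m * C) (M.posGen L F) where
  measurable n := by
    unfold Params.posGen
    split_ifs
    · exact hF.measurable_gen M hL n
    · exact measurable_const
  bounded η n := by
    have h0 := mul_nonneg (M.genBound_nonneg hL m) hC
    unfold Params.posGen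
    split_ifs with hn
    · by_cases hm : (m : ℤ) < (η.num 0 L : ℤ) + n
      · rw [M.gen_eq_zero hF hm, abs_zero]
        exact h0
      · refine (M.abs_gen_le hF η n).trans ?_
        have hnm : (η.num 0 L : ℝ) ≤ m := by
          exact_mod_cast (by omega : η.num 0 L ≤ m)
        have h1 := M.totalRate_le hL η
        have h2 := mul_le_mul_of_nonneg_left hnm (M.speedBound_nonneg hL)
        rw [Params.genBound, mul_assoc]
        exact mul_le_mul_of_nonneg_right (by linarith) (by linarith)
    · rw [abs_zero]
      exact h0
  isLocal η ξ h n := by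
    unfold Params.posGen
    split_ifs
    · exact hF.gen_congr M hL h n
    · rfl
  vanishes η n h := by
    unfold Params.posGen
    split_ifs
    · exact M.gen_eq_zero hF h
    · rfl

namespace Params

variable {M : Params} {P : Measure Config} {L : ℝ} {m : ℕ} {C : ℝ} {F : Config → ℤ → ℝ}

/-- The mean of the generator under the stationary law. -/
theorem IsInitialLaw.integral_gen (hP : M.IsInitialLaw (M.v 0) P)
    (hv : ∀ y, 0 < y → M.v 0 < M.v y) (hL : 0 ≤ L)
    (hrate : IntegrableOn (M.stackRate (M.v 0)) (Set.Ioc 0 L)) (hF : IsBoundedTest L m C F)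
    (n : ℤ) :
    ∫ η, M.gen L F η n ∂P = M.v 0 * ((∫ η, F η (n + 1) ∂P) - ∫ η, F η n ∂P) := by
  have := hP.isProbabilityMeasure
  have hint : ∀ {G : Config → ℤ → ℝ}, IsBoundedTest L m C G → ∀ n, Integrable (fun η => G η n) P :=
    fun hG n => Integrable.of_bound (hG.measurable n).aestronglyMeasurable C
      (Eventually.of_forall fun η => hG.bounded η n)
  have key : ∀ {G : Config → ℤ → ℝ}, IsBoundedTest L m C G → (∀ η n, 0 ≤ G η n) →
      Integrable (fun η => M.gen L G η n) P ∧
      ∫ η, M.gen L G η n ∂P = M.v 0 * ((∫ η, G η (n + 1) ∂P) - ∫ η, G η n ∂P) := by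
    intro G hG h0
    have hv0 := (M.v_pos 0 le_rfl).le
    -- Where `G` does not vanish at level `n`, the window has at most `m - n` particles, so the
    -- total rate is bounded there.
    have hR : Integrable (fun η => M.totalRate L η * G η n) P := by
      refine Integrable.of_bound (M.measurable_totalRate.mul
        (hG.measurable n)).aestronglyMeasurable (M.speedBound L * (m - n : ℤ).toNat * C)
        (Eventually.of_forall fun η => ?_)
      have hC : 0 ≤ C := (abs_nonneg _).trans (hG.bounded η n)
      have hS := M.speedBound_nonneg hL
      rw [Real.norm_eq_abs, abs_mul, abs_of_nonneg (M.totalRate_nonneg η)]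
      by_cases hm : (m : ℤ) < (η.num 0 L : ℤ) + n
      · rw [hG.vanishes η n hm, abs_zero, mul_zero]
        positivity
      · refine mul_le_mul ((M.totalRate_le hL η).trans (mul_le_mul_of_nonneg_left ?_ hS))
          (hG.bounded η n) (abs_nonneg _) (by positivity)
        exact_mod_cast (by omega : η.num 0 L ≤ (m - n : ℤ).toNat)
    have hg := hP.lintegral_gain hv hL hrate (hG.measurable n).ennreal_ofReal
      (hG.measurable (n + 1)).ennreal_ofReal
    have e1 : ∫⁻ η, (∑ y ∈ η.sites L, ENNReal.ofReal (M.v y * (1 - M.q ^ η.count y))) *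
        ENNReal.ofReal (G η n) ∂P = ENNReal.ofReal (∫ η, M.totalRate L η * G η n ∂P) := by
      rw [ofReal_integral_eq_lintegral_ofReal hR
        (Eventually.of_forall fun η => mul_nonneg (M.totalRate_nonneg η) (h0 η n))]
      refine lintegral_congr fun η => ?_
      rw [← ofReal_totalRate, ENNReal.ofReal_mul (M.totalRate_nonneg η)]
    have e2 : ∫⁻ η, ENNReal.ofReal (G η (n + 1)) ∂P = ENNReal.ofReal (∫ η, G η (n + 1) ∂P) :=
      (ofReal_integral_eq_lintegral_ofReal (hint hG _)
        (Eventually.of_forall fun η => h0 η _)).symm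
    have hi1 : 0 ≤ ∫ η, M.totalRate L η * G η n ∂P :=
      integral_nonneg fun η => mul_nonneg (M.totalRate_nonneg η) (h0 η n)
    have hi2 : 0 ≤ ∫ η, G η (n + 1) ∂P := integral_nonneg fun η => h0 η _
    rw [e1, e2, ← ENNReal.ofReal_mul hv0, ← ENNReal.ofReal_add hi1 (mul_nonneg hv0 hi2)] at hg
    have hgm := Params.measurable_gain M L (hG.measurable n).ennreal_ofReal
      (hG.measurable (n + 1)).ennreal_ofReal
    have hgi := integrable_toReal_of_lintegral_ne_top hgm.aemeasurable
      (hg ▸ ENNReal.ofReal_ne_top)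
    have hlt := ae_lt_top hgm (hg ▸ ENNReal.ofReal_ne_top)
    have hG1 := (hint hG n).const_mul (M.v 0)
    have hG1R : Integrable (fun η => M.v 0 * G η n + M.totalRate L η * G η n) P := hG1.add hR
    simp_rw [M.gen_eq_gain hL hG h0, add_mul]
    refine ⟨hgi.sub hG1R, ?_⟩
    rw [integral_sub hgi hG1R, integral_add hG1 hR, integral_toReal hgm.aemeasurable hlt,
      hg, ENNReal.toReal_ofReal (add_nonneg hi1 (mul_nonneg hv0 hi2)), integral_const_mul]
    ring
  obtain ⟨i1, k1⟩ := key hF.posPart fun _ _ => le_max_right _ _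
  obtain ⟨i2, k2⟩ := key hF.neg.posPart fun _ _ => le_max_right _ _
  have hsplit : ∀ k, ∫ η, F η k ∂P = (∫ η, max (F η k) 0 ∂P) - ∫ η, max (-F η k) 0 ∂P := by
    intro k
    rw [← integral_sub (hint hF.posPart k) (hint hF.neg.posPart k)]
    refine integral_congr_ae (Eventually.of_forall fun η => ?_)
    rcases le_total 0 (F η k) with h | h
    · simp only [max_eq_left h, max_eq_right (show -F η k ≤ 0 by linarith), sub_zero]
    · simp only [max_eq_right h, max_eq_left (show 0 ≤ -F η k by linarith)]
      ring
  simp_rw [hF.gen_eq M]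
  rw [integral_sub i1 i2, k1, k2, hsplit, hsplit n]
  ring

end Params

/-! ### Right-continuous processes -/

/-- Time is approximated from the right by multiples of `1 / (n + 1)`. For each `n` only countably
many times occur, and for each path the value is eventually the right one. -/
lemma measurable_uncurry_of_rightCont {Ω : Type*} [MeasurableSpace Ω] {Y : ℝ≥0 → Ω → ℝ}
    (hY : ∀ t, Measurable (Y t)) (hr : ∀ ω t, ∀ᶠ s in 𝓝[≥] t, Y s ω = Y t ω) :
    Measurable fun p : ℝ≥0 × Ω => Y p.1 p.2 := by
  let d : ℕ → ℝ≥0 → ℝ≥0 := fun n t => ((⌊t * (n + 1)⌋₊ + 1 : ℕ) : ℝ≥0) / (n + 1)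
  have hd1 : ∀ n t, t ≤ d n t := fun n t => by
    rw [le_div_iff₀ (by positivity)]
    push_cast
    exact (Nat.lt_floor_add_one _).le
  have hd2 : ∀ n t, d n t ≤ t + 1 / (n + 1) := fun n t => by
    simp only [d]
    rw [div_le_iff₀ (by positivity), add_mul, one_div, inv_mul_cancel₀ (by positivity)]
    push_cast
    gcongr
    exact Nat.floor_le (by positivity)
  have hd : ∀ t, Tendsto (fun n => d n t) atTop (𝓝[≥] t) := by
    intro t
    refine tendsto_nhdsWithin_iff.2 ⟨?_, Eventually.of_forall fun n => hd1 n t⟩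
    refine tendsto_of_tendsto_of_tendsto_of_le_of_le tendsto_const_nhds ?_ (fun n => hd1 n t)
      fun n => hd2 n t
    have := tendsto_const_nhds (x := t) |>.add (tendsto_one_div_add_atTop_nhds_zero_nat (𝕜 := ℝ≥0))
    simpa using this
  have hm : ∀ n : ℕ, Measurable fun p : ℝ≥0 × Ω => Y (d n p.1) p.2 := by
    intro n
    have h1 : Measurable fun x : ℕ × Ω => Y (((x.1 + 1 : ℕ) : ℝ≥0) / (n + 1)) x.2 :=
      measurable_from_prod_countable_right fun k => hY (((k + 1 : ℕ) : ℝ≥0) / (n + 1))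
    have h2 : Measurable fun p : ℝ≥0 × Ω => (⌊p.1 * (n + 1)⌋₊, p.2) :=
      (Nat.measurable_floor.comp (measurable_fst.mul_const _)).prodMk measurable_snd
    exact h1.comp h2
  refine measurable_of_tendsto_metrizable hm (tendsto_pi_nhds.2 fun p => ?_)
  exact tendsto_const_nhds.congr' (((hd p.1).eventually (hr p.2 p.1)).mono fun n hn => hn.symm)

/-! ### Uniqueness for linear evolution equations -/

/-- If `δ` solves `δ_F' = δ_{AF}` with `δ_F(0) = 0` and satisfies the a priori bound given by a
norm for which `A` is bounded, then `δ` vanishes. -/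
lemma eq_zero_of_eq_integral {T : Type*} {p : ℝ → T → Prop} {A : T → T} {δ : T → ℝ → ℝ} {K B : ℝ}
    (hK : 0 ≤ K) (hA : ∀ C F, 0 ≤ C → p C F → p (K * C) (A F))
    (hδ : ∀ C F, 0 ≤ C → p C F → ∀ t, 0 ≤ t → |δ F t| ≤ B * C)
    (hint : ∀ C F, 0 ≤ C → p C F → ∀ t, 0 ≤ t → δ F t = ∫ r in (0 : ℝ)..t, δ (A F) r)
    {C : ℝ} (hC : 0 ≤ C) {F : T} (hF : p C F) {t : ℝ} (ht : 0 ≤ t) : δ F t = 0 := by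
  -- Picard iteration: every use of the integral equation costs a factor `K` and one more
  -- integration, and `(K t)^k / k!` tends to zero.
  have key : ∀ k : ℕ, ∀ C F, 0 ≤ C → p C F → ∀ t, 0 ≤ t →
      |δ F t| ≤ B * C * ((K * t) ^ k / k.factorial) := by
    intro k
    induction k with
    | zero => simpa using hδ
    | succ k ih =>
      intro C F hC hF t ht
      have hKC := mul_nonneg hK hC
      have hc : Continuous fun r : ℝ => B * (K * C) * ((K * r) ^ k / k.factorial) := by fun_prop
      rw [hint C F hC hF t ht, ← Real.norm_eq_abs]
      refine (intervalIntegral.norm_integral_le_of_norm_le ht (Eventually.of_forall fun r hr =>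
        ih (K * C) (A F) hKC (hA C F hC hF) r hr.1.le) (hc.intervalIntegrable 0 t)).trans
        (le_of_eq ?_)
      have hk : ((k.factorial : ℕ) : ℝ) ≠ 0 := by exact_mod_cast k.factorial_ne_zero
      have hk1 : (k : ℝ) + 1 ≠ 0 := by positivity
      simp_rw [mul_pow, mul_div_assoc]
      rw [intervalIntegral.integral_const_mul, intervalIntegral.integral_const_mul,
        intervalIntegral.integral_div, integral_pow, Nat.factorial_succ]
      push_cast
      field_simp
      ring
  have hlim : Tendsto (fun k : ℕ => B * C * ((K * t) ^ k / k.factorial)) atTop (𝓝 0) := by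
    simpa using (FloorSemiring.tendsto_pow_div_factorial_atTop (K * t)).const_mul (B * C)
  have := ge_of_tendsto' hlim fun k => key k C F hC hF t ht
  exact abs_nonpos_iff.1 this

/-! ### Poisson weights -/

/-- The Poisson weights. -/
noncomputable def poissonWeight (a : ℝ) (j : ℕ) : ℝ := Real.exp (-a) * a ^ j / j.factorial

lemma poissonWeight_zero (j : ℕ) : poissonWeight 0 j = if j = 0 then 1 else 0 := by
  rcases j with _ | j <;> simp [poissonWeight]

lemma poissonWeight_nonneg {a : ℝ} (ha : 0 ≤ a) (j : ℕ) : 0 ≤ poissonWeight a j := by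
  unfold poissonWeight
  positivity

lemma hasSum_poissonWeight {a : ℝ} (ha : 0 ≤ a) : HasSum (poissonWeight a) 1 :=
  hasSum_one_poissonMeasure ⟨a, ha⟩

lemma sum_poissonWeight_le {a : ℝ} (ha : 0 ≤ a) (s : Finset ℕ) :
    ∑ j ∈ s, poissonWeight a j ≤ 1 :=
  sum_le_hasSum s (fun j _ => poissonWeight_nonneg ha j) (hasSum_poissonWeight ha)

lemma continuous_poissonWeight (j : ℕ) : Continuous fun a => poissonWeight a j := by
  unfold poissonWeight
  fun_prop

/-- The Poisson weights satisfy `w_j' = v (w_(j-1) - w_j)` with `w_(-1) = 0`. Summation by parts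
moves the difference to `c`; the boundary term vanishes since `c (m + 1) = 0`. -/
lemma hasDerivAt_sum_poissonWeight (c : ℕ → ℝ) (m : ℕ) (hc : c (m + 1) = 0) (v t : ℝ) :
    HasDerivAt (fun t => ∑ j ∈ Finset.range (m + 1), poissonWeight (v * t) j * c j)
      (∑ j ∈ Finset.range (m + 1), poissonWeight (v * t) j * (v * (c (j + 1) - c j))) t := by
  have h0 : HasDerivAt (fun t => Real.exp (-(v * t))) (-v * Real.exp (-(v * t))) t := by
    have := ((hasDerivAt_id t).const_mul v).neg.exp
    simpa [mul_comm] using this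
  have hp : ∀ j : ℕ, HasDerivAt (fun t => poissonWeight (v * t) j)
      (v * ((if j = 0 then 0 else poissonWeight (v * t) (j - 1)) - poissonWeight (v * t) j)) t := by
    intro j
    have h1 : HasDerivAt (fun t => (v * t) ^ j) (j * (v * t) ^ (j - 1) * v) t := by
      simpa using ((hasDerivAt_id t).const_mul v).fun_pow j
    have h2 := (h0.mul h1).div_const (j.factorial : ℝ)
    unfold poissonWeight
    refine h2.congr_deriv ?_
    rcases j with _ | j
    · simp
    · have hk : ((j.factorial : ℕ) : ℝ) ≠ 0 := by exact_mod_cast j.factorial_ne_zero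
      have hk1 : (j : ℝ) + 1 ≠ 0 := by positivity
      rw [if_neg (Nat.succ_ne_zero j), Nat.add_sub_cancel, Nat.factorial_succ]
      push_cast
      field_simp
      ring
  have hsum := HasDerivAt.fun_sum (u := Finset.range (m + 1)) fun j _ => (hp j).mul_const (c j)
  refine hsum.congr_deriv ?_
  have e : ∀ j, v * ((if j = 0 then 0 else poissonWeight (v * t) (j - 1)) -
      poissonWeight (v * t) j) * c j =
      v * ((if j = 0 then 0 else poissonWeight (v * t) (j - 1)) * c j) -
      v * (poissonWeight (v * t) j * c j) := fun j => by ring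
  have e' : ∀ j, poissonWeight (v * t) j * (v * (c (j + 1) - c j)) =
      v * (poissonWeight (v * t) j * c (j + 1)) - v * (poissonWeight (v * t) j * c j) :=
    fun j => by ring
  simp_rw [e, e', Finset.sum_sub_distrib]
  congr 1
  rw [Finset.sum_range_succ', Finset.sum_range_succ, hc]
  simp

variable {Ω : Type*} [mΩ : MeasurableSpace Ω] {M : Params} {μ : Measure Ω}
  {ℱ : Filtration ℝ≥0 mΩ} {X : ℝ≥0 → Ω → Config} {I : ℝ≥0 → Ω → ℕ} {L : ℝ} {m : ℕ} {C : ℝ}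
  {F : Config → ℤ → ℝ} {P : Measure Config}

/-! ### The law of the window and of the flux, given the past. -/

namespace IsExpJumpProcess

lemma flux_zero (hX : IsExpJumpProcess M μ ℱ X I) (L : ℝ) (ω : Ω) : flux X I L 0 ω = 0 := by
  simp [flux, hX.inj_zero]

lemma flux_nonneg (hX : IsExpJumpProcess M μ ℱ X I) (hL : 0 ≤ L) (t : ℝ≥0) (ω : Ω) :
    0 ≤ flux X I L t ω := by
  rw [← hX.flux_zero L ω]
  exact hX.flux_mono ω L hL (zero_le (a := t))

lemma measurable_flux (hX : IsExpJumpProcess M μ ℱ X I) (L : ℝ) (t : ℝ≥0) :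
    Measurable[ℱ t] (flux X I L t) := by
  have hnum : Measurable fun η : Config => ((η.num 0 L : ℕ) : ℤ) :=
    (measurable_from_nat (f := fun n : ℕ => (n : ℤ))).comp
      (Config.measurable_num measurable_id measurable_const measurable_const)
  have h1 : Measurable[ℱ t] fun ω => (I t ω : ℤ) :=
    (measurable_from_nat (f := fun n : ℕ => (n : ℤ))).comp (hX.measurable_inj t)
  have h2 : Measurable[ℱ t] fun ω => ((X 0 ω).num 0 L : ℤ) :=
    hnum.comp ((hX.measurable_config 0).mono (ℱ.mono (zero_le (a := t))) le_rfl)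
  exact (h1.add h2).sub (hnum.comp (hX.measurable_config t))

lemma flux_right_cont (hX : IsExpJumpProcess M μ ℱ X I) (L : ℝ) (ω : Ω) (t : ℝ≥0) :
    ∀ᶠ s in 𝓝[≥] t, flux X I L s ω = flux X I L t ω := by
  filter_upwards [hX.right_cont ω L t] with s hs
  rw [flux, flux, hs.1, Config.num_congr hs.2 0]

lemma measurable_observable (hX : IsExpJumpProcess M μ ℱ X I) (L : ℝ)
    (hF : ∀ n, Measurable fun η => F η n) (t : ℝ≥0) :
    Measurable fun ω => F (X t ω) (flux X I L t ω) := by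
  have h1 : Measurable fun x : Config × ℤ => F x.1 x.2 :=
    measurable_from_prod_countable_left fun n => hF n
  exact h1.comp (((hX.measurable_config t).mono (ℱ.le t) le_rfl).prodMk
    ((hX.measurable_flux L t).mono (ℱ.le t) le_rfl))

lemma measurable_uncurry_observable (hX : IsExpJumpProcess M μ ℱ X I)
    (hF : IsBoundedTest L m C F) :
    Measurable fun p : ℝ≥0 × Ω => F (X p.1 p.2) (flux X I L p.1 p.2) := by
  refine measurable_uncurry_of_rightCont (Y := fun t ω => F (X t ω) (flux X I L t ω))
    (fun t => hX.measurable_observable L hF.measurable t) fun ω t => ?_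
  filter_upwards [hX.right_cont ω L t, hX.flux_right_cont L ω t] with s hs hs'
  rw [hs', hF.isLocal _ _ hs.2]

variable [IsProbabilityMeasure μ]

lemma integrable_observable (hX : IsExpJumpProcess M μ ℱ X I) (hF : IsBoundedTest L m C F)
    (t : ℝ≥0) : Integrable (fun ω => F (X t ω) (flux X I L t ω)) μ :=
  Integrable.of_bound (hX.measurable_observable L hF.measurable t).aestronglyMeasurable C
    (Eventually.of_forall fun _ => hF.bounded _ _)

/-- The martingale problem, integrated over an event of the past. -/
lemma setIntegral_observable (hX : IsExpJumpProcess M μ ℱ X I) (hL : 0 ≤ L) (hC : 0 ≤ C)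
    (hF : IsBoundedTest L m C F) {s : ℝ≥0} {A : Set Ω} (hA : MeasurableSet[ℱ s] A) {t : ℝ}
    (ht : 0 ≤ t) :
    ∫ ω in A, F (X (s + t.toNNReal) ω) (flux X I L (s + t.toNNReal) ω) ∂μ =
      (∫ ω in A, F (X s ω) (flux X I L s ω) ∂μ) +
        ∫ r in (0 : ℝ)..t, ∫ ω in A, M.posGen L F (X (s + r.toNNReal) ω)
          (flux X I L (s + r.toNNReal) ω) ∂μ := by
  have hG := hF.posGen M hL hC
  obtain ⟨g, hg⟩ : ∃ g : ℝ → Ω → ℝ, ∀ r ω,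
      g r ω = M.posGen L F (X r.toNNReal ω) (flux X I L r.toNNReal ω) := ⟨_, fun _ _ => rfl⟩
  have hgb : ∀ r ω, ‖g r ω‖ ≤ M.genBound L m * C := fun r ω => by
    rw [hg]
    exact hG.bounded _ _
  have hgm : Measurable fun p : ℝ × Ω => g p.1 p.2 := by
    have h : Measurable fun p : ℝ × Ω => (p.1.toNNReal, p.2) :=
      (measurable_real_toNNReal.comp measurable_fst).prodMk measurable_snd
    simp_rw [hg]
    exact (hX.measurable_uncurry_observable hG).comp h
  have hgi : ∀ ω a b, IntervalIntegrable (fun r => g r ω) volume a b := fun ω a b =>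
    (intervalIntegrable_const (c := M.genBound L m * C)).mono_fun
      (hgm.comp measurable_prodMk_right).aestronglyMeasurable
      (Eventually.of_forall fun r => (hgb r ω).trans (le_abs_self _))
  -- Along the paths the flux is nonnegative, so the truncated, bounded generator can replace the
  -- full one.
  have hgen : ∀ r ω, M.gen L F (X (Real.toNNReal r) ω) (flux X I L (Real.toNNReal r) ω) =
      g r ω := fun r ω => by
    rw [hg, Params.posGen, if_pos (hX.flux_nonneg hL _ ω)]
  have hmart := hX.martingale L hL F hF.isTestFunction
  simp_rw [hgen] at hmart
  have hst : s ≤ s + t.toNNReal := le_self_add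
  have e1 := hmart.setIntegral_eq hst hA
  have hDi : ∀ r : ℝ≥0, Integrable (fun ω => ∫ u in (0 : ℝ)..r, g u ω) μ := by
    intro r
    have h := (hX.integrable_observable hF r).sub (hmart.integrable r)
    refine h.congr (Eventually.of_forall fun ω => ?_)
    simp
  rw [integral_sub (hX.integrable_observable hF _).integrableOn (hDi _).integrableOn,
    integral_sub (hX.integrable_observable hF _).integrableOn (hDi _).integrableOn] at e1
  have e2 : (∫ ω in A, (∫ u in (0 : ℝ)..((s + t.toNNReal : ℝ≥0) : ℝ), g u ω) ∂μ) -
      ∫ ω in A, (∫ u in (0 : ℝ)..(s : ℝ), g u ω) ∂μ =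
      ∫ ω in A, (∫ r in (0 : ℝ)..t, g (s + r) ω) ∂μ := by
    rw [← integral_sub (hDi _).integrableOn (hDi _).integrableOn]
    refine integral_congr_ae (Eventually.of_forall fun ω => ?_)
    simp only
    rw [intervalIntegral.integral_interval_sub_left (hgi ω _ _) (hgi ω _ _),
      intervalIntegral.integral_comp_add_left (fun r => g r ω)]
    simp [ht]
  have e3 : ∫ ω in A, (∫ r in (0 : ℝ)..t, g (s + r) ω) ∂μ =
      ∫ r in (0 : ℝ)..t, ∫ ω in A, g (s + r) ω ∂μ := by
    simp_rw [intervalIntegral.integral_of_le ht]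
    refine integral_integral_swap ?_
    have h : Measurable fun p : Ω × ℝ => ((s : ℝ) + p.2, p.1) :=
      (measurable_const.add measurable_snd).prodMk measurable_fst
    have hm : Measurable fun p : Ω × ℝ => g (s + p.2) p.1 := hgm.comp h
    exact Integrable.of_bound (f := fun p : Ω × ℝ => g (s + p.2) p.1) hm.aestronglyMeasurable
      (M.genBound L m * C) (Eventually.of_forall fun p => hgb _ _)
  have e4 : ∫ r in (0 : ℝ)..t, ∫ ω in A, g (s + r) ω ∂μ =
      ∫ r in (0 : ℝ)..t, ∫ ω in A, M.posGen L F (X (s + r.toNNReal) ω)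
          (flux X I L (s + r.toNNReal) ω) ∂μ := by
    refine intervalIntegral.integral_congr fun r hr => ?_
    rw [Set.uIcc_of_le ht] at hr
    simp only [hg]
    rw [Real.toNNReal_add s.coe_nonneg hr.1, Real.toNNReal_coe]
  rw [← e4, ← e3, ← e2]
  linarith

lemma intervalIntegrable_setIntegral (hX : IsExpJumpProcess M μ ℱ X I)
    (hF : IsBoundedTest L m C F) (s : ℝ≥0) (A : Set Ω) (a b : ℝ) :
    IntervalIntegrable (fun r : ℝ => ∫ ω in A, F (X (s + r.toNNReal) ω)
      (flux X I L (s + r.toNNReal) ω) ∂μ) volume a b := by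
  have hm : Measurable fun p : ℝ × Ω => F (X (s + p.1.toNNReal) p.2)
      (flux X I L (s + p.1.toNNReal) p.2) := by
    have h : Measurable fun p : ℝ × Ω => (s + p.1.toNNReal, p.2) :=
      (measurable_const.add (measurable_real_toNNReal.comp measurable_fst)).prodMk measurable_snd
    exact (hX.measurable_uncurry_observable hF).comp h
  have hsm := hm.stronglyMeasurable.integral_prod_right' (ν := μ.restrict A)
  refine (intervalIntegrable_const (c := C)).mono_fun hsm.aestronglyMeasurable
    (Eventually.of_forall fun r => ?_)
  have := norm_setIntegral_le_of_norm_le_const (measure_lt_top μ A)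
    (f := fun ω => F (X (s + r.toNNReal) ω) (flux X I L (s + r.toNNReal) ω))
    (fun ω _ => hF.bounded _ _)
  have hC : 0 ≤ C ∨ IsEmpty Ω := by
    by_cases h : Nonempty Ω
    · exact Or.inl ((abs_nonneg _).trans (hF.bounded (X 0 h.some) 0))
    · exact Or.inr (not_nonempty_iff.1 h)
  rcases hC with hC | h
  · refine this.trans ((mul_le_of_le_one_right hC measureReal_le_one).trans (le_abs_self _))
  · simp [Subsingleton.elim A ∅]

end IsExpJumpProcess

/-- On the event `A` of mass `c` in the past of `s`, the flux is `i` and the particles in `(0, L]`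
at time `s` have law `P`. -/
structure IsStationaryOn (ℱ : Filtration ℝ≥0 mΩ) (X : ℝ≥0 → Ω → Config) (I : ℝ≥0 → Ω → ℕ)
    (μ : Measure Ω) (P : Measure Config) (L : ℝ) (s : ℝ≥0) (i : ℕ) (A : Set Ω) (c : ℝ) :
    Prop where
  measurableSet : MeasurableSet[ℱ s] A
  flux_eq : ∀ ω ∈ A, flux X I L s ω = i
  integral_eq : ∀ (m : ℕ) (C : ℝ) (f : Config → ℝ), Measurable f → (∀ η, |f η| ≤ C) →
    (∀ η ξ : Config, (∀ x, x ≤ L → η.count x = ξ.count x) → f η = f ξ) →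
    (∀ η : Config, m < η.num 0 L → f η = 0) → ∫ ω in A, f (X s ω) ∂μ = c * ∫ η, f η ∂P

namespace IsStationaryOn

variable [IsProbabilityMeasure μ] {s : ℝ≥0} {i : ℕ} {A : Set Ω} {c : ℝ}

lemma abs_mean_le [IsProbabilityMeasure P] (hF : IsBoundedTest L m C F) (n : ℤ) :
    |∫ η, F η n ∂P| ≤ C := by
  have := norm_integral_le_of_norm_le_const (μ := P) (f := fun η => F η n)
    (Eventually.of_forall fun η => hF.bounded η n)
  simpa using this

/-- The evolution of the particles in `(0, L]` together with the flux. -/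
theorem setIntegral_test (hA : IsStationaryOn ℱ X I μ P L s i A c)
    (hX : IsExpJumpProcess M μ ℱ X I) (hP : M.IsInitialLaw (M.v 0) P)
    (hv : ∀ y, 0 < y → M.v 0 < M.v y) (hL : 0 ≤ L)
    (hrate : IntegrableOn (M.stackRate (M.v 0)) (Set.Ioc 0 L)) (hC : 0 ≤ C)
    (hF : IsBoundedTest L m C F) {t : ℝ} (ht : 0 ≤ t) :
    ∫ ω in A, F (X (s + t.toNNReal) ω) (flux X I L (s + t.toNNReal) ω) ∂μ =
      c * ∑ j ∈ Finset.range (m + 1), poissonWeight (M.v 0 * t) j * ∫ η, F η (i + j) ∂P := by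
  have := hP.isProbabilityMeasure
  have hv0 := (M.v_pos 0 le_rfl).le
  let φ : (Config → ℤ → ℝ) → ℝ → ℝ := fun F t =>
    ∫ ω in A, F (X (s + t.toNNReal) ω) (flux X I L (s + t.toNNReal) ω) ∂μ
  let ψ : (Config → ℤ → ℝ) → ℝ → ℝ := fun F t =>
    ∑ j ∈ Finset.range (m + 1), poissonWeight (M.v 0 * t) j * ∫ η, F η (i + j) ∂P
  have hψc : ∀ F, Continuous (ψ F) := fun F => continuous_finsetSum _ fun j _ =>
    ((continuous_poissonWeight j).comp (continuous_const.mul continuous_id)).mul_const _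
  have h0 : φ F t - c * ψ F t = 0 := by
    -- `φ` obeys the evolution equation by the martingale problem, and `c ψ` by the stationary
    -- identity for the generator and the Poisson equation. They agree at time `0`, because the flux
    -- is `i` on `A` and the window has law `P` there.
    refine eq_zero_of_eq_integral (p := fun C F => IsBoundedTest L m C F) (A := M.posGen L)
      (δ := fun F t => φ F t - c * ψ F t) (K := M.genBound L m) (B := 1 + |c|)
      (M.genBound_nonneg hL m) (fun C F hC hF => hF.posGen M hL hC) ?_ ?_ hC hF ht
    · intro C F hC hF t ht
      have h1 : |φ F t| ≤ C := by
        have := norm_setIntegral_le_of_norm_le_const (measure_lt_top μ A)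
          (f := fun ω => F (X (s + t.toNNReal) ω) (flux X I L (s + t.toNNReal) ω))
          (fun ω _ => hF.bounded _ _)
        exact this.trans (mul_le_of_le_one_right hC measureReal_le_one)
      have h2 : |ψ F t| ≤ C := by
        have ha := mul_nonneg hv0 ht
        calc |ψ F t| ≤ ∑ j ∈ Finset.range (m + 1), poissonWeight (M.v 0 * t) j * C := by
              refine (Finset.abs_sum_le_sum_abs _ _).trans (Finset.sum_le_sum fun j _ => ?_)
              rw [abs_mul, abs_of_nonneg (poissonWeight_nonneg ha j)]
              exact mul_le_mul_of_nonneg_left (abs_mean_le hF _) (poissonWeight_nonneg ha j)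
          _ ≤ C := by
              rw [← Finset.sum_mul]
              exact mul_le_of_le_one_left hC (sum_poissonWeight_le ha _)
      calc |φ F t - c * ψ F t| ≤ |φ F t| + |c * ψ F t| := abs_sub _ _
        _ ≤ C + |c| * C := by
            rw [abs_mul]
            exact add_le_add h1 (mul_le_mul_of_nonneg_left h2 (abs_nonneg c))
        _ = (1 + |c|) * C := by ring
    · intro C F hC hF t ht
      have hG := hF.posGen M hL hC
      have h1 : φ F t = (∫ ω in A, F (X s ω) (flux X I L s ω) ∂μ) +
          ∫ r in (0 : ℝ)..t, φ (M.posGen L F) r :=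
        hX.setIntegral_observable hL hC hF hA.measurableSet ht
      have h2 : ∫ ω in A, F (X s ω) (flux X I L s ω) ∂μ = c * ψ F 0 := by
        have e : ψ F 0 = ∫ η, F η i ∂P := by
          simp only [ψ, mul_zero, poissonWeight_zero]
          rw [Finset.sum_eq_single 0] <;> simp
          intro b _ hb h
          exact absurd h hb
        rw [e, ← hA.integral_eq m C (fun η => F η i) (hF.measurable i) (fun η => hF.bounded η i)
          (fun η ξ h => hF.isLocal η ξ h i) fun η h => hF.vanishes η i (by omega)]
        refine setIntegral_congr_fun (ℱ.le s _ hA.measurableSet) fun ω hω => ?_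
        simp only [hA.flux_eq ω hω]
      have h3 : ∫ r in (0 : ℝ)..t, ψ (M.posGen L F) r = ψ F t - ψ F 0 := by
        refine intervalIntegral.integral_eq_sub_of_hasDerivAt (fun r _ => ?_)
          ((hψc _).intervalIntegrable 0 t)
        -- A test function vanishes once the flux exceeds `m`; this justifies the cut of the Poisson
        -- sum at `m`.
        have hz : ∫ η, F η ((i : ℤ) + (m + 1 : ℕ)) ∂P = 0 := by
          rw [← integral_zero Config ℝ (μ := P)]
          refine integral_congr_ae (Eventually.of_forall fun η => hF.vanishes η _ ?_)
          push_cast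
          omega
        refine (hasDerivAt_sum_poissonWeight (fun j => ∫ η, F η ((i : ℤ) + j) ∂P) m hz
          (M.v 0) r).congr_deriv ?_
        refine Finset.sum_congr rfl fun j _ => ?_
        have hg := hP.integral_gen hv hL hrate hF ((i : ℤ) + j)
        have hpos : (0 : ℤ) ≤ (i : ℤ) + j := by positivity
        simp only [Params.posGen, if_pos hpos, hg]
        push_cast
        rw [add_assoc]
      change φ F t - c * ψ F t = ∫ r in (0 : ℝ)..t, (φ (M.posGen L F) r - c * ψ (M.posGen L F) r)
      rw [intervalIntegral.integral_sub (hX.intervalIntegrable_setIntegral hG s A 0 t)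
        (((hψc _).const_mul c).intervalIntegrable 0 t), intervalIntegral.integral_const_mul, h3,
        h1, h2]
      ring
  exact sub_eq_zero.1 h0

end IsStationaryOn

/-- Events that only depend on the particles in `(0, L]`. -/
def IsLocalEvent (L : ℝ) (S : Set Config) : Prop :=
  ∀ η ξ : Config, (∀ x, x ≤ L → η.count x = ξ.count x) → (η ∈ S ↔ ξ ∈ S)

/-! ### Local events determine the law of a configuration. -/

section LocalEvents

lemma IsLocalEvent.mono {L L' : ℝ} (h : L ≤ L') {S : Set Config} (hS : IsLocalEvent L S) :
    IsLocalEvent L' S := fun η ξ hx => hS η ξ fun x hxL => hx x (hxL.trans h)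

/-- The measurable local events. -/
def localEvents : Set (Set Config) := {S | MeasurableSet S ∧ ∃ L : ℝ, 0 ≤ L ∧ IsLocalEvent L S}

lemma isPiSystem_localEvents : IsPiSystem localEvents := by
  rintro S ⟨hS, L, hL, hSL⟩ T ⟨hT, L', _, hTL⟩ -
  refine ⟨hS.inter hT, max L L', hL.trans (le_max_left _ _), fun η ξ h => ?_⟩
  exact and_congr (hSL.mono (le_max_left _ _) η ξ h) (hTL.mono (le_max_right _ _) η ξ h)

lemma generateFrom_localEvents :
    (inferInstance : MeasurableSpace Config) = MeasurableSpace.generateFrom localEvents := by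
  refine le_antisymm ?_ (MeasurableSpace.generateFrom_le fun S hS => hS.1)
  have key : ∀ A : Set ℝ, MeasurableSet A →
      Measurable[MeasurableSpace.generateFrom localEvents] fun η : Config => η.toMeasure A := by
    intro A hA
    have h1 : (fun η : Config => η.toMeasure A) =
        fun η => ⨆ n : ℕ, η.toMeasure (A ∩ Set.Iic (n : ℝ)) := by
      ext η
      rw [← Monotone.measure_iUnion, ← Set.inter_iUnion]
      · congr 1
        rw [Set.inter_eq_left.2]
        intro x _
        obtain ⟨n, hn⟩ := exists_nat_ge x
        exact Set.mem_iUnion.2 ⟨n, hn⟩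
      · intro a b hab
        exact Set.inter_subset_inter_right _ (Set.Iic_subset_Iic.2 (by exact_mod_cast hab))
    rw [h1]
    refine Measurable.iSup fun n U hU => MeasurableSpace.measurableSet_generateFrom ?_
    refine ⟨((Measure.measurable_coe (hA.inter measurableSet_Iic)).comp
      Config.measurable_toMeasure) hU, n, n.cast_nonneg, fun η ξ h => ?_⟩
    have e : η.toMeasure (A ∩ Set.Iic (n : ℝ)) = ξ.toMeasure (A ∩ Set.Iic (n : ℝ)) := by
      rw [Config.toMeasure_apply _ (hA.inter measurableSet_Iic),
        Config.toMeasure_apply _ (hA.inter measurableSet_Iic)]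
      refine tsum_congr fun x => ?_
      by_cases hx : x ∈ A ∩ Set.Iic (n : ℝ)
      · rw [h x hx.2]
      · simp [Set.indicator_of_notMem hx]
    simp only [Set.mem_preimage, e]
  have := @Config.measurable_of_toMeasure Config (MeasurableSpace.generateFrom localEvents) id key
  intro S hS
  exact this hS

end LocalEvents

variable {Ω : Type*} [mΩ : MeasurableSpace Ω] {M : Params} {μ : Measure Ω}
  {ℱ : Filtration ℝ≥0 mΩ} {X : ℝ≥0 → Ω → Config} {I : ℝ≥0 → Ω → ℕ} {L : ℝ} {m : ℕ} {C : ℝ}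
  {F : Config → ℤ → ℝ} {P : Measure Config}

namespace IsStationaryOn

variable {s : ℝ≥0} {i : ℕ} {A : Set Ω} {c : ℝ}

lemma univ (hX : IsExpJumpProcess M μ ℱ X I) (h0 : μ.map (X 0) = P) (L : ℝ) :
    IsStationaryOn ℱ X I μ P L 0 0 Set.univ 1 where
  measurableSet := MeasurableSet.univ
  flux_eq ω _ := by simpa using hX.flux_zero L ω
  integral_eq m C f hf _ _ _ := by
    rw [← h0, integral_map ((hX.measurable_config 0).mono (ℱ.le 0) le_rfl).aemeasurable
      hf.aestronglyMeasurable, one_mul, Measure.restrict_univ]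

variable [IsProbabilityMeasure μ]

/-- Given the past, the flux grows by a Poisson variable, and it is independent of the particles
in `(0, L]`. -/
lemma step (hA : IsStationaryOn ℱ X I μ P L s i A c)
    (hX : IsExpJumpProcess M μ ℱ X I) (hP : M.IsInitialLaw (M.v 0) P)
    (hv : ∀ y, 0 < y → M.v 0 < M.v y) (hL : 0 ≤ L)
    (hrate : IntegrableOn (M.stackRate (M.v 0)) (Set.Ioc 0 L)) (j : ℕ) {t : ℝ≥0} (hst : s ≤ t) :
    IsStationaryOn ℱ X I μ P L t (i + j) (A ∩ {ω | flux X I L t ω = (i + j : ℕ)})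
      (c * poissonWeight (M.v 0 * (t - s)) j) := by
  have hprob := hP.isProbabilityMeasure
  have hB : MeasurableSet[ℱ t] {ω | flux X I L t ω = (i + j : ℕ)} :=
    hX.measurable_flux L t (measurableSet_singleton _)
  refine ⟨(ℱ.mono hst _ hA.measurableSet).inter hB, fun ω hω => hω.2, ?_⟩
  intro m C f hf hC hl hm
  have hC0 : 0 ≤ C := (abs_nonneg _).trans (hC (nonempty_of_isProbabilityMeasure P).some)
  -- The test function selects the flux value `i + j`. There `f` vanishes beyond `m` particles, so
  -- the total is at most `m + i + j`, and only the summand `j` of the Poisson sum survives.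
  have hF : IsBoundedTest L (m + i + j) C fun η n => if n = (i + j : ℕ) then f η else 0 := by
    refine ⟨fun n => ?_, fun η n => ?_, fun η ξ h n => ?_, fun η n h => ?_⟩
    · split_ifs
      · exact hf
      · exact measurable_const
    · split_ifs
      · exact hC η
      · simpa using hC0
    · rw [hl η ξ h]
    · split_ifs with hn
      · refine hm η ?_
        subst hn
        push_cast at h
        omega
      · rfl
  have key := hA.setIntegral_test hX hP hv hL hrate hC0 hF (t := (t : ℝ) - s)
    (sub_nonneg.2 (NNReal.coe_le_coe.2 hst))
  have ht : s + ((t : ℝ) - s).toNNReal = t := by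
    rw [← NNReal.coe_sub hst, Real.toNNReal_coe, add_tsub_cancel_of_le hst]
  rw [ht, Finset.sum_eq_single j] at key
  · rw [← setIntegral_indicator (ℱ.le t _ hB), mul_assoc]
    have hij : (i : ℤ) + j = (i + j : ℕ) := by push_cast; rfl
    simp only [hij, if_true] at key
    rw [← key]
    congr 1
    ext ω
    simp only [Set.indicator_apply, Set.mem_ofPred_eq]
  · intro b _ hb
    simp [hb]
  · intro h
    exact absurd (Finset.mem_range.2 (by omega)) h

/-- A local event at time `s` is independent of `A`. -/
lemma measureReal_inter (hA : IsStationaryOn ℱ X I μ P L s i A c) [IsProbabilityMeasure P]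
    (hX : IsExpJumpProcess M μ ℱ X I) {S : Set Config} (hS : MeasurableSet S)
    (hSL : IsLocalEvent L S) : μ.real (A ∩ X s ⁻¹' S) = c * P.real S := by
  classical
  have hXm : Measurable (X s) := (hX.measurable_config s).mono (ℱ.le s) le_rfl
  -- The defining identity of `IsStationaryOn` only admits functions that vanish for many particles;
  -- continuity from below removes the restriction.
  let T : ℕ → Set Config := fun m => S ∩ {η | η.num 0 L ≤ m}
  have hTm : ∀ m, MeasurableSet (T m) := fun m => hS.inter
    ((Config.measurable_num measurable_id measurable_const measurable_const) measurableSet_Iic)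
  have hT : Monotone T := fun a b hab => Set.inter_subset_inter_right _ fun η hη => by
    simp only [Set.mem_ofPred_eq] at hη ⊢
    omega
  have hU : ⋃ m, T m = S := by
    rw [← Set.inter_iUnion, Set.inter_eq_left]
    exact fun η _ => Set.mem_iUnion.2 ⟨η.num 0 L, by simp⟩
  have h1 : ∀ m, μ.real (A ∩ X s ⁻¹' T m) = c * P.real (T m) := by
    intro m
    have h := hA.integral_eq m 1 ((T m).indicator 1) (measurable_one.indicator (hTm m))
      (fun η => ?_) (fun η ξ h => ?_) fun η h => ?_
    · rw [integral_indicator_one (hTm m)] at h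
      rw [← h]
      have e : (fun ω => (T m).indicator (1 : Config → ℝ) (X s ω)) =
          (X s ⁻¹' T m).indicator 1 := by
        ext ω
        simp [Set.indicator_apply]
      rw [e, setIntegral_indicator (hXm (hTm m))]
      simp
    · rw [Set.indicator_apply]
      split_ifs <;> simp
    · have : η ∈ T m ↔ ξ ∈ T m := and_congr (hSL η ξ h) (by
        simp only [Set.mem_ofPred_eq, Config.num_congr h 0])
      simp only [Set.indicator_apply, this]
      rfl
    · exact Set.indicator_of_notMem (fun hη => absurd hη.2 (not_le.2 h)) _
  have l1 : Tendsto (fun m => μ.real (A ∩ X s ⁻¹' T m)) atTop (𝓝 (μ.real (A ∩ X s ⁻¹' S))) := by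
    have h := tendsto_measure_iUnion_atTop (μ := μ) (s := fun m => A ∩ X s ⁻¹' T m)
      fun a b hab => Set.inter_subset_inter_right _ (Set.preimage_mono (hT hab))
    rw [← Set.inter_iUnion, ← Set.preimage_iUnion, hU] at h
    exact (ENNReal.tendsto_toReal (measure_ne_top _ _)).comp h
  have l2 : Tendsto (fun m => P.real (T m)) atTop (𝓝 (P.real S)) := by
    have h := tendsto_measure_iUnion_atTop (μ := P) hT
    rw [hU] at h
    exact (ENNReal.tendsto_toReal (measure_ne_top _ _)).comp h
  simp_rw [h1] at l1
  exact tendsto_nhds_unique l1 (l2.const_mul c)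

end IsStationaryOn

variable [IsProbabilityMeasure μ]

lemma hasSum_measureReal_fiber {N : Ω → ℤ} (hN : Measurable N) (h0 : ∀ ω, 0 ≤ N ω) {B : Set Ω}
    (hB : MeasurableSet B) : HasSum (fun j : ℕ => μ.real ({ω | N ω = j} ∩ B)) (μ.real B) := by
  have hU : ⋃ j : ℕ, {ω | N ω = j} ∩ B = B := by
    rw [← Set.iUnion_inter, Set.inter_eq_right]
    intro ω _
    exact Set.mem_iUnion.2 ⟨(N ω).toNat, (Int.toNat_of_nonneg (h0 ω)).symm⟩
  have hs : μ B = ∑' j : ℕ, μ ({ω | N ω = j} ∩ B) := by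
    rw [← measure_iUnion, hU]
    · intro a b hab
      refine Set.disjoint_left.2 fun ω ha hb => hab ?_
      have h1 : N ω = a := ha.1
      have h2 : N ω = b := hb.1
      omega
    · exact fun j => (hN (measurableSet_singleton _)).inter hB
  have := ENNReal.hasSum_toReal (hs ▸ measure_ne_top μ B)
  rw [← ENNReal.tsum_toReal_eq fun _ => measure_ne_top _ _, ← hs] at this
  exact this

/-! ### Stationarity and the Poisson property of the flux. -/

namespace IsExpJumpProcess

variable (hX : IsExpJumpProcess M μ ℱ X I) (hP : M.IsInitialLaw (M.v 0) P)
    (hv : ∀ y, 0 < y → M.v 0 < M.v y)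
    (hrate : ∀ R : ℝ, IntegrableOn (M.stackRate (M.v 0)) (Set.Ioc 0 R)) (h0 : μ.map (X 0) = P)

include hX hP hv hrate h0

/-- Stationarity. -/
theorem map_eq (t : ℝ≥0) : μ.map (X t) = P := by
  have := hP.isProbabilityMeasure
  have hXm : Measurable (X t) := (hX.measurable_config t).mono (ℱ.le t) le_rfl
  have := Measure.isProbabilityMeasure_map (μ := μ) hXm.aemeasurable
  refine ext_of_generate_finite localEvents generateFrom_localEvents isPiSystem_localEvents ?_
    (by simp)
  rintro S ⟨hS, L, hL, hSL⟩
  rw [Measure.map_apply hXm hS, ← measureReal_eq_measureReal_iff]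
  have hN := (hX.measurable_flux L t).mono (ℱ.le t) le_rfl
  have h1 := hasSum_measureReal_fiber (μ := μ) hN (hX.flux_nonneg hL t) (hXm hS)
  -- At time `t` the flux is independent of the window. Summation over its values, whose Poisson
  -- weights add up to one, leaves the law of the window.
  have h2 : ∀ j : ℕ, μ.real ({ω | flux X I L t ω = j} ∩ X t ⁻¹' S) =
      poissonWeight (M.v 0 * t) j * P.real S := by
    intro j
    have h := ((IsStationaryOn.univ hX h0 L).step hX hP hv hL (hrate L) j
      (zero_le (a := t))).measureReal_inter hX hS hSL
    simpa using h
  simp_rw [h2] at h1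
  have h3 := (hasSum_poissonWeight (mul_nonneg (M.v_pos 0 le_rfl).le t.coe_nonneg)).mul_right
    (P.real S)
  rw [h1.unique h3, one_mul]

/-- Increments of the flux along a sequence of times. -/
lemma isStationaryOn_increments (hL : 0 ≤ L) {t : ℕ → ℝ≥0} (ht : Monotone t) (i : ℕ) (j : ℕ → ℕ)
    (n : ℕ) :
    IsStationaryOn ℱ X I μ P L (t n) (i + ∑ k ∈ Finset.range n, j k)
      ({ω | flux X I L (t 0) ω = i} ∩
        {ω | ∀ k < n, flux X I L (t (k + 1)) ω - flux X I L (t k) ω = j k})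
      (poissonWeight (M.v 0 * t 0) i *
        ∏ k ∈ Finset.range n, poissonWeight (M.v 0 * (t (k + 1) - t k)) (j k)) := by
  induction n with
  | zero =>
    have h := (IsStationaryOn.univ hX h0 L).step hX hP hv hL (hrate L) i (zero_le (a := t 0))
    simpa using h
  | succ n ih =>
    have h := ih.step hX hP hv hL (hrate L) (j n) (ht n.le_succ)
    rw [Finset.sum_range_succ, Finset.prod_range_succ, ← add_assoc, ← mul_assoc]
    convert h using 1
    ext ω
    simp only [Set.mem_inter_iff, Set.mem_ofPred_eq, Nat.forall_lt_succ_right]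
    rw [← and_assoc]
    -- On the event of the first `n` increments the flux at `t n` is known, so prescribing the next
    -- increment means prescribing the next value.
    refine and_congr_right fun hω => ?_
    have hn := ih.flux_eq ω hω
    rw [hn]
    push_cast
    constructor <;> intro h <;> linarith

lemma measureReal_increments (hL : 0 ≤ L) {t : ℕ → ℝ≥0} (ht : Monotone t) (j : ℕ → ℕ) (n : ℕ) :
    μ.real {ω | ∀ k < n, flux X I L (t (k + 1)) ω - flux X I L (t k) ω = j k} =
      ∏ k ∈ Finset.range n, poissonWeight (M.v 0 * (t (k + 1) - t k)) (j k) := by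
  have := hP.isProbabilityMeasure
  have hN : ∀ s, Measurable (flux X I L s) := fun s => (hX.measurable_flux L s).mono (ℱ.le s) le_rfl
  have hE : MeasurableSet {ω | ∀ k < n, flux X I L (t (k + 1)) ω - flux X I L (t k) ω = j k} := by
    simp only [Set.ofPred_forall]
    exact MeasurableSet.iInter fun k => MeasurableSet.iInter fun _ =>
      ((hN (t (k + 1))).sub (hN (t k))) (measurableSet_singleton _)
  have h1 := hasSum_measureReal_fiber (μ := μ) (hN (t 0)) (hX.flux_nonneg hL _) hE
  have h2 : ∀ i : ℕ, μ.real ({ω | flux X I L (t 0) ω = i} ∩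
      {ω | ∀ k < n, flux X I L (t (k + 1)) ω - flux X I L (t k) ω = j k}) =
      poissonWeight (M.v 0 * t 0) i *
        ∏ k ∈ Finset.range n, poissonWeight (M.v 0 * (t (k + 1) - t k)) (j k) := by
    intro i
    have h := (isStationaryOn_increments hX hP hv hrate h0 hL ht i j n).measureReal_inter hX
      MeasurableSet.univ fun _ _ _ => Iff.rfl
    simpa using h
  simp_rw [h2] at h1
  have h3 := (hasSum_poissonWeight (mul_nonneg (M.v_pos 0 le_rfl).le
    (t 0).coe_nonneg)).mul_right
      (∏ k ∈ Finset.range n, poissonWeight (M.v 0 * (t (k + 1) - t k)) (j k))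
  rw [h1.unique h3, one_mul]

/-- The law of an increment of the flux. -/
lemma map_increment (hL : 0 ≤ L) {s t : ℝ≥0} (hst : s ≤ t) :
    μ.map (fun ω => flux X I L t ω - flux X I L s ω) =
      (poissonMeasure ((M.v 0).toNNReal * (t - s))).map (Nat.cast : ℕ → ℤ) := by
  have hN : ∀ s, Measurable (flux X I L s) := fun s => (hX.measurable_flux L s).mono (ℱ.le s) le_rfl
  have hm : Measurable fun ω => flux X I L t ω - flux X I L s ω := (hN t).sub (hN s)
  refine Measure.ext_of_singleton fun z => ?_
  rw [Measure.map_apply hm (measurableSet_singleton z),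
    Measure.map_apply measurable_from_nat (measurableSet_singleton z)]
  rcases le_or_gt 0 z with hz | hz
  · lift z to ℕ using hz
    have e : (Nat.cast : ℕ → ℤ) ⁻¹' {(z : ℤ)} = {z} := by
      ext k
      simp
    -- A single increment is the case `n = 1` for the times `s, t, t, …`.
    have hmono : Monotone fun k : ℕ => if k = 0 then s else t := by
      intro a b hab
      dsimp only
      split_ifs with h1 h2 h2
      · exact le_rfl
      · exact hst
      · omega
      · exact le_rfl
    have h := measureReal_increments hX hP hv hrate h0 hL hmono (fun _ => z) 1
    simp only [Nat.lt_one_iff, forall_eq, Nat.add_eq_zero_iff, one_ne_zero, and_false, if_false,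
      if_true, Finset.prod_range_one] at h
    rw [e, poissonMeasure_singleton, ← ofReal_measureReal (measure_ne_top _ _)]
    congr 1
    refine Eq.trans h ?_
    rw [poissonWeight, NNReal.coe_mul, Real.coe_toNNReal _ (M.v_pos 0 le_rfl).le,
      NNReal.coe_sub hst]
  · have e1 : (Nat.cast : ℕ → ℤ) ⁻¹' {z} = ∅ := by
      ext k
      simp only [Set.mem_preimage, Set.mem_singleton_iff, Set.mem_empty_iff_false, iff_false]
      omega
    have e2 : (fun ω => flux X I L t ω - flux X I L s ω) ⁻¹' {z} = ∅ := by
      ext ω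
      have h : flux X I L s ω ≤ flux X I L t ω := hX.flux_mono ω L hL hst
      simp only [Set.mem_preimage, Set.mem_singleton_iff, Set.mem_empty_iff_false, iff_false]
      omega
    rw [e1, e2, measure_empty, measure_empty]

/-- The increments are integer valued, so their joint law is determined by its values on singletons,
and these are the products of Poisson weights in `measureReal_increments`. -/
lemma hasIndepIncrements (hL : 0 ≤ L) : HasIndepIncrements (flux X I L) μ := by
  have hN : ∀ s, Measurable (flux X I L s) := fun s => (hX.measurable_flux L s).mono (ℱ.le s) le_rfl
  intro n t ht
  have hm : ∀ k : Fin n, Measurable fun ω => flux X I L (t k.succ) ω - flux X I L (t k.castSucc) ω :=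
    fun k => (hN _).sub (hN _)
  rw [iIndepFun_iff_map_fun_eq_pi_map fun k => (hm k).aemeasurable]
  refine Measure.ext_of_singleton fun z => ?_
  rw [Measure.map_apply (measurable_pi_lambda _ hm) (measurableSet_singleton z),
    Measure.pi_singleton]
  have hle : ∀ k : Fin n, t k.castSucc ≤ t k.succ := fun k => ht k.castSucc_le_succ
  simp_rw [map_increment hX hP hv hrate h0 hL (hle _)]
  by_cases hz : ∀ k, 0 ≤ z k
  · lift z to Fin n → ℕ using hz
    -- The finite sequence of times is continued as a constant, to fit the statement for sequences
    -- indexed by `ℕ`.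
    let t' : ℕ → ℝ≥0 := fun k => t ⟨min k n, by omega⟩
    let z' : ℕ → ℕ := fun k => if h : k < n then z ⟨k, h⟩ else 0
    have ht' : Monotone t' := fun a b hab => ht (Fin.mk_le_mk.2 (by omega))
    have h := measureReal_increments hX hP hv hrate h0 hL ht' z' n
    have hs : ∀ k : Fin n, t' (k + 1) = t k.succ := fun k => by
      simp only [t']
      congr 1
      ext
      simp
    have hc : ∀ k : Fin n, t' k = t k.castSucc := fun k => by
      simp only [t']
      congr 1
      ext
      simp
    have hz' : ∀ k : Fin n, z' k = z k := fun k => by simp [z']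
    rw [← Fin.prod_univ_eq_prod_range
      (fun k => poissonWeight (M.v 0 * (t' (k + 1) - t' k)) (z' k)) n] at h
    simp_rw [hs, hc, hz'] at h
    have e : (fun ω k => flux X I L (t (Fin.succ k)) ω - flux X I L (t (Fin.castSucc k)) ω) ⁻¹'
        {fun k => ((z k : ℕ) : ℤ)} =
        {ω | ∀ k < n, flux X I L (t' (k + 1)) ω - flux X I L (t' k) ω = z' k} := by
      ext ω
      simp only [Set.mem_preimage, Set.mem_singleton_iff, funext_iff, Set.mem_ofPred_eq]
      constructor
      · intro h k hk
        have := h ⟨k, hk⟩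
        rwa [← hs, ← hc, ← hz'] at this
      · intro h k
        have := h k k.2
        rwa [hs, hc, hz'] at this
    rw [e, ← ofReal_measureReal (measure_ne_top _ _), h, ENNReal.ofReal_prod_of_nonneg]
    · refine Finset.prod_congr rfl fun k _ => ?_
      have e : (Nat.cast : ℕ → ℤ) ⁻¹' {((z k : ℕ) : ℤ)} = {z k} := by
        ext l
        simp
      rw [Measure.map_apply measurable_from_nat (measurableSet_singleton _), e,
        poissonMeasure_singleton, poissonWeight, NNReal.coe_mul,
        Real.coe_toNNReal _ (M.v_pos 0 le_rfl).le, NNReal.coe_sub (hle k)]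
    · intro k _
      exact poissonWeight_nonneg (mul_nonneg (M.v_pos 0 le_rfl).le
        (sub_nonneg.2 (NNReal.coe_le_coe.2 (hle k)))) _
  -- A negative increment is impossible by monotonicity of the flux, and the corresponding factor of
  -- the product measure is zero.
  · push Not at hz
    obtain ⟨k, hk⟩ := hz
    have e1 : (Nat.cast : ℕ → ℤ) ⁻¹' {z k} = ∅ := by
      ext l
      simp only [Set.mem_preimage, Set.mem_singleton_iff, Set.mem_empty_iff_false, iff_false]
      omega
    have e2 : (fun ω k => flux X I L (t (Fin.succ k)) ω - flux X I L (t (Fin.castSucc k)) ω) ⁻¹'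
        {z} = ∅ := by
      ext ω
      have h : flux X I L (t k.castSucc) ω ≤ flux X I L (t k.succ) ω :=
        hX.flux_mono ω L hL (hle k)
      simp only [Set.mem_preimage, Set.mem_singleton_iff, Set.mem_empty_iff_false, iff_false]
      intro hω
      have h' : flux X I L (t k.succ) ω - flux X I L (t k.castSucc) ω = z k := congrFun hω k
      omega
    rw [Finset.prod_eq_zero (Finset.mem_univ k), e2, measure_empty]
    rw [Measure.map_apply measurable_from_nat (measurableSet_singleton _), e1, measure_empty]

theorem isPoissonProcess (hL : 0 ≤ L) :
    IsPoissonProcess (flux X I L) (M.v 0).toNNReal μ where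
  zero := Eventually.of_forall fun ω => hX.flux_zero L ω
  mono := Eventually.of_forall fun ω => hX.flux_mono ω L hL
  right_cont := Eventually.of_forall fun ω t => hX.flux_right_cont L ω t
  indep := hasIndepIncrements hX hP hv hrate h0 hL
  law _ _ hst := map_increment hX hP hv hrate h0 hL hst

end IsExpJumpProcess

end ExpJump

theorem mainTheorem11 (M : ExpJump.Params)
    (hv : ∀ y : ℝ, 0 < y → M.v 0 < M.v y)
    (hrate : ∀ R : ℝ, IntegrableOn (M.stackRate (M.v 0)) (Set.Ioc 0 R))
    {Ω : Type*} [mΩ : MeasurableSpace Ω] (μ : Measure Ω) [IsProbabilityMeasure μ]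
    (ℱ : Filtration ℝ≥0 mΩ) (X : ℝ≥0 → Ω → ExpJump.Config) (I : ℝ≥0 → Ω → ℕ)
    (hX : ExpJump.IsExpJumpProcess M μ ℱ X I)
    (P : Measure ExpJump.Config) (hP : M.IsInitialLaw (M.v 0) P)
    (h0 : μ.map (X 0) = P) :
    (∀ t : ℝ≥0, μ.map (X t) = P) ∧
    (∀ L : ℝ, 0 ≤ L → ExpJump.IsPoissonProcess (ExpJump.flux X I L) (M.v 0).toNNReal μ) :=
  ⟨hX.map_eq hP hv hrate h0, fun _ hL => hX.isPoissonProcess hP hv hrate h0 hL⟩
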